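/- Notation. For a real vector field $u\in L^2(\mathbb R^2;\mathbb R^2)$ let $\hat u(\xi)=(2\pi)^{-1}\int_{\mathbb R^2}e^{-i\xi\cdot x}u(x)\,dx$ (in the $L^2$ sense). For $s\ge 0$ let $$H^s=\Big\{u\in L^2(\mathbb R^2;\mathbb R^2):\ \xi\cdot\hat u(\xi)=0\text{ for a.e. }\xi,\ \ \|u\|_{H^s}^2:=\int_{\mathbb R^2}(1+|\xi|^2)^s|\hat u(\xi)|^2\,d\xi<\infty\Big\},$$ the Sobolev space of divergence-free fields. Let $\Pi$ be the Leray projector, i.e. the orthogonal projection of $L^2(\mathbb R^2;\mathbb R^2)$ onto $H^0$, let $A^\alpha$ and $e^{-\nu tA^\alpha}$ be the Fourier multipliers with symbols $(1+|\xi|^2)^\alpha$ and $e^{-\nu t(1+|\xi|^2)^\alpha}$, and let $B(u)=\Pi\big((u\cdot\nabla)u\big)$. Write $\mathbb R_+=[0,\infty)$. Theorem. Let $\nu>0$ and $\alpha>1$. For $x\in H^{2\alpha}$ and $z\in C(\mathbb R_+;H^{2\alpha})$ consider the problem $$v'+\nu A^\alpha v+B(v+z)=0\ \text{ on }(0,\infty),\qquad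 v(0)=x .$$ A function $v\in C(\mathbb R_+;H^{2\alpha})\cap L^2_{loc}(\mathbb R_+;H^{3\alpha})$ solves it in the mild sense if, in $H^{2\alpha}$, $$v(t)+\int_0^t e^{-\nu(t-s)A^\alpha}B(v(s)+z(s))\,ds=e^{-\nu tA^\alpha}x\qquad\text{for all }t\ge 0,$$ and in the strong sense if, in $H^\alpha$, $$v(t)+\nu\int_0^tA^\alpha v(s)\,ds+\int_0^tB(v(s)+z(s))\,ds=x\qquad\text{for all }t\ge 0.$$ (1) For every $x\in H^{2\alpha}$, $z\in C(\mathbb R_+;H^{2\alpha})$ and every $v\in C(\mathbb R_+;H^{2\alpha})\cap L^2_{loc}(\mathbb R_+;H^{3\alpha})$, all terms of both formulations are well defined (as Bochner integrals in $H^{2\alpha}$ and $H^{\alpha}$, respectively), and $v$ is a mild solution if and only if it is a strong solution. (2) For every $x\in H^{2\alpha}$ and $z\in C(\mathbb R_+;H^{2\alpha})$ there is a unique $v\in C(\mathbb R_+;H^{2\alpha})\cap L^2_{loc}(\mathbb R_+;H^{3\alpha})$ that solves the problem in the mild sense, equivalently in the strong sense. (3) The solution map $\mathcal V:(x,z)\mapsto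 v$ satisfies $\mathcal V(0,0)=0$, and for every $T>0$ and $R>0$ there is a constant $C=C(T,R,\nu,\alpha)>0$ such that, whenever $\|x_i\|_{H^{2\alpha}}\le R$ and $\sup_{t\in[0,T]}\|z_i(t)\|_{H^{2\alpha}}\le R$ for $i=1,2$, $$\sup_{t\in[0,T]}\|\mathcal V(x_1,z_1)(t)-\mathcal V(x_2,z_2)(t)\|_{H^{2\alpha}}^2+\int_0^T\|\mathcal V(x_1,z_1)(t)-\mathcal V(x_2,z_2)(t)\|_{H^{3\alpha}}^2\,dt\le C\Big(\|x_1-x_2\|_{H^{2\alpha}}^2+\sup_{t\in[0,T]}\|z_1(t)-z_2(t)\|_{H^{2\alpha}}^2\Big).$$ -/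

import Mathlib

open MeasureTheory FourierTransform
open scoped NNReal ENNReal

noncomputable section

namespace HyperNS

/-- The plane `ℝ²` with its Euclidean norm; also the values of real vector fields. -/
abbrev Plane : Type := EuclideanSpace ℝ (Fin 2)

/-- `ℂ²`, the values of Fourier transforms. -/
abbrev CPlane : Type := EuclideanSpace ℂ (Fin 2)

/-- `L²(ℝ²; ℝ²)`. -/
abbrev Field : Type := Lp Plane 2 (volume : Measure Plane)

/-- `L²(ℝ²; ℂ²)`. -/
abbrev CField : Type := Lp CPlane 2 (volume : Measure Plane)

/-- The inclusion `ℝ² → ℂ²`. -/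
def ofRealVec : Plane →L[ℝ] CPlane :=
  LinearMap.toContinuousLinearMap
    { toFun := fun v => WithLp.toLp 2 (fun i => ((v i : ℝ) : ℂ))
      map_add' := fun v w => by ext i; simp
      map_smul' := fun c v => by ext i; simp }

/-- The componentwise real part `ℂ² → ℝ²`. -/
def reVec : CPlane →L[ℝ] Plane :=
  LinearMap.toContinuousLinearMap
    { toFun := fun v => WithLp.toLp 2 (fun i => (v i).re)
      map_add' := fun v w => by ext i; simp
      map_smul' := fun c v => by ext i; simp }

/-- The Fourier transform `û` of a real field, with Mathlib's normalisation
`û(ξ) = ∫ exp(-2πi ξ·x) u(x) dx`.  A frequency `ξ` here is the frequency `2πξ` for the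
normalisation `(2π)⁻¹ ∫ exp(-i ξ·x) u(x) dx`. -/
def fourier : Field →L[ℝ] CField :=
  ((Lp.fourierTransformₗᵢ Plane CPlane).toContinuousLinearEquiv.toContinuousLinearMap.restrictScalars
    ℝ).comp (ofRealVec.compLpL 2 volume)

/-- The symbol `1 + |2πξ|²` of `A = 1 - Δ`. -/
def symbolA (ξ : Plane) : ℝ := 1 + (2 * Real.pi * ‖ξ‖) ^ 2

theorem symbolA_pos (ξ : Plane) : 0 < symbolA ξ := by
  unfold symbolA; positivity

theorem one_le_symbolA (ξ : Plane) : 1 ≤ symbolA ξ := by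
  unfold symbolA; nlinarith [sq_nonneg (2 * Real.pi * ‖ξ‖)]

theorem continuous_symbolA : Continuous symbolA := by
  unfold symbolA; fun_prop

/-- The space `H = H⁰` of divergence-free fields in `L²(ℝ²; ℝ²)`: `ξ · û(ξ) = 0` for a.e. `ξ`. -/
def divFree : Submodule ℝ Field where
  carrier := {u | ∀ᵐ ξ : Plane, ∑ i : Fin 2, ((ξ i : ℝ) : ℂ) * fourier u ξ i = 0}
  zero_mem' := by
    simp only [Set.mem_ofPred_eq, map_zero]
    filter_upwards with ξ
    simp
  add_mem' := by
    intro u v hu hv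
    simp only [Set.mem_ofPred_eq, map_add] at *
    filter_upwards [hu, hv, Lp.coeFn_add (fourier u) (fourier v)] with ξ h1 h2 h3
    rw [h3]
    simp only [Pi.add_apply, PiLp.add_apply, mul_add, Finset.sum_add_distrib, h1, h2, add_zero]
  smul_mem' := by
    intro c u hu
    simp only [Set.mem_ofPred_eq, map_smul] at *
    filter_upwards [hu, Lp.coeFn_smul c (fourier u)] with ξ h1 h3
    rw [h3]
    have : ∀ i : Fin 2, ((ξ i : ℝ) : ℂ) * (c • fourier u ξ) i
        = (c : ℂ) * (((ξ i : ℝ) : ℂ) * fourier u ξ i) := by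
      intro i
      simp only [PiLp.smul_apply, Complex.real_smul]
      ring
    simp only [Pi.smul_apply, this, ← Finset.mul_sum, h1, mul_zero]

theorem isClosed_divFree : IsClosed (divFree : Set Field) := by
  rw [← isSeqClosed_iff_isClosed]
  intro u w hu huw
  have h1 : Filter.Tendsto (fun n => fourier (u n)) Filter.atTop (nhds (fourier w)) :=
    (fourier.continuous.tendsto w).comp huw
  obtain ⟨φ, -, hφ⟩ := (tendstoInMeasure_of_tendsto_Lp h1).exists_seq_tendsto_ae
  have h2 : ∀ᵐ ξ : Plane, ∀ n, ∑ i : Fin 2, ((ξ i : ℝ) : ℂ) * fourier (u n) ξ i = 0 :=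
    ae_all_iff.2 hu
  show ∀ᵐ ξ : Plane, ∑ i : Fin 2, ((ξ i : ℝ) : ℂ) * fourier w ξ i = 0
  filter_upwards [hφ, h2] with ξ h3 h4
  have h5 : Filter.Tendsto (fun n => ∑ i : Fin 2, ((ξ i : ℝ) : ℂ) * fourier (u (φ n)) ξ i)
      Filter.atTop (nhds (∑ i : Fin 2, ((ξ i : ℝ) : ℂ) * fourier w ξ i)) := by
    refine tendsto_finsetSum _ fun i _ => Filter.Tendsto.const_mul _ ?_
    exact ((PiLp.continuous_apply 2 (fun _ : Fin 2 => ℂ) i).tendsto _).comp h3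
  simp only [h4] at h5
  exact (tendsto_const_nhds_iff.1 h5).symm

instance : CompleteSpace divFree := isClosed_divFree.completeSpace_coe

/-- The Leray projector: the orthogonal projection of `L²(ℝ²; ℝ²)` onto `H`. -/
def leray : Field →L[ℝ] Field := divFree.starProjection

/-- The weighted Fourier transform `ξ ↦ (1 + |2πξ|²)^{s/2} û(ξ)`. -/
def weighted (s : ℝ) (u : Field) (ξ : Plane) : CPlane := (symbolA ξ ^ (s / 2)) • fourier u ξ

/-- The elements of `H^s`, `s ≥ 0`, as a subspace of `L²(ℝ²; ℝ²)`. -/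
def sobolev (s : ℝ) : Submodule ℝ Field where
  carrier := {u | u ∈ divFree ∧ MemLp (weighted s u) 2 (volume : Measure Plane)}
  zero_mem' := by
    refine ⟨divFree.zero_mem, (memLp_congr_ae ?_).2 (MemLp.zero (ε := CPlane))⟩
    exact Filter.Eventually.of_forall fun ξ => by simp [weighted]
  add_mem' := by
    rintro u v ⟨hu, hu'⟩ ⟨hv, hv'⟩
    refine ⟨divFree.add_mem hu hv, (memLp_congr_ae ?_).2 (hu'.add hv')⟩
    filter_upwards [Lp.coeFn_add (fourier u) (fourier v)] with ξ h3
    simp only [weighted, map_add, Pi.add_apply, h3, smul_add]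
  smul_mem' := by
    rintro c u ⟨hu, hu'⟩
    refine ⟨divFree.smul_mem c hu, (memLp_congr_ae ?_).2 (hu'.const_smul c)⟩
    filter_upwards [Lp.coeFn_smul c (fourier u)] with ξ h3
    simp only [weighted, map_smul, Pi.smul_apply, h3, smul_comm c]

/-- The Sobolev space `H^s`, `s ≥ 0`, of divergence-free fields on `ℝ²`, as a normed space of its
own: its norm is `(∫ (1 + |2πξ|²)^s |û(ξ)|² dξ)^{1/2}`, not the `L²` norm. -/
def HDiv (s : ℝ) : Type := sobolev s

namespace HDiv

variable {s : ℝ}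

instance : AddCommGroup (HDiv s) := inferInstanceAs (AddCommGroup (sobolev s))

instance : Module ℝ (HDiv s) := inferInstanceAs (Module ℝ (sobolev s))

/-- The underlying `L²` field of an element of `H^s`. -/
def toField : HDiv s →ₗ[ℝ] Field := (sobolev s).subtype

/-- `u ↦ (1 + |2πξ|²)^{s/2} û`, as a map into `L²(ℝ²; ℂ²)`. -/
def weightedHat : HDiv s →ₗ[ℝ] CField where
  toFun u := (show MemLp (weighted s (toField u)) 2 volume from u.2.2).toLp _
  map_add' u v := by
    rw [← MemLp.toLp_add]
    refine MemLp.toLp_congr _ _ ?_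
    filter_upwards [Lp.coeFn_add (fourier (toField u)) (fourier (toField v))] with ξ h3
    simp only [weighted, map_add, Pi.add_apply, h3, smul_add]
  map_smul' c u := by
    rw [RingHom.id_apply, ← MemLp.toLp_const_smul]
    refine MemLp.toLp_congr _ _ ?_
    filter_upwards [Lp.coeFn_smul c (fourier (toField u))] with ξ h3
    simp only [weighted, map_smul, Pi.smul_apply, h3, smul_comm c]

theorem fourier_injective : Function.Injective fourier := by
  rw [injective_iff_map_eq_zero]
  intro u hu
  have h1 : ofRealVec.compLpL 2 volume u = 0 := by
    have : Lp.fourierTransformₗᵢ Plane CPlane (ofRealVec.compLpL 2 volume u) = 0 := hu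
    simpa using this
  refine (Lp.eq_zero_iff_ae_eq_zero).2 ?_
  have h2 := (Lp.eq_zero_iff_ae_eq_zero).1 h1
  filter_upwards [h2, ofRealVec.coeFn_compLpL (p := 2) (μ := volume) u] with x h3 h4
  rw [h3] at h4
  ext i
  have h5 := congrArg (fun w : CPlane => w i) h4
  simpa [ofRealVec] using h5.symm

theorem weightedHat_injective : Function.Injective (weightedHat (s := s)) := by
  rw [injective_iff_map_eq_zero]
  intro u hu
  have h1 : fourier (toField u) = 0 := by
    refine (Lp.eq_zero_iff_ae_eq_zero).2 ?_
    have h2 := (Lp.eq_zero_iff_ae_eq_zero).1 hu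
    have hm : MemLp (weighted s (toField u)) 2 volume := u.2.2
    filter_upwards [h2, hm.coeFn_toLp] with ξ h3 h4
    have h5 : weighted s (toField u) ξ = 0 := by
      rw [← h4]; exact h3
    have h6 : symbolA ξ ^ (s / 2) ≠ 0 := (Real.rpow_pos_of_pos (symbolA_pos ξ) _).ne'
    exact (smul_eq_zero.1 h5).resolve_left h6
  exact Subtype.ext (fourier_injective (h1.trans (map_zero fourier).symm))

instance : NormedAddCommGroup (HDiv s) :=
  NormedAddCommGroup.induced (HDiv s) CField weightedHat weightedHat_injective

instance : NormedSpace ℝ (HDiv s) := NormedSpace.induced ℝ (HDiv s) CField weightedHat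

theorem norm_fourier (u : Field) : ‖fourier u‖ = ‖u‖ := by
  have h1 : ‖fourier u‖ = ‖ofRealVec.compLpL 2 volume u‖ :=
    (Lp.fourierTransformₗᵢ Plane CPlane).norm_map _
  rw [h1, Lp.norm_def, Lp.norm_def]
  congr 1
  refine eLpNorm_congr_norm_ae ?_
  filter_upwards [ofRealVec.coeFn_compLpL (p := 2) (μ := volume) u] with x hx
  rw [hx]
  simp [ofRealVec, EuclideanSpace.norm_eq]

theorem norm_toField_le (hs : 0 ≤ s) (u : HDiv s) : ‖toField u‖ ≤ ‖u‖ := by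
  rw [← norm_fourier]
  show _ ≤ ‖weightedHat u‖
  refine Lp.norm_le_norm_of_ae_le ?_
  have hm : MemLp (weighted s (toField u)) 2 volume := u.2.2
  filter_upwards [hm.coeFn_toLp] with ξ h4
  have h5 : weightedHat u ξ = weighted s (toField u) ξ := h4
  have h6 : 1 ≤ symbolA ξ ^ (s / 2) := Real.one_le_rpow (one_le_symbolA ξ) (by positivity)
  rw [h5, weighted, norm_smul, Real.norm_of_nonneg (by positivity)]
  exact le_mul_of_one_le_left (norm_nonneg _) h6

/-- `H^s` is complete, so that Bochner integrals with values in it have their usual meaning. -/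
theorem completeSpace (hs : 0 ≤ s) : CompleteSpace (HDiv s) := by
  refine Metric.complete_of_cauchySeq_tendsto fun u hu => ?_
  have hc1 : CauchySeq fun n => weightedHat (u n) := by
    rw [Metric.cauchySeq_iff] at hu ⊢
    exact hu
  have hc2 : CauchySeq fun n => toField (u n) := by
    rw [Metric.cauchySeq_iff] at hu ⊢
    intro ε hε
    obtain ⟨N, hN⟩ := hu ε hε
    refine ⟨N, fun m hm n hn => lt_of_le_of_lt ?_ (hN m hm n hn)⟩
    rw [dist_eq_norm, dist_eq_norm, ← map_sub]
    exact norm_toField_le hs _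
  obtain ⟨g, hg⟩ := cauchySeq_tendsto_of_complete hc1
  obtain ⟨w, hw⟩ := cauchySeq_tendsto_of_complete hc2
  have hwd : w ∈ divFree :=
    isClosed_divFree.mem_of_tendsto hw (Filter.Eventually.of_forall fun n => (u n).2.1)
  obtain ⟨φ, hφm, hφ⟩ := (tendstoInMeasure_of_tendsto_Lp hg).exists_seq_tendsto_ae
  have hw1 : Filter.Tendsto (fun n => fourier (toField (u (φ n)))) Filter.atTop
      (nhds (fourier w)) := (fourier.continuous.tendsto w).comp (hw.comp hφm.tendsto_atTop)
  obtain ⟨ψ, hψm, hψ⟩ := (tendstoInMeasure_of_tendsto_Lp hw1).exists_seq_tendsto_ae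
  have hall : ∀ᵐ ξ : Plane, ∀ n, weightedHat (u n) ξ = weighted s (toField (u n)) ξ :=
    ae_all_iff.2 fun n =>
      (show MemLp (weighted s (toField (u n))) 2 volume from (u n).2.2).coeFn_toLp
  have hae : (g : Plane → CPlane) =ᵐ[volume] weighted s w := by
    filter_upwards [hφ, hψ, hall] with ξ h1 h2 h3
    have h4 := h1.comp hψm.tendsto_atTop
    have h5 := h2.const_smul (symbolA ξ ^ (s / 2))
    refine tendsto_nhds_unique h4 (h5.congr fun n => ?_)
    exact (h3 _).symm
  have hws : MemLp (weighted s w) 2 volume := (memLp_congr_ae hae).1 (Lp.memLp g)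
  obtain ⟨w', hgw⟩ : ∃ w' : HDiv s, weightedHat w' = g :=
    ⟨(⟨w, ⟨hwd, hws⟩⟩ : sobolev s), Lp.ext (hws.coeFn_toLp.trans hae.symm)⟩
  refine ⟨w', ?_⟩
  rw [tendsto_iff_norm_sub_tendsto_zero] at hg ⊢
  refine hg.congr fun n => ?_
  rw [← hgw, ← map_sub]
  rfl

end HDiv

open Classical in
/-- An `L²` field regarded as an element of `H^s` (and `0` if it does not belong to `H^s`). -/
def toHDiv (s : ℝ) (u : Field) : HDiv s := if h : u ∈ sobolev s then ⟨u, h⟩ else 0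

instance (s : ℝ) : CoeOut (HDiv s) Field := ⟨HDiv.toField⟩

open Classical in
/-- The real field whose Fourier transform is the square integrable function `g` (`0` if `g` is not
square integrable).  All functions `g` used below satisfy `g(-ξ) = conj g(ξ)`, so that taking the
real part changes nothing. -/
def invFourier (g : Plane → CPlane) : Field :=
  if h : MemLp g 2 (volume : Measure Plane) then
    reVec.compLpL 2 volume ((Lp.fourierTransformₗᵢ Plane CPlane).symm (h.toLp g))
  else 0

/-- The hyperviscous Stokes operator `A^α`, of symbol `(1 + |2πξ|²)^α`. -/
def stokesPow (α : ℝ) (u : Field) : Field :=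
  invFourier fun ξ => (symbolA ξ ^ α) • fourier u ξ

/-- The semigroup `exp(-ν t A^α)`, of symbol `exp(-ν t (1 + |2πξ|²)^α)`. -/
def semigroup (ν α t : ℝ) (u : Field) : Field :=
  invFourier fun ξ => Real.exp (-(ν * t * symbolA ξ ^ α)) • fourier u ξ

/-- The weak partial derivative `∂ᵢ v`, of symbol `2πi ξᵢ`. -/
def partialDeriv (i : Fin 2) (v : Field) : Field :=
  invFourier fun ξ => (2 * Real.pi * Complex.I * ((ξ i : ℝ) : ℂ)) • fourier v ξ

/-- `(u · ∇) v = ∑ᵢ uᵢ ∂ᵢ v`. -/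
def advection (u v : Field) (x : Plane) : Plane := ∑ i : Fin 2, (u x i) • partialDeriv i v x

open Classical in
/-- The bilinear operator `B(u, v) = Π (u · ∇) v`, for `(u · ∇) v` square integrable. -/
def bilinB (u v : Field) : Field :=
  if h : MemLp (advection u v) 2 (volume : Measure Plane) then leray (h.toLp _) else 0

/-- The Navier-Stokes nonlinearity `B(u) = B(u, u)`. -/
def nonlinB (u : Field) : Field := bilinB u u

/-- `v ∈ L²_loc(ℝ₊; H^r)` for a curve `v` in `H^s`. -/
def IsL2Loc {s : ℝ} (r : ℝ) (v : C(ℝ≥0, HDiv s)) : Prop :=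
  (∀ᵐ t : ℝ, 0 ≤ t → (v t.toNNReal : Field) ∈ sobolev r) ∧
    ∀ T : ℝ, 0 < T →
      MemLp (fun t : ℝ => toHDiv r (v t.toNNReal)) 2 (volume.restrict (Set.Ioc 0 T))

/-- The class `C(ℝ₊; H^{2α}) ∩ L²_loc(ℝ₊; H^{3α})`. -/
def InClass (α : ℝ) (v : C(ℝ≥0, HDiv (2 * α))) : Prop := IsL2Loc (3 * α) v

/-- `B(v(s) + z(s))` at time `s ≥ 0`. -/
def nonlinTerm {α : ℝ} (z v : C(ℝ≥0, HDiv (2 * α))) (s : ℝ) : Field :=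
  nonlinB (v s.toNNReal + z s.toNNReal : HDiv (2 * α))

/-- All the terms of the strong formulation make sense in `H^α`: `A^α v(s)` for almost every `s`,
`B(v(s) + z(s))` for every `s`, and both are locally Bochner integrable. -/
def StrongTermsWellDefined (α : ℝ) (z v : C(ℝ≥0, HDiv (2 * α))) : Prop :=
  (∀ t : ℝ≥0, (v t : Field) ∈ sobolev α) ∧
  (∀ᵐ s : ℝ, 0 ≤ s →
    MemLp (fun ξ => (symbolA ξ ^ α) • fourier (v s.toNNReal) ξ) 2 (volume : Measure Plane) ∧
    stokesPow α (v s.toNNReal) ∈ sobolev α) ∧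
  (∀ s : ℝ, 0 ≤ s →
    MemLp (advection (v s.toNNReal + z s.toNNReal : HDiv (2 * α))
      (v s.toNNReal + z s.toNNReal : HDiv (2 * α))) 2 (volume : Measure Plane) ∧
    nonlinTerm z v s ∈ sobolev α) ∧
  ∀ t : ℝ≥0,
    IntervalIntegrable (fun s => toHDiv α (stokesPow α (v s.toNNReal))) volume 0 t ∧
    IntervalIntegrable (fun s => toHDiv α (nonlinTerm z v s)) volume 0 t

/-- All the terms of the mild formulation make sense in `H^{2α}`. -/
def MildTermsWellDefined (ν α : ℝ) (x : HDiv (2 * α)) (z v : C(ℝ≥0, HDiv (2 * α))) : Prop :=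
  ∀ t : ℝ≥0, semigroup ν α t x ∈ sobolev (2 * α) ∧
    (∀ s : ℝ, 0 ≤ s → s < t → semigroup ν α (t - s) (nonlinTerm z v s) ∈ sobolev (2 * α)) ∧
    IntervalIntegrable (fun s => toHDiv (2 * α) (semigroup ν α (t - s) (nonlinTerm z v s)))
      volume 0 t

/-- The mild formulation of `v' + ν A^α v + B(v + z) = 0`, `v(0) = x`, an identity in `H^{2α}`. -/
def SolvesMild (ν α : ℝ) (x : HDiv (2 * α)) (z v : C(ℝ≥0, HDiv (2 * α))) : Prop :=
  ∀ t : ℝ≥0,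
    v t + ∫ s in (0 : ℝ)..t, toHDiv (2 * α) (semigroup ν α (t - s) (nonlinTerm z v s))
      = toHDiv (2 * α) (semigroup ν α t x)

/-- The strong formulation of `v' + ν A^α v + B(v + z) = 0`, `v(0) = x`, an identity in `H^α`. -/
def SolvesStrong (ν α : ℝ) (x : HDiv (2 * α)) (z v : C(ℝ≥0, HDiv (2 * α))) : Prop :=
  ∀ t : ℝ≥0,
    toHDiv α (v t) + ν • (∫ s in (0 : ℝ)..t, toHDiv α (stokesPow α (v s.toNNReal)))
      + ∫ s in (0 : ℝ)..t, toHDiv α (nonlinTerm z v s) = toHDiv α x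

/-- `sup_{t ∈ [0,T]} ‖f(t)‖²` in `H^s`. -/
def supSq {s : ℝ} (T : ℝ≥0) (f : C(ℝ≥0, HDiv s)) : ℝ := ⨆ t : Set.Icc (0 : ℝ≥0) T, ‖f t‖ ^ 2

/-- `∫₀ᵀ ‖f(t)‖² dt` in `H^r`, for a curve `f` in `H^s` of class `L²_loc(ℝ₊; H^r)`. -/
def intSq {s : ℝ} (r : ℝ) (T : ℝ≥0) (f : C(ℝ≥0, HDiv s)) : ℝ :=
  ∫ t in (0 : ℝ)..T, ‖toHDiv r (f t.toNNReal)‖ ^ 2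

end HyperNS

end

/-! Put Λ = A^α and use the coordinates w = A^α v and F = A^{α/2} B(v + z), both with values in the
single Hilbert space X = H⁰ (`divFree`). The problem becomes w' + νΛw + Λ^{1/2}F = 0 with Λ ≥ 1
self-adjoint, and the norms of v in H^{3α}, H^{2α}, H^α and L² are the X-norms of Λ^{1/2}w, w,
Λ^{-1/2}w and Λ^{-1}w. Only Λ^{-1/2} (`invRoot`) is a bounded operator, so membership in H^{3α} is
expressed by solving Λ^{-1/2}Y = w.

Linear theory. A bounded Borel functional calculus (`SymbolCalculus`) supplies the spectral
projections onto {λ ≤ N}. Each truncation of a mild solution solves an ODE with bounded generator,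
where Duhamel's formula and the energy identity are elementary, and N → ∞ then gives ‖w(t)‖² +
ν∫‖Λ^{1/2}w‖² ≤ ‖x‖² + ν⁻¹∫‖F‖² (`exists_root_mild`), continuity of w (`continuousOn_mild`), the
equivalence of both formulations (`strong_iff_mild`) and the L² energy identity for v
(`low_energy_mild`). In particular every continuous mild solution lies in L²_loc(H^{3α}), so
existence and uniqueness can be treated in C(ℝ₊; H^{2α}) alone.

Nonlinearity. Two facts carry it: the estimate ‖B(u,v)‖_{H^α} ≤ K‖u‖_{H^α}‖v‖_{H^{2α}}
(`sobolevSq_bilinB_le`), a weighted Young inequality for Fourier transforms in which α > 1 makes û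
and the transform of ∇v integrable; and the cancellation (B(u,v), v) = 0 (`inner_bilinB_self`). By
the cancellation, the L² energy identity sees only B(v+z, z), and bounds v in L^∞(L²) ∩ L²(H^α).
Since the estimate is linear in the H^α norm of its first argument, ‖v‖²_{H^α}, now known to be
integrable in time, becomes a Gronwall coefficient for ‖v‖²_{H^{2α}} (`exists_apriori_bound`).

Global solutions come from a nonlinearity made bounded and Lipschitz by a radial retraction
(`exists_mild_of_lipschitz`). The retraction amounts to a scalar damping with values in [0,1], which
the a priori bound does not notice; a large enough radius makes it inactive (`exists_isMild`).
Uniqueness and the Lipschitz estimate follow from `mild_stability` on bounded sets. -/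

noncomputable section

namespace HyperNS

open Filter Topology Set

/-! ### Duhamel's formula for a bounded generator. -/

section BoundedGenerator

variable {X : Type*} [NormedAddCommGroup X] [NormedSpace ℝ X] [CompleteSpace X]

/-- Variation of constants for a bounded generator `-L` with (possibly degenerate) group `E`. -/
theorem hasDerivAt_duhamel {E : ℝ → X →L[ℝ] X} {L : X →L[ℝ] X}
    (hE : ∀ t, HasDerivAt E (-(L ∘L E t)) t)
    (hmul : ∀ s t, E (s + t) = E s ∘L E t) {f : ℝ → X} (hf : Continuous f)
    (hEf : ∀ t, E 0 (f t) = f t) (y₀ : X) (t : ℝ) :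
    HasDerivAt (fun t => E t y₀ - ∫ s in (0 : ℝ)..t, E (t - s) (f s))
      (-(L (E t y₀ - ∫ s in (0 : ℝ)..t, E (t - s) (f s))) - f t) t := by
  have hEc : Continuous E := continuous_iff_continuousAt.2 fun t => (hE t).continuousAt
  have hg : Continuous fun s => E (-s) (f s) := (hEc.comp continuous_neg).clm_apply hf
  -- The group law pulls E t out of the integral, so that t enters through a product; this uses E at
  -- negative times.
  have hint : ∀ t, ∫ s in (0 : ℝ)..t, E (t - s) (f s) = E t (∫ s in (0 : ℝ)..t, E (-s) (f s)) := by
    intro t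
    rw [← (E t).intervalIntegral_comp_comm (hg.intervalIntegrable _ _)]
    refine intervalIntegral.integral_congr fun s _ => ?_
    simp only [sub_eq_add_neg, hmul, ContinuousLinearMap.comp_apply]
  have h1 : HasDerivAt (fun t => ∫ s in (0 : ℝ)..t, E (-s) (f s)) (E (-t) (f t)) t :=
    intervalIntegral.integral_hasDerivAt_right (hg.intervalIntegrable _ _)
      (hg.stronglyMeasurableAtFilter _ _) hg.continuousAt
  have h2 : HasDerivAt (fun t => E t (y₀ - ∫ s in (0 : ℝ)..t, E (-s) (f s))) _ t :=
    (hE t).clm_apply (h1.const_sub y₀)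
  have h3 : ∀ t, E t y₀ - ∫ s in (0 : ℝ)..t, E (t - s) (f s)
      = E t (y₀ - ∫ s in (0 : ℝ)..t, E (-s) (f s)) := fun t => by rw [hint, map_sub]
  simp only [h3]
  convert h2 using 1
  have h4 : E t (E (-t) (f t)) = f t := by
    rw [← ContinuousLinearMap.comp_apply, ← hmul, add_neg_cancel, hEf]
  simp only [neg_apply, ContinuousLinearMap.comp_apply, map_neg, h4]
  abel

/-- Uniqueness by the integrating factor E(-s): applied to the difference of the two candidates it
gives a function of zero derivative. This determines the difference only up to the kernel of the
projection E 0, whence the assumption that E 0 fixes y and f. -/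
theorem eq_duhamel_of_integral_eq {E : ℝ → X →L[ℝ] X} {L : X →L[ℝ] X}
    (hE : ∀ t, HasDerivAt E (-(L ∘L E t)) t) (hcomm : ∀ t, L ∘L E t = E t ∘L L)
    (hmul : ∀ s t, E (s + t) = E s ∘L E t) {f : ℝ → X} (hf : Continuous f)
    (hEf : ∀ t, E 0 (f t) = f t) {y₀ : X} {y : ℝ → X} (hy : Continuous y)
    (hEy : ∀ t, E 0 (y t) = y t)
    (h : ∀ t, 0 ≤ t → y t + ∫ s in (0 : ℝ)..t, (L (y s) + f s) = E 0 y₀) {t : ℝ} (ht : 0 ≤ t) :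
    y t = E t y₀ - ∫ s in (0 : ℝ)..t, E (t - s) (f s) := by
  set ζ : ℝ → X := fun t => E t y₀ - ∫ s in (0 : ℝ)..t, E (t - s) (f s) with hζ
  have hdζ : ∀ t, HasDerivAt ζ (-(L (ζ t)) - f t) t := hasDerivAt_duhamel hE hmul hf hEf y₀
  -- Y agrees with y for t ≥ 0 and is differentiable on all of ℝ, which spares one-sided derivatives
  -- at 0.
  set Y : ℝ → X := fun t => E 0 y₀ - ∫ s in (0 : ℝ)..t, (L (y s) + f s) with hY
  have hYy : ∀ t, 0 ≤ t → Y t = y t := fun t ht => by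
    rw [hY]; simp only; rw [← h t ht]; abel
  have hc : Continuous fun s => L (y s) + f s := (L.continuous.comp hy).add hf
  have hdY : ∀ t, HasDerivAt Y (-(L (y t) + f t)) t := fun t =>
    (intervalIntegral.integral_hasDerivAt_right (hc.intervalIntegrable _ _)
      (hc.stronglyMeasurableAtFilter _ _) hc.continuousAt).const_sub _
  have hd : ∀ s, HasDerivAt (fun s => E (-s) (Y s - ζ s))
      (E (-s) (L (Y s - ζ s)) + E (-s) (-(L (y s) + f s) - (-(L (ζ s)) - f s))) s := by
    intro s
    have h1 : HasDerivAt (fun s => E (-s)) (E (-s) ∘L L) s := by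
      have := (hE (-s)).scomp s (hasDerivAt_neg s)
      simpa [hcomm, Function.comp_def] using this
    simpa using h1.clm_apply ((hdY s).sub (hdζ s))
  have hconst := constant_of_has_deriv_right_zero (f := fun s => E (-s) (Y s - ζ s)) (a := 0)
    (b := t) (fun s _ => (hd s).continuousAt.continuousWithinAt) (fun s hs => by
      refine HasDerivAt.hasDerivWithinAt ?_
      convert hd s using 1
      rw [← map_add, ← hYy s hs.1]
      have : L (Y s - ζ s) + (-(L (Y s) + f s) - (-(L (ζ s)) - f s)) = 0 := by
        rw [map_sub]; abel
      rw [this, map_zero])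
  have h0 : Y 0 - ζ 0 = 0 := by simp [hY, hζ]
  have h1 := hconst t ⟨ht, le_rfl⟩
  simp only [h0, map_zero] at h1
  have h2 : E 0 (Y t - ζ t) = 0 := by
    have : E t (E (-t) (Y t - ζ t)) = E 0 (Y t - ζ t) := by
      rw [← ContinuousLinearMap.comp_apply, ← hmul, add_neg_cancel]
    rw [← this, h1, map_zero]
  have hE0 : ∀ t, E 0 (E t y₀) = E t y₀ := fun t => by
    rw [← ContinuousLinearMap.comp_apply, ← hmul, zero_add]
  have hEc : Continuous E := continuous_iff_continuousAt.2 fun t => (hE t).continuousAt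
  have h3 : E 0 (ζ t) = ζ t := by
    have hg : Continuous fun s => E (t - s) (f s) :=
      (hEc.comp (continuous_const.sub continuous_id)).clm_apply hf
    simp only [hζ, map_sub, hE0]
    rw [← (E 0).intervalIntegral_comp_comm (hg.intervalIntegrable _ _)]
    simp only [← ContinuousLinearMap.comp_apply, ← hmul, zero_add]
  rw [map_sub, hYy t ht, hEy, h3] at h2
  exact sub_eq_zero.1 h2

end BoundedGenerator

/-! ### Bounded functional calculus and spectral truncation. -/

/-- Measurable functions which are bounded on `[1, ∞)`. -/
def IsBddSymbol (φ : ℝ → ℝ) : Prop := Measurable φ ∧ ∃ C, ∀ x, 1 ≤ x → |φ x| ≤ C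

theorem IsBddSymbol.mul {φ ψ : ℝ → ℝ} (hφ : IsBddSymbol φ) (hψ : IsBddSymbol ψ) :
    IsBddSymbol fun x => φ x * ψ x := by
  obtain ⟨h1, C, hC⟩ := hφ
  obtain ⟨h2, D, hD⟩ := hψ
  refine ⟨h1.mul h2, C * D, fun x hx => ?_⟩
  rw [abs_mul]
  exact mul_le_mul (hC x hx) (hD x hx) (abs_nonneg _) ((abs_nonneg _).trans (hC x hx))

theorem IsBddSymbol.add {φ ψ : ℝ → ℝ} (hφ : IsBddSymbol φ) (hψ : IsBddSymbol ψ) :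
    IsBddSymbol fun x => φ x + ψ x := by
  obtain ⟨h1, C, hC⟩ := hφ
  obtain ⟨h2, D, hD⟩ := hψ
  exact ⟨h1.add h2, C + D, fun x hx => (abs_add_le _ _).trans (add_le_add (hC x hx) (hD x hx))⟩

theorem IsBddSymbol.const_mul {φ : ℝ → ℝ} (hφ : IsBddSymbol φ) (c : ℝ) :
    IsBddSymbol fun x => c * φ x :=
  IsBddSymbol.mul ⟨measurable_const, |c|, fun _ _ => le_rfl⟩ hφ

theorem isBddSymbol_one : IsBddSymbol fun _ => 1 := ⟨measurable_const, 1, by simp⟩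

/-- A bounded Borel functional calculus for a self-adjoint operator bounded below by `1`. -/
structure SymbolCalculus (X : Type*) [NormedAddCommGroup X] [InnerProductSpace ℝ X] where
  /-- The operator with symbol `φ`. -/
  op : (ℝ → ℝ) → X →L[ℝ] X
  op_one : op (fun _ => 1) = ContinuousLinearMap.id ℝ X
  op_mul : ∀ {φ ψ : ℝ → ℝ}, IsBddSymbol φ → IsBddSymbol ψ →
    op (fun x => φ x * ψ x) = op φ ∘L op ψ
  op_add : ∀ {φ ψ : ℝ → ℝ}, IsBddSymbol φ → IsBddSymbol ψ →
    op (fun x => φ x + ψ x) = op φ + op ψ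
  op_const_mul : ∀ {φ : ℝ → ℝ} (c : ℝ), IsBddSymbol φ → op (fun x => c * φ x) = c • op φ
  norm_op_le : ∀ {φ : ℝ → ℝ} {c : ℝ}, Measurable φ → 0 ≤ c → (∀ x, 1 ≤ x → |φ x| ≤ c) →
    ‖op φ‖ ≤ c
  inner_op : ∀ {φ : ℝ → ℝ}, IsBddSymbol φ → ∀ u v : X, inner ℝ (op φ u) v = inner ℝ u (op φ v)
  tendsto_op : ∀ {φ : ℕ → ℝ → ℝ} {ψ : ℝ → ℝ} {c : ℝ}, (∀ n, Measurable (φ n)) → Measurable ψ →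
    (∀ n x, 1 ≤ x → |φ n x| ≤ c) → (∀ x, 1 ≤ x → Tendsto (fun n => φ n x) atTop (𝓝 (ψ x))) →
    ∀ u : X, Tendsto (fun n => op (φ n) u) atTop (𝓝 (op ψ u))

namespace SymbolCalculus

variable {X : Type*} [NormedAddCommGroup X] [InnerProductSpace ℝ X] (C : SymbolCalculus X)

theorem op_comp {φ ψ : ℝ → ℝ} (hφ : IsBddSymbol φ) (hψ : IsBddSymbol ψ) (u : X) :
    C.op φ (C.op ψ u) = C.op (fun x => φ x * ψ x) u := by
  rw [C.op_mul hφ hψ]; rfl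

theorem op_comm {φ ψ : ℝ → ℝ} (hφ : IsBddSymbol φ) (hψ : IsBddSymbol ψ) (u : X) :
    C.op φ (C.op ψ u) = C.op ψ (C.op φ u) := by
  rw [op_comp C hφ hψ, op_comp C hψ hφ]; simp only [mul_comm]

/-- The difference of the symbols is bounded by 0 on [1, ∞), so its operator has norm 0. Symbols can
thus be simplified with x ≥ 1 at hand, for instance √x ≠ 0. -/
theorem op_congr {φ ψ : ℝ → ℝ} (hφ : IsBddSymbol φ) (hψ : IsBddSymbol ψ)
    (h : ∀ x, 1 ≤ x → φ x = ψ x) : C.op φ = C.op ψ := by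
  have h1 : C.op (fun x => φ x + -1 * ψ x) = C.op φ - C.op ψ := by
    rw [C.op_add hφ (hψ.const_mul _), C.op_const_mul _ hψ]; simp [sub_eq_add_neg]
  have h2 : ‖C.op (fun x => φ x + -1 * ψ x)‖ ≤ 0 :=
    C.norm_op_le (hφ.add (hψ.const_mul _)).1 le_rfl fun x hx => by simp [h x hx]
  rw [h1] at h2
  exact sub_eq_zero.1 (norm_le_zero_iff.1 h2)

theorem norm_op_apply_le {φ : ℝ → ℝ} {c : ℝ} (hφ : Measurable φ) (hc : 0 ≤ c)
    (h : ∀ x, 1 ≤ x → |φ x| ≤ c) (u : X) : ‖C.op φ u‖ ≤ c * ‖u‖ :=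
  ((C.op φ).le_opNorm u).trans (mul_le_mul_of_nonneg_right (C.norm_op_le hφ hc h) (norm_nonneg _))

/-- The indicator function of `{x ≤ N}`. -/
def cutoff (N : ℕ) (x : ℝ) : ℝ := if x ≤ N then 1 else 0

theorem measurable_cutoff (N : ℕ) : Measurable (cutoff N) :=
  Measurable.ite measurableSet_Iic measurable_const measurable_const

theorem abs_cutoff_le (N : ℕ) (x : ℝ) : |cutoff N x| ≤ 1 := by
  unfold cutoff; split_ifs <;> simp

theorem cutoff_mul_self (N : ℕ) (x : ℝ) : cutoff N x * cutoff N x = cutoff N x := by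
  unfold cutoff; split_ifs <;> simp

theorem isBddSymbol_cutoff (N : ℕ) : IsBddSymbol (cutoff N) :=
  ⟨measurable_cutoff N, 1, fun x _ => abs_cutoff_le N x⟩

theorem isBddSymbol_cutoff_mul (N : ℕ) {φ : ℝ → ℝ} (hφ : Continuous φ) :
    IsBddSymbol fun x => cutoff N x * φ x := by
  obtain ⟨B, hB⟩ := (isCompact_Icc (a := (1 : ℝ)) (b := N)).exists_bound_of_continuousOn
    hφ.continuousOn
  refine ⟨(measurable_cutoff N).mul hφ.measurable, max B 0, fun x hx => ?_⟩
  simp only [cutoff]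
  split_ifs with h
  · rw [one_mul]; exact (hB x ⟨hx, h⟩).trans (le_max_left _ _)
  · simp

theorem tendsto_cutoff (x : ℝ) : Tendsto (fun N => cutoff N x) atTop (𝓝 1) := by
  refine tendsto_const_nhds.congr' ?_
  filter_upwards [eventually_ge_atTop ⌈x⌉₊] with N hN
  rw [cutoff, if_pos ((Nat.le_ceil x).trans (by exact_mod_cast hN))]

theorem tendsto_op_cutoff (u : X) :
    Tendsto (fun N => C.op (cutoff N) u) atTop (𝓝 u) := by
  have := C.tendsto_op measurable_cutoff measurable_const (fun n x _ => abs_cutoff_le n x)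
    (fun x _ => tendsto_cutoff x) u
  rwa [C.op_one] at this

theorem norm_op_cutoff_le (N : ℕ) (u : X) : ‖C.op (cutoff N) u‖ ≤ ‖u‖ := by
  simpa using C.norm_op_apply_le (measurable_cutoff N) zero_le_one
    (fun x _ => abs_cutoff_le N x) u

/-- The truncated group `exp(-ν t λ)` on `{λ ≤ N}`. -/
def group (ν : ℝ) (N : ℕ) (t : ℝ) : X →L[ℝ] X :=
  C.op fun x => cutoff N x * Real.exp (-(ν * t * x))

/-- The truncated square root of the generator. -/
def rootCut (N : ℕ) : X →L[ℝ] X := C.op fun x => cutoff N x * √x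

/-- The truncated generator. -/
def genCut (N : ℕ) : X →L[ℝ] X := C.op fun x => cutoff N x * x

theorem isBddSymbol_group (ν : ℝ) (N : ℕ) (t : ℝ) :
    IsBddSymbol fun x => cutoff N x * Real.exp (-(ν * t * x)) :=
  isBddSymbol_cutoff_mul N (by fun_prop)

theorem isBddSymbol_rootCut (N : ℕ) : IsBddSymbol fun x => cutoff N x * √x :=
  isBddSymbol_cutoff_mul N (by fun_prop)

theorem isBddSymbol_genCut (N : ℕ) : IsBddSymbol fun x => cutoff N x * x :=
  isBddSymbol_cutoff_mul N (by fun_prop)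

/-- The truncated group is degenerate: at time 0 it is a spectral projection and not the identity,
which is why the Duhamel lemmas only ask E 0 to fix the relevant vectors. -/
theorem group_zero (ν : ℝ) (N : ℕ) : C.group ν N 0 = C.op (cutoff N) := by
  simp [group]

theorem group_add (ν : ℝ) (N : ℕ) (s t : ℝ) :
    C.group ν N (s + t) = C.group ν N s ∘L C.group ν N t := by
  unfold group
  rw [← C.op_mul (isBddSymbol_group ν N s) (isBddSymbol_group ν N t)]
  congr 1
  ext x
  rw [mul_mul_mul_comm, cutoff_mul_self, ← Real.exp_add]
  ring_nf

theorem genCut_comp_group (ν : ℝ) (N : ℕ) (t : ℝ) :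
    (ν • C.genCut N) ∘L C.group ν N t
      = C.op fun x => ν * (cutoff N x * (x * Real.exp (-(ν * t * x)))) := by
  rw [C.op_const_mul ν (isBddSymbol_cutoff_mul N (by fun_prop)), ContinuousLinearMap.smul_comp,
    genCut, group, ← C.op_mul (isBddSymbol_genCut N) (isBddSymbol_group ν N t)]
  congr 2
  ext x
  rw [mul_mul_mul_comm, cutoff_mul_self]

theorem group_comm (ν : ℝ) (N : ℕ) (t : ℝ) :
    (ν • C.genCut N) ∘L C.group ν N t = C.group ν N t ∘L (ν • C.genCut N) := by
  ext u
  simp only [ContinuousLinearMap.comp_apply, smul_apply, map_smul]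
  rw [genCut, group, C.op_comm (isBddSymbol_genCut N) (isBddSymbol_group ν N t)]

/-- Norm differentiability reduces to a scalar estimate: the Taylor remainder is itself an operator
of the calculus, and on {λ ≤ N} its symbol is at most B(νhN)² once |νhN| < 1. -/
theorem hasDerivAt_group (ν : ℝ) (N : ℕ) (t : ℝ) :
    HasDerivAt (C.group ν N) (-((ν • C.genCut N) ∘L C.group ν N t)) t := by
  rw [hasDerivAt_iff_isLittleO_nhds_zero]
  have hb1 := isBddSymbol_cutoff_mul N (φ := fun x => x * Real.exp (-(ν * t * x))) (by fun_prop)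
  have key : ∀ h, C.group ν N (t + h) - C.group ν N t - h • -((ν • C.genCut N) ∘L C.group ν N t)
      = C.op fun x => cutoff N x * (Real.exp (-(ν * t * x))
        * (Real.exp (-(ν * h * x)) - 1 - (-(ν * h * x)))) := by
    intro h
    rw [genCut_comp_group, group, group]
    have e1 : (fun x => cutoff N x * (Real.exp (-(ν * t * x))
        * (Real.exp (-(ν * h * x)) - 1 - (-(ν * h * x)))))
        = fun x => (cutoff N x * Real.exp (-(ν * (t + h) * x))
          + (-1) * (cutoff N x * Real.exp (-(ν * t * x))))
          + h * (ν * (cutoff N x * (x * Real.exp (-(ν * t * x))))) := by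
      ext x
      rw [show -(ν * (t + h) * x) = -(ν * t * x) + -(ν * h * x) by ring, Real.exp_add]
      ring
    rw [e1, C.op_add (((isBddSymbol_group ν N _)).add ((isBddSymbol_group ν N t).const_mul _))
      ((hb1.const_mul ν).const_mul h),
      C.op_add (isBddSymbol_group ν N _) ((isBddSymbol_group ν N t).const_mul _),
      C.op_const_mul _ (isBddSymbol_group ν N t), C.op_const_mul _ (hb1.const_mul ν)]
    simp [sub_eq_add_neg]
  simp only [key]
  obtain ⟨hm, B, hB⟩ := isBddSymbol_group ν N t
  have hB0 : 0 ≤ B := (abs_nonneg _).trans (hB 1 le_rfl)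
  refine Asymptotics.IsBigO.trans_isLittleO (g := fun h : ℝ => h ^ 2) ?_
    (Asymptotics.isLittleO_pow_id one_lt_two)
  refine Asymptotics.IsBigO.of_bound (B * (ν * N) ^ 2) ?_
  have hsmall : ∀ᶠ h : ℝ in 𝓝 0, |ν * h * N| < 1 := by
    have : Continuous fun h : ℝ => |ν * h * N| := by fun_prop
    refine this.continuousAt.eventually_lt continuousAt_const (by simp)
  filter_upwards [hsmall] with h hh
  have hc : 0 ≤ B * (ν * N) ^ 2 * ‖h ^ 2‖ := by positivity
  refine C.norm_op_le ((measurable_cutoff N).mul (by fun_prop)) hc fun x hx => ?_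
  by_cases hxN : x ≤ N
  · have h1 : |-(ν * h * x)| ≤ |ν * h * N| := by
      rw [abs_neg, abs_mul, abs_mul (ν * h)]
      refine mul_le_mul_of_nonneg_left ?_ (abs_nonneg _)
      rw [abs_of_nonneg (by linarith), abs_of_nonneg (by linarith)]; exact hxN
    have h2 := Real.abs_exp_sub_one_sub_id_le (h1.trans hh.le)
    have h3 : (-(ν * h * x)) ^ 2 ≤ (ν * h * N) ^ 2 := by
      rw [← sq_abs, ← sq_abs (ν * h * N)]; exact pow_le_pow_left₀ (abs_nonneg _) h1 2
    rw [← mul_assoc, abs_mul]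
    calc _ ≤ B * (ν * h * N) ^ 2 :=
          mul_le_mul (hB x hx) (h2.trans h3) (abs_nonneg _) hB0
      _ = B * (ν * N) ^ 2 * ‖h ^ 2‖ := by
          rw [Real.norm_of_nonneg (sq_nonneg h)]; ring
  · rw [cutoff, if_neg hxN, zero_mul, abs_zero]; exact hc

end SymbolCalculus

end HyperNS

end

/-! ### Linear equation: mild solutions, energy and continuity. -/

noncomputable section

namespace HyperNS

open Filter Topology Set

namespace SymbolCalculus

variable {X : Type*} [NormedAddCommGroup X] [InnerProductSpace ℝ X] (C : SymbolCalculus X)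

/-- The inverse square root of the generator. -/
def invRoot : X →L[ℝ] X := C.op fun x => (√x)⁻¹

theorem abs_inv_sqrt_le {x : ℝ} (hx : 1 ≤ x) : |(√x)⁻¹| ≤ 1 := by
  rw [abs_of_nonneg (by positivity)]
  exact inv_le_one_of_one_le₀ (Real.one_le_sqrt.2 hx)

theorem isBddSymbol_inv_sqrt : IsBddSymbol fun x => (√x)⁻¹ :=
  ⟨Real.continuous_sqrt.measurable.inv, 1, fun _ hx => abs_inv_sqrt_le hx⟩

theorem norm_invRoot_le (u : X) : ‖C.invRoot u‖ ≤ ‖u‖ := by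
  simpa [invRoot] using C.norm_op_apply_le isBddSymbol_inv_sqrt.1 zero_le_one
    (fun x hx => abs_inv_sqrt_le hx) u

theorem rootCut_invRoot (N : ℕ) (u : X) : C.rootCut N (C.invRoot u) = C.op (cutoff N) u := by
  rw [rootCut, invRoot, C.op_comp (isBddSymbol_rootCut N) isBddSymbol_inv_sqrt]
  refine congrArg (fun T : X →L[ℝ] X => T u) ?_
  refine C.op_congr ((isBddSymbol_rootCut N).mul isBddSymbol_inv_sqrt) (isBddSymbol_cutoff N) ?_
  intro x hx
  have : √x ≠ 0 := (Real.sqrt_pos.2 (by linarith)).ne'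
  field_simp

theorem invRoot_rootCut (N : ℕ) (u : X) : C.invRoot (C.rootCut N u) = C.op (cutoff N) u := by
  rw [← rootCut_invRoot, invRoot, rootCut, C.op_comm isBddSymbol_inv_sqrt (isBddSymbol_rootCut N)]

theorem genCut_invRoot (N : ℕ) (u : X) : C.genCut N (C.invRoot u) = C.rootCut N u := by
  rw [rootCut, genCut, invRoot, C.op_comp (isBddSymbol_genCut N) isBddSymbol_inv_sqrt]
  refine congrArg (fun T : X →L[ℝ] X => T u) ?_
  refine C.op_congr ((isBddSymbol_genCut N).mul isBddSymbol_inv_sqrt) (isBddSymbol_rootCut N) ?_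
  intro x hx
  have : √x ≠ 0 := (Real.sqrt_pos.2 (by linarith)).ne'
  have h2 := Real.mul_self_sqrt (show 0 ≤ x by linarith)
  field_simp
  rw [sq, h2]

theorem rootCut_rootCut (N : ℕ) (u : X) : C.rootCut N (C.rootCut N u) = C.genCut N u := by
  rw [rootCut, genCut, C.op_comp (isBddSymbol_rootCut N) (isBddSymbol_rootCut N)]
  refine congrArg (fun T : X →L[ℝ] X => T u) ?_
  refine C.op_congr ((isBddSymbol_rootCut N).mul (isBddSymbol_rootCut N)) (isBddSymbol_genCut N) ?_
  intro x hx
  rw [mul_mul_mul_comm, cutoff_mul_self, Real.mul_self_sqrt (by linarith)]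

theorem rootCut_cutoff (N : ℕ) (u : X) : C.rootCut N (C.op (cutoff N) u) = C.rootCut N u := by
  rw [rootCut, C.op_comp (isBddSymbol_rootCut N) (isBddSymbol_cutoff N)]
  congr 2
  ext x
  rw [mul_right_comm, cutoff_mul_self]

theorem genCut_cutoff (N : ℕ) (u : X) : C.genCut N (C.op (cutoff N) u) = C.genCut N u := by
  rw [genCut, C.op_comp (isBddSymbol_genCut N) (isBddSymbol_cutoff N)]
  congr 2
  ext x
  rw [mul_right_comm, cutoff_mul_self]

theorem cutoff_cutoff (N : ℕ) (u : X) :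
    C.op (cutoff N) (C.op (cutoff N) u) = C.op (cutoff N) u := by
  rw [C.op_comp (isBddSymbol_cutoff N) (isBddSymbol_cutoff N)]
  simp only [cutoff_mul_self]

theorem cutoff_rootCut (N : ℕ) (u : X) : C.op (cutoff N) (C.rootCut N u) = C.rootCut N u := by
  rw [rootCut, C.op_comp (isBddSymbol_cutoff N) (isBddSymbol_rootCut N)]
  simp only [← mul_assoc, cutoff_mul_self]

/-- The projections converge strongly to the identity. This transfers identities from the truncated
problems to the full one. -/
theorem eq_of_cutoff_eq {u v : X} (h : ∀ N, C.op (cutoff N) u = C.op (cutoff N) v) : u = v :=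
  tendsto_nhds_unique (C.tendsto_op_cutoff u)
    ((C.tendsto_op_cutoff v).congr fun N => (h N).symm)

theorem invRoot_injective : Function.Injective C.invRoot := fun u v h =>
  C.eq_of_cutoff_eq fun N => by rw [← rootCut_invRoot, h, rootCut_invRoot]

theorem inner_rootCut (N : ℕ) (u v : X) :
    inner ℝ (C.rootCut N u) v = inner ℝ u (C.rootCut N v) :=
  C.inner_op (isBddSymbol_rootCut N) u v

theorem inner_invRoot (u v : X) : inner ℝ (C.invRoot u) v = inner ℝ u (C.invRoot v) :=
  C.inner_op isBddSymbol_inv_sqrt u v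

theorem op_one_sub_cutoff (N : ℕ) (u : X) :
    C.op (fun x => 1 + -1 * cutoff N x) u = u - C.op (cutoff N) u := by
  rw [C.op_add isBddSymbol_one ((isBddSymbol_cutoff N).const_mul _),
    C.op_const_mul _ (isBddSymbol_cutoff N), C.op_one]
  simp [sub_eq_add_neg]

/-- The contraction semigroup `exp(-ν t λ)`. -/
def semi (ν t : ℝ) : X →L[ℝ] X := C.op fun x => Real.exp (-(ν * t * x))

/-- The smoothing operator `λ^{1/2} exp(-ν t λ)`. -/
def kern (ν t : ℝ) : X →L[ℝ] X := C.op fun x => √x * Real.exp (-(ν * t * x))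

/-- The mild solution of `w' + ν A w + A^{1/2} F = 0`, `w(0) = x`. -/
def mild (ν : ℝ) (x : X) (F : ℝ → X) (t : ℝ) : X :=
  C.semi ν t x - ∫ s in (0 : ℝ)..t, C.kern ν (t - s) (F s)

variable {ν : ℝ}

theorem isBddSymbol_exp (hν : 0 < ν) {t : ℝ} (ht : 0 ≤ t) :
    IsBddSymbol fun x => Real.exp (-(ν * t * x)) := by
  refine ⟨by fun_prop, 1, fun x hx => ?_⟩
  rw [Real.abs_exp, Real.exp_le_one_iff]
  have : 0 ≤ ν * t * x := by positivity
  linarith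

/-- From √(νtx) ≤ 1 + νtx ≤ exp(νtx). The resulting singularity t^{-1/2} is integrable, so half a
power of the generator may stand in front of the forcing. -/
theorem abs_kern_symbol_le (hν : 0 < ν) {t : ℝ} (ht : 0 < t) {x : ℝ} (hx : 1 ≤ x) :
    |√x * Real.exp (-(ν * t * x))| ≤ (√ν)⁻¹ * t ^ (-(1 / 2) : ℝ) := by
  rw [abs_of_nonneg (by positivity), Real.rpow_neg ht.le, ← Real.sqrt_eq_rpow, ← mul_inv,
    ← Real.sqrt_mul hν.le, Real.exp_neg, ← div_eq_mul_inv, div_le_iff₀ (Real.exp_pos _),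
    ← div_eq_inv_mul, le_div_iff₀ (by positivity), ← Real.sqrt_mul (by linarith)]
  have h0 : 0 ≤ ν * t * x := by positivity
  have h1 : √(x * (ν * t)) ≤ 1 + ν * t * x := by
    rw [mul_comm]
    refine Real.sqrt_le_iff.2 ⟨by positivity, by nlinarith⟩
  linarith [Real.add_one_le_exp (ν * t * x)]

theorem isBddSymbol_kern (hν : 0 < ν) {t : ℝ} (ht : 0 < t) :
    IsBddSymbol fun x => √x * Real.exp (-(ν * t * x)) :=
  ⟨by fun_prop, _, fun _ hx => abs_kern_symbol_le hν ht hx⟩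

theorem norm_kern_le (hν : 0 < ν) {t : ℝ} (ht : 0 < t) (u : X) :
    ‖C.kern ν t u‖ ≤ (√ν)⁻¹ * t ^ (-(1 / 2) : ℝ) * ‖u‖ :=
  C.norm_op_apply_le (isBddSymbol_kern hν ht).1 (by positivity)
    (fun _ hx => abs_kern_symbol_le hν ht hx) u

theorem cutoff_kern (hν : 0 < ν) {t : ℝ} (ht : 0 < t) (N : ℕ) (u : X) :
    C.op (cutoff N) (C.kern ν t u) = C.group ν N t (C.rootCut N u) := by
  rw [kern, group, rootCut, C.op_comp (isBddSymbol_cutoff N) (isBddSymbol_kern hν ht),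
    C.op_comp (isBddSymbol_group ν N t) (isBddSymbol_rootCut N)]
  congr 2
  ext x
  rw [mul_mul_mul_comm, cutoff_mul_self, mul_comm (√x)]

theorem cutoff_semi (hν : 0 < ν) {t : ℝ} (ht : 0 ≤ t) (N : ℕ) (u : X) :
    C.op (cutoff N) (C.semi ν t u) = C.group ν N t u := by
  rw [semi, group, C.op_comp (isBddSymbol_cutoff N) (isBddSymbol_exp hν ht)]

theorem continuous_group (ν : ℝ) (N : ℕ) : Continuous (C.group ν N) :=
  continuous_iff_continuousAt.2 fun t => (C.hasDerivAt_group ν N t).continuousAt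

theorem continuous_group_sub (ν : ℝ) (N : ℕ) (t : ℝ) {F : ℝ → X} (hF : Continuous F) :
    Continuous fun s => C.group ν N (t - s) (C.rootCut N (F s)) :=
  ((C.continuous_group ν N).comp (continuous_const.sub continuous_id)).clm_apply
    ((C.rootCut N).continuous.comp hF)

/-- Domination by the integrable singularity (t - s)^{-1/2}. Measurability is inherited from the
truncated integrands, which are continuous and converge pointwise for s < t. -/
theorem intervalIntegrable_kern (hν : 0 < ν) {F : ℝ → X} (hF : Continuous F) {t : ℝ}
    (ht : 0 ≤ t) : IntervalIntegrable (fun s => C.kern ν (t - s) (F s)) volume 0 t := by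
  rw [intervalIntegrable_iff_integrableOn_Ioo_of_le ht]
  obtain ⟨B, hB⟩ := (isCompact_Icc (a := (0 : ℝ)) (b := t)).exists_bound_of_continuousOn
    hF.continuousOn
  have h1 : IntervalIntegrable (fun s => (√ν)⁻¹ * (t - s) ^ (-(1 / 2) : ℝ) * B) volume 0 t := by
    have := (intervalIntegral.intervalIntegrable_rpow' (a := t) (b := 0)
      (r := (-(1 / 2) : ℝ)) (by norm_num)).comp_sub_left t
    simp only [sub_self, sub_zero] at this
    exact (this.const_mul _).mul_const _
  rw [intervalIntegrable_iff_integrableOn_Ioo_of_le ht] at h1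
  refine Integrable.mono' h1 ?_ ?_
  · refine aestronglyMeasurable_of_tendsto_ae atTop
      (f := fun N s => C.group ν N (t - s) (C.rootCut N (F s)))
      (fun N => (C.continuous_group_sub ν N t hF).aestronglyMeasurable) ?_
    refine (ae_restrict_iff' measurableSet_Ioo).2 (Eventually.of_forall fun s hs => ?_)
    refine (C.tendsto_op_cutoff (C.kern ν (t - s) (F s))).congr fun N => ?_
    rw [C.cutoff_kern hν (sub_pos.2 hs.2)]
  · refine (ae_restrict_iff' measurableSet_Ioo).2 (Eventually.of_forall fun s hs => ?_)
    refine (C.norm_kern_le hν (sub_pos.2 hs.2) _).trans ?_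
    have : 0 ≤ (t - s) ^ (-(1 / 2) : ℝ) := Real.rpow_nonneg (sub_nonneg.2 hs.2.le) _
    exact mul_le_mul_of_nonneg_left (hB s ⟨hs.1.le, hs.2.le⟩) (by positivity)

theorem ae_uIoc_lt (t : ℝ) (ht : 0 ≤ t) : ∀ᵐ s : ℝ, s ∈ Set.uIoc 0 t → s < t := by
  filter_upwards [Measure.ae_ne volume t] with s hs h
  rw [uIoc_of_le ht] at h
  exact lt_of_le_of_ne h.2 hs

/-- Operators of the calculus commute with the semigroup and its kernel, so applying one to a mild
solution only changes the data. It is used for the spectral tails in `continuousOn_mild` and to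
descend the Sobolev scale in `low_energy_mild`. -/
theorem op_mild [CompleteSpace X] (hν : 0 < ν) {F : ℝ → X} (hF : Continuous F) (x : X) {t : ℝ}
    (ht : 0 ≤ t) {φ : ℝ → ℝ} (hφ : IsBddSymbol φ) :
    C.op φ (C.mild ν x F t) = C.mild ν (C.op φ x) (fun s => C.op φ (F s)) t := by
  unfold mild
  rw [map_sub, ← (C.op φ).intervalIntegral_comp_comm (C.intervalIntegrable_kern hν hF ht), semi,
    C.op_comm hφ (isBddSymbol_exp hν ht)]
  congr 1
  refine intervalIntegral.integral_congr_ae ?_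
  filter_upwards [ae_uIoc_lt t ht] with s hs h
  rw [kern, C.op_comm hφ (isBddSymbol_kern hν (sub_pos.2 (hs h)))]

theorem mild_sub_mild (hν : 0 < ν) {F G : ℝ → X} (hF : Continuous F) (hG : Continuous G)
    (x y : X) {t : ℝ} (ht : 0 ≤ t) :
    C.mild ν x F t - C.mild ν y G t = C.mild ν (x - y) (fun s => F s - G s) t := by
  unfold mild
  simp only [map_sub]
  rw [intervalIntegral.integral_sub (C.intervalIntegrable_kern hν hF ht)
    (C.intervalIntegrable_kern hν hG ht)]
  abel

theorem mild_congr {F G : ℝ → X} (x : X) {t : ℝ} (ht : 0 ≤ t)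
    (h : ∀ s ∈ Icc 0 t, F s = G s) : C.mild ν x F t = C.mild ν x G t := by
  unfold mild
  congr 1
  refine intervalIntegral.integral_congr fun s hs => ?_
  rw [uIcc_of_le ht] at hs
  simp only [h s hs]

variable [CompleteSpace X]

theorem cutoff_mild (hν : 0 < ν) {F : ℝ → X} (hF : Continuous F) (x : X) {t : ℝ}
    (ht : 0 ≤ t) (N : ℕ) : C.op (cutoff N) (C.mild ν x F t)
      = C.group ν N t x - ∫ s in (0 : ℝ)..t, C.group ν N (t - s) (C.rootCut N (F s)) := by
  unfold mild
  rw [map_sub, C.cutoff_semi hν ht,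
    ← (C.op (cutoff N)).intervalIntegral_comp_comm (C.intervalIntegrable_kern hν hF ht)]
  congr 1
  refine intervalIntegral.integral_congr_ae ?_
  filter_upwards [ae_uIoc_lt t ht] with s hs h
  rw [C.cutoff_kern hν (sub_pos.2 (hs h))]

theorem hasDerivAt_cut (ν : ℝ) {F : ℝ → X} (hF : Continuous F) (x : X) (N : ℕ) (t : ℝ) :
    HasDerivAt (fun t => C.group ν N t x
        - ∫ s in (0 : ℝ)..t, C.group ν N (t - s) (C.rootCut N (F s)))
      (-((ν • C.genCut N) (C.group ν N t x
        - ∫ s in (0 : ℝ)..t, C.group ν N (t - s) (C.rootCut N (F s)))) - C.rootCut N (F t)) t :=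
  hasDerivAt_duhamel (C.hasDerivAt_group ν N) (C.group_add ν N)
    ((C.rootCut N).continuous.comp hF) (fun t => by
      rw [C.group_zero]; exact C.cutoff_rootCut N _) x t

/-- The integrated equation for the spectral truncation of the mild solution. -/
theorem cutoff_mild_add_integral (hν : 0 < ν) {F : ℝ → X} (hF : Continuous F) (x : X) {t : ℝ}
    (ht : 0 ≤ t) (N : ℕ) : C.op (cutoff N) (C.mild ν x F t)
      + ∫ s in (0 : ℝ)..t, ((ν • C.genCut N) (C.mild ν x F s) + C.rootCut N (F s))
      = C.op (cutoff N) x := by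
  set y : ℝ → X := fun t => C.group ν N t x
        - ∫ s in (0 : ℝ)..t, C.group ν N (t - s) (C.rootCut N (F s)) with hy
  have hd : ∀ t, HasDerivAt y (-((ν • C.genCut N) (y t)) - C.rootCut N (F t)) t :=
    C.hasDerivAt_cut ν hF x N
  have hyc : Continuous y := continuous_iff_continuousAt.2 fun t => (hd t).continuousAt
  have h1 : ∫ s in (0 : ℝ)..t, ((ν • C.genCut N) (C.mild ν x F s) + C.rootCut N (F s))
      = -∫ s in (0 : ℝ)..t, (-((ν • C.genCut N) (y s)) - C.rootCut N (F s)) := by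
    rw [← intervalIntegral.integral_neg]
    refine intervalIntegral.integral_congr fun s hs => ?_
    rw [uIcc_of_le ht] at hs
    simp only [hy]
    rw [← C.cutoff_mild hν hF x hs.1 N]
    simp only [smul_apply, C.genCut_cutoff]
    abel
  rw [h1, intervalIntegral.integral_eq_sub_of_hasDerivAt (fun s _ => hd s)
    (Continuous.intervalIntegrable (by fun_prop) _ _), C.cutoff_mild hν hF x ht N]
  have h0 : y 0 = C.op (cutoff N) x := by simp [hy, C.group_zero]
  rw [h0]
  simp [hy]

theorem continuousOn_cutoff_mild (hν : 0 < ν) {F : ℝ → X} (hF : Continuous F) (x : X) (N : ℕ) :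
    ContinuousOn (fun t => C.op (cutoff N) (C.mild ν x F t)) (Ici 0) := by
  have hyc : Continuous fun t => C.group ν N t x
        - ∫ s in (0 : ℝ)..t, C.group ν N (t - s) (C.rootCut N (F s)) :=
    continuous_iff_continuousAt.2 fun t => (C.hasDerivAt_cut ν hF x N t).continuousAt
  exact hyc.continuousOn.congr fun t ht => C.cutoff_mild hν hF x ht N

/-- The truncated curve is differentiable although the mild solution need not be. Differentiating
its squared norm and writing the generator as the square of its self-adjoint root yields dissipation
and forcing, both in terms of the root. -/
theorem energy_cutoff_mild (hν : 0 < ν) {F : ℝ → X} (hF : Continuous F) (x : X) {t : ℝ}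
    (ht : 0 ≤ t) (N : ℕ) : ‖C.op (cutoff N) (C.mild ν x F t)‖ ^ 2
      + 2 * ν * ∫ s in (0 : ℝ)..t, ‖C.rootCut N (C.mild ν x F s)‖ ^ 2
      = ‖C.op (cutoff N) x‖ ^ 2
        - 2 * ∫ s in (0 : ℝ)..t, inner ℝ (C.rootCut N (C.mild ν x F s)) (F s) := by
  set y : ℝ → X := fun t => C.group ν N t x
        - ∫ s in (0 : ℝ)..t, C.group ν N (t - s) (C.rootCut N (F s)) with hy
  have hd : ∀ t, HasDerivAt y (-((ν • C.genCut N) (y t)) - C.rootCut N (F t)) t :=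
    C.hasDerivAt_cut ν hF x N
  have hyc : Continuous y := continuous_iff_continuousAt.2 fun t => (hd t).continuousAt
  have hroot : ∀ s ∈ uIcc 0 t, C.rootCut N (C.mild ν x F s) = C.rootCut N (y s) := by
    intro s hs
    rw [uIcc_of_le ht] at hs
    rw [← C.rootCut_cutoff N (C.mild ν x F s), C.cutoff_mild hν hF x hs.1 N]
  have hrc : Continuous fun s => C.rootCut N (y s) := (C.rootCut N).continuous.comp hyc
  have hd2 : ∀ s, HasDerivAt (fun s => ‖y s‖ ^ 2)
      (-(2 * ν) * ‖C.rootCut N (y s)‖ ^ 2 - 2 * inner ℝ (C.rootCut N (y s)) (F s)) s := by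
    intro s
    convert (hd s).norm_sq using 1
    have e1 : inner ℝ (y s) (C.genCut N (y s)) = ‖C.rootCut N (y s)‖ ^ 2 := by
      rw [← C.rootCut_rootCut, ← C.inner_rootCut, real_inner_self_eq_norm_sq]
    rw [inner_sub_right, inner_neg_right, smul_apply, inner_smul_right, e1, ← C.inner_rootCut]
    ring
  have h0 : y 0 = C.op (cutoff N) x := by simp [hy, C.group_zero]
  have hftc := intervalIntegral.integral_eq_sub_of_hasDerivAt (a := 0) (b := t)
    (fun s _ => hd2 s) (Continuous.intervalIntegrable (by fun_prop) _ _)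
  rw [intervalIntegral.integral_sub (Continuous.intervalIntegrable (by fun_prop) _ _)
    (Continuous.intervalIntegrable (by fun_prop) _ _), intervalIntegral.integral_const_mul,
    intervalIntegral.integral_const_mul, h0] at hftc
  rw [intervalIntegral.integral_congr fun s hs => congrArg (fun u => ‖u‖ ^ 2) (hroot s hs),
    intervalIntegral.integral_congr fun s hs => congrArg (fun u => inner ℝ u (F s)) (hroot s hs),
    C.cutoff_mild hν hF x ht N]
  linarith

theorem continuousOn_rootCut_mild (hν : 0 < ν) {F : ℝ → X} (hF : Continuous F) (x : X) (N : ℕ) :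
    ContinuousOn (fun t => C.rootCut N (C.mild ν x F t)) (Ici 0) :=
  ((C.rootCut N).continuous.comp_continuousOn (C.continuousOn_cutoff_mild hν hF x N)).congr
    fun _ _ => (C.rootCut_cutoff N _).symm

theorem energy_le_cutoff_mild (hν : 0 < ν) {F : ℝ → X} (hF : Continuous F) (x : X) {t : ℝ}
    (ht : 0 ≤ t) (N : ℕ) : ‖C.op (cutoff N) (C.mild ν x F t)‖ ^ 2
      + ν * ∫ s in (0 : ℝ)..t, ‖C.rootCut N (C.mild ν x F s)‖ ^ 2
      ≤ ‖x‖ ^ 2 + ν⁻¹ * ∫ s in (0 : ℝ)..t, ‖F s‖ ^ 2 := by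
  have h1 := C.energy_cutoff_mild hν hF x ht N
  have hr : ContinuousOn (fun s => C.rootCut N (C.mild ν x F s)) (uIcc 0 t) :=
    (C.continuousOn_rootCut_mild hν hF x N).mono (by
      rw [uIcc_of_le ht]; exact fun s hs => hs.1)
  have hr2 : ContinuousOn (fun s => ν * ‖C.rootCut N (C.mild ν x F s)‖ ^ 2) (uIcc 0 t) :=
    (hr.norm.pow 2).const_mul ν
  have hF2 : ContinuousOn (fun s => ν⁻¹ * ‖F s‖ ^ 2) (uIcc 0 t) :=
    Continuous.continuousOn (by fun_prop)
  have h2 : -2 * ∫ s in (0 : ℝ)..t, inner ℝ (C.rootCut N (C.mild ν x F s)) (F s)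
      ≤ ν * (∫ s in (0 : ℝ)..t, ‖C.rootCut N (C.mild ν x F s)‖ ^ 2)
        + ν⁻¹ * ∫ s in (0 : ℝ)..t, ‖F s‖ ^ 2 := by
    rw [← intervalIntegral.integral_const_mul, ← intervalIntegral.integral_const_mul,
      ← intervalIntegral.integral_const_mul, ← intervalIntegral.integral_add
        hr2.intervalIntegrable hF2.intervalIntegrable]
    refine intervalIntegral.integral_mono_on ht
      (((hr.inner hF.continuousOn).const_mul (-2)).intervalIntegrable)
      (hr2.add hF2).intervalIntegrable fun s _ => ?_
    have h3 := abs_real_inner_le_norm (C.rootCut N (C.mild ν x F s)) (F s)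
    have h4 := (neg_le_abs _).trans h3
    -- Young's inequality with weights ν and ν⁻¹: half of the dissipation 2ν absorbs the forcing,
    -- the other half stays in the conclusion.
    have h5 : 0 ≤ ν⁻¹ * (ν * ‖C.rootCut N (C.mild ν x F s)‖ - ‖F s‖) ^ 2 := by positivity
    have h6 : ν⁻¹ * (ν * ‖C.rootCut N (C.mild ν x F s)‖ - ‖F s‖) ^ 2
      = ν * ‖C.rootCut N (C.mild ν x F s)‖ ^ 2
        - 2 * (‖C.rootCut N (C.mild ν x F s)‖ * ‖F s‖) + ν⁻¹ * ‖F s‖ ^ 2 := by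
      field_simp
      ring
    linarith
  have h3 : ‖C.op (cutoff N) x‖ ^ 2 ≤ ‖x‖ ^ 2 :=
    pow_le_pow_left₀ (norm_nonneg _) (C.norm_op_cutoff_le N x) 2
  linarith

theorem sq_norm_mild_le (hν : 0 < ν) {F : ℝ → X} (hF : Continuous F) (x : X) {t : ℝ}
    (ht : 0 ≤ t) :
    ‖C.mild ν x F t‖ ^ 2 ≤ ‖x‖ ^ 2 + ν⁻¹ * ∫ s in (0 : ℝ)..t, ‖F s‖ ^ 2 := by
  refine le_of_tendsto ((C.tendsto_op_cutoff (C.mild ν x F t)).norm.pow 2)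
    (Eventually.of_forall fun N => ?_)
  have h1 := C.energy_le_cutoff_mild hν hF x ht N
  have h2 : 0 ≤ ν * ∫ s in (0 : ℝ)..t, ‖C.rootCut N (C.mild ν x F s)‖ ^ 2 :=
    mul_nonneg hν.le (intervalIntegral.integral_nonneg ht fun _ _ => by positivity)
  linarith

/-- The continuous truncations converge uniformly on compact time intervals: the remainder is the
mild solution whose data are the spectral tails of x and F, and its energy bound tends to 0 by
dominated convergence. -/
theorem continuousOn_mild (hν : 0 < ν) {F : ℝ → X} (hF : Continuous F) (x : X) :
    ContinuousOn (C.mild ν x F) (Ici 0) := by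
  intro t₀ ht₀
  have ht₀' : (0 : ℝ) ≤ t₀ := ht₀
  set T := t₀ + 1 with hT
  have hT0 : 0 ≤ T := by linarith
  have hsub : ContinuousOn (C.mild ν x F) (Icc 0 T) := by
    refine TendstoUniformlyOn.continuousOn (p := atTop)
      (F := fun N t => C.op (cutoff N) (C.mild ν x F t)) ?_ (Frequently.of_forall fun N =>
        (C.continuousOn_cutoff_mild hν hF x N).mono fun s hs => hs.1)
    have hlim : Tendsto (fun N => ‖x - C.op (cutoff N) x‖ ^ 2
        + ν⁻¹ * ∫ s in (0 : ℝ)..T, ‖F s - C.op (cutoff N) (F s)‖ ^ 2) atTop (𝓝 0) := by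
      have h1 : Tendsto (fun N => ‖x - C.op (cutoff N) x‖ ^ 2) atTop (𝓝 0) := by
        simpa using ((tendsto_const_nhds (x := x)).sub (C.tendsto_op_cutoff x)).norm.pow 2
      have h2 : Tendsto (fun N => ∫ s in (0 : ℝ)..T, ‖F s - C.op (cutoff N) (F s)‖ ^ 2) atTop
          (𝓝 (∫ s in (0 : ℝ)..T, (0 : ℝ))) := by
        refine intervalIntegral.tendsto_integral_filter_of_dominated_convergence
          (fun s => (2 * ‖F s‖) ^ 2) (Eventually.of_forall fun N =>
            Continuous.aestronglyMeasurable (by fun_prop)) (Eventually.of_forall fun N =>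
            Eventually.of_forall fun s _ => ?_)
          (Continuous.intervalIntegrable (by fun_prop) _ _) (Eventually.of_forall fun s _ => ?_)
        · rw [Real.norm_of_nonneg (by positivity)]
          refine pow_le_pow_left₀ (norm_nonneg _) ?_ 2
          linarith [norm_sub_le (F s) (C.op (cutoff N) (F s)), C.norm_op_cutoff_le N (F s)]
        · simpa using
            ((tendsto_const_nhds (x := F s)).sub (C.tendsto_op_cutoff (F s))).norm.pow 2
      simpa using h1.add (h2.const_mul ν⁻¹)
    rw [Metric.tendstoUniformlyOn_iff]
    intro ε hε
    filter_upwards [hlim.eventually_lt_const (show 0 < ε ^ 2 by positivity)] with N hN t ht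
    have hφ : IsBddSymbol fun x => 1 + -1 * cutoff N x :=
      isBddSymbol_one.add ((isBddSymbol_cutoff N).const_mul _)
    have h1 := C.sq_norm_mild_le hν (F := fun s => C.op (fun x => 1 + -1 * cutoff N x) (F s))
      ((C.op _).continuous.comp hF) (C.op (fun x => 1 + -1 * cutoff N x) x) ht.1
    rw [← C.op_mild hν hF x ht.1 hφ] at h1
    simp only [op_one_sub_cutoff] at h1
    rw [dist_eq_norm]
    refine lt_of_pow_lt_pow_left₀ 2 hε.le (h1.trans_lt (lt_of_le_of_lt ?_ hN))
    refine add_le_add_right (mul_le_mul_of_nonneg_left ?_ (by positivity)) _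
    refine intervalIntegral.integral_mono_interval le_rfl ht.1 ht.2
      (Eventually.of_forall fun s => by positivity)
      (Continuous.intervalIntegrable (by fun_prop) _ _)
  refine (hsub t₀ ⟨ht₀', by linarith⟩).mono_of_mem_nhdsWithin ?_
  rw [← Ici_inter_Iic]
  exact inter_mem_nhdsWithin _ (Iic_mem_nhds (by linarith))

end SymbolCalculus

end HyperNS

end

/-! ### Parabolic regularity, strong solutions and low-order energy. -/

noncomputable section

namespace HyperNS

open Filter Topology Set

namespace SymbolCalculus

variable {X : Type*} [NormedAddCommGroup X] [InnerProductSpace ℝ X] (C : SymbolCalculus X)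

/-- Pythagoras: `rootCut N u` is the orthogonal projection of `rootCut M u` to {λ ≤ N}. Hence the
norms increase with N, and boundedness of the norms already forces convergence of the vectors. -/
theorem sq_norm_rootCut_sub {M N : ℕ} (h : N ≤ M) (u : X) :
    ‖C.rootCut M u - C.rootCut N u‖ ^ 2 = ‖C.rootCut M u‖ ^ 2 - ‖C.rootCut N u‖ ^ 2 := by
  have h1 : C.op (cutoff N) (C.rootCut M u) = C.rootCut N u := by
    rw [rootCut, rootCut, C.op_comp (isBddSymbol_cutoff N) (isBddSymbol_rootCut M)]
    congr 2
    ext x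
    have : cutoff N x * cutoff M x = cutoff N x := by
      unfold cutoff
      split_ifs with h1 h2 <;> simp
      exact h2 (h1.trans (by exact_mod_cast h))
    rw [← mul_assoc, this]
  have h2 : inner ℝ (C.rootCut M u) (C.rootCut N u) = ‖C.rootCut N u‖ ^ 2 := by
    rw [← real_inner_self_eq_norm_sq, ← C.cutoff_rootCut N u,
      ← C.inner_op (isBddSymbol_cutoff N), h1, C.cutoff_rootCut]
  rw [norm_sub_sq_real, h2]
  ring

theorem monotone_sq_norm_rootCut (u : X) : Monotone fun N => ‖C.rootCut N u‖ ^ 2 := by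
  intro N M h
  have := C.sq_norm_rootCut_sub h u
  have h2 := sq_nonneg ‖C.rootCut M u - C.rootCut N u‖
  simp only
  linarith

theorem tendsto_rootCut_of_bddAbove [CompleteSpace X] {u : X}
    (h : BddAbove (range fun N => ‖C.rootCut N u‖ ^ 2)) :
    ∃ y, Tendsto (fun N => C.rootCut N u) atTop (𝓝 y) ∧ C.invRoot y = u := by
  have h1 : CauchySeq fun N => ‖C.rootCut N u‖ ^ 2 :=
    (tendsto_atTop_ciSup (C.monotone_sq_norm_rootCut u) h).cauchySeq
  have h2 : CauchySeq fun N => C.rootCut N u := by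
    rw [Metric.cauchySeq_iff'] at h1 ⊢
    intro ε hε
    obtain ⟨N, hN⟩ := h1 (ε ^ 2) (by positivity)
    refine ⟨N, fun n hn => ?_⟩
    have h3 := hN n hn
    rw [Real.dist_eq, ← C.sq_norm_rootCut_sub hn, abs_of_nonneg (by positivity)] at h3
    rw [dist_eq_norm]
    exact lt_of_pow_lt_pow_left₀ 2 hε.le h3
  obtain ⟨y, hy⟩ := cauchySeq_tendsto_of_complete h2
  refine ⟨y, hy, ?_⟩
  refine tendsto_nhds_unique ((C.invRoot.continuous.tendsto y).comp hy) ?_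
  refine (C.tendsto_op_cutoff u).congr fun N => ?_
  rw [Function.comp_apply, C.invRoot_rootCut]

variable {ν : ℝ} [CompleteSpace X]

/-- The energy bound is uniform in N and the integrands increase with N, so by monotone convergence
their supremum is integrable, hence finite for almost every time. -/
theorem ae_bddAbove_rootCut_mild (hν : 0 < ν) {F : ℝ → X} (hF : Continuous F) (x : X) {T : ℝ}
    (hT : 0 ≤ T) :
    (∀ᵐ s ∂(volume.restrict (Ioc 0 T)),
      BddAbove (range fun N => ‖C.rootCut N (C.mild ν x F s)‖ ^ 2)) ∧
    ∫⁻ s in Ioc 0 T, ⨆ N, ENNReal.ofReal (‖C.rootCut N (C.mild ν x F s)‖ ^ 2) < ⊤ := by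
  have hcont : ∀ N, ContinuousOn (fun s => ‖C.rootCut N (C.mild ν x F s)‖ ^ 2) (Icc 0 T) :=
    fun N => ((C.continuousOn_rootCut_mild hν hF x N).norm.pow 2).mono fun s hs => hs.1
  have hmeas : ∀ N, AEMeasurable (fun s => ENNReal.ofReal (‖C.rootCut N (C.mild ν x F s)‖ ^ 2))
      (volume.restrict (Ioc 0 T)) := fun N =>
    (((hcont N).mono Ioc_subset_Icc_self).aemeasurable measurableSet_Ioc).ennreal_ofReal
  set K := ν⁻¹ * (‖x‖ ^ 2 + ν⁻¹ * ∫ s in (0 : ℝ)..T, ‖F s‖ ^ 2) with hK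
  have hle : ∫⁻ s in Ioc 0 T, ⨆ N, ENNReal.ofReal (‖C.rootCut N (C.mild ν x F s)‖ ^ 2)
      ≤ ENNReal.ofReal K := by
    rw [lintegral_iSup' hmeas (Eventually.of_forall fun s N M h =>
      ENNReal.ofReal_le_ofReal (C.monotone_sq_norm_rootCut _ h))]
    refine iSup_le fun N => ?_
    rw [← ofReal_integral_eq_lintegral_ofReal
      ((intervalIntegrable_iff_integrableOn_Ioc_of_le hT).1
        ((hcont N).intervalIntegrable_of_Icc hT)) (Eventually.of_forall fun s => by positivity),
      ← intervalIntegral.integral_of_le hT]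
    refine ENNReal.ofReal_le_ofReal ?_
    have h1 := C.energy_le_cutoff_mild hν hF x hT N
    rw [hK, ← div_eq_inv_mul, le_div_iff₀' hν]
    have : 0 ≤ ‖C.op (cutoff N) (C.mild ν x F T)‖ ^ 2 := by positivity
    linarith
  have hlt := hle.trans_lt ENNReal.ofReal_lt_top
  refine ⟨?_, hlt⟩
  filter_upwards [ae_lt_top' (AEMeasurable.iSup hmeas) hlt.ne] with s hs
  refine ⟨(⨆ N, ENNReal.ofReal (‖C.rootCut N (C.mild ν x F s)‖ ^ 2)).toReal, ?_⟩
  rintro _ ⟨N, rfl⟩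
  exact (ENNReal.ofReal_le_iff_le_toReal hs.ne).1
    (le_iSup (fun N => ENNReal.ofReal (‖C.rootCut N (C.mild ν x F s)‖ ^ 2)) N)

/-- Parabolic regularity: the mild solution has a square root of the generator in `L²`. -/
theorem exists_root_mild (hν : 0 < ν) {F : ℝ → X} (hF : Continuous F) (x : X) :
    ∃ Y : ℝ → X, (∀ᵐ s : ℝ, 0 ≤ s → C.invRoot (Y s) = C.mild ν x F s) ∧
      ∀ T, 0 ≤ T → MemLp Y 2 (volume.restrict (Ioc 0 T)) ∧
        ‖C.mild ν x F T‖ ^ 2 + ν * ∫ s in (0 : ℝ)..T, ‖Y s‖ ^ 2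
          ≤ ‖x‖ ^ 2 + ν⁻¹ * ∫ s in (0 : ℝ)..T, ‖F s‖ ^ 2 := by
  -- The truncated roots converge for almost every s ≥ 0; the value of `limUnder` at the other times
  -- plays no role.
  set Y : ℝ → X := fun s => limUnder atTop fun N => C.rootCut N (C.mild ν x F s) with hY
  have hgood : ∀ s, BddAbove (range fun N => ‖C.rootCut N (C.mild ν x F s)‖ ^ 2) →
      Tendsto (fun N => C.rootCut N (C.mild ν x F s)) atTop (𝓝 (Y s)) ∧
        C.invRoot (Y s) = C.mild ν x F s := by
    intro s hs
    obtain ⟨y, hy, hy2⟩ := C.tendsto_rootCut_of_bddAbove hs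
    have : Y s = y := hy.limUnder_eq
    rw [this]; exact ⟨hy, hy2⟩
  refine ⟨Y, ?_, fun T hT => ?_⟩
  · have h1 : ∀ n : ℕ, ∀ᵐ s : ℝ, s ∈ Ioc (0 : ℝ) n →
        BddAbove (range fun N => ‖C.rootCut N (C.mild ν x F s)‖ ^ 2) := fun n =>
      (ae_restrict_iff' measurableSet_Ioc).1
        (C.ae_bddAbove_rootCut_mild hν hF x (Nat.cast_nonneg n)).1
    filter_upwards [ae_all_iff.2 h1, Measure.ae_ne volume (0 : ℝ)] with s hs hs0 hs1
    obtain ⟨n, hn⟩ := exists_nat_ge s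
    exact (hgood s (hs n ⟨lt_of_le_of_ne hs1 (Ne.symm hs0), hn⟩)).2
  · obtain ⟨hb, hfin⟩ := C.ae_bddAbove_rootCut_mild hν hF x hT
    have hcont : ∀ N, ContinuousOn (fun s => C.rootCut N (C.mild ν x F s)) (Ioc 0 T) :=
      fun N => (C.continuousOn_rootCut_mild hν hF x N).mono fun s hs => hs.1.le
    have hmeas : AEStronglyMeasurable Y (volume.restrict (Ioc 0 T)) :=
      aestronglyMeasurable_of_tendsto_ae atTop
        (fun N => (hcont N).aestronglyMeasurable measurableSet_Ioc)
        (hb.mono fun s hs => (hgood s hs).1)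
    have hmono : ∀ N, ∀ᵐ s ∂(volume.restrict (Ioc 0 T)),
        ‖C.rootCut N (C.mild ν x F s)‖ ^ 2 ≤ ‖Y s‖ ^ 2 := fun N => hb.mono fun s hs =>
      (C.monotone_sq_norm_rootCut _).ge_of_tendsto ((hgood s hs).1.norm.pow 2) N
    have hsup : ∀ᵐ s ∂(volume.restrict (Ioc 0 T)), ENNReal.ofReal (‖Y s‖ ^ 2)
        ≤ ⨆ N, ENNReal.ofReal (‖C.rootCut N (C.mild ν x F s)‖ ^ 2) := hb.mono fun s hs => by
      refine le_of_tendsto ((ENNReal.continuous_ofReal.tendsto _).comp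
        ((hgood s hs).1.norm.pow 2)) (Eventually.of_forall fun N => ?_)
      exact le_iSup (fun N => ENNReal.ofReal (‖C.rootCut N (C.mild ν x F s)‖ ^ 2)) N
    have hint : Integrable (fun s => ‖Y s‖ ^ 2) (volume.restrict (Ioc 0 T)) := by
      refine ⟨hmeas.norm.pow 2, ?_⟩
      rw [hasFiniteIntegral_iff_ofReal (Eventually.of_forall fun s => by positivity)]
      exact (lintegral_mono_ae hsup).trans_lt hfin
    refine ⟨(memLp_two_iff_integrable_sq_norm hmeas).2 hint, ?_⟩
    have hlim : Tendsto (fun N => ∫ s in (0 : ℝ)..T, ‖C.rootCut N (C.mild ν x F s)‖ ^ 2) atTop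
        (𝓝 (∫ s in (0 : ℝ)..T, ‖Y s‖ ^ 2)) := by
      simp only [intervalIntegral.integral_of_le hT]
      refine tendsto_integral_of_dominated_convergence (fun s => ‖Y s‖ ^ 2)
        (fun N => ((hcont N).aestronglyMeasurable measurableSet_Ioc).norm.pow 2) hint
        (fun N => (hmono N).mono fun s hs => ?_) (hb.mono fun s hs => (hgood s hs).1.norm.pow 2)
      rwa [Real.norm_of_nonneg (by positivity)]
    refine le_of_tendsto (((C.tendsto_op_cutoff (C.mild ν x F T)).norm.pow 2).add
      (hlim.const_mul ν)) (Eventually.of_forall fun N => C.energy_le_cutoff_mild hν hF x hT N)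

/-- Equivalence of the mild and of the strong formulation of the linear equation. -/
theorem strong_iff_mild (hν : 0 < ν) {F : ℝ → X} (hF : Continuous F) (x : X) {w Y : ℝ → X}
    (hw : Continuous w) (hY : ∀ᵐ s : ℝ, 0 ≤ s → C.invRoot (Y s) = w s)
    (hYi : ∀ t, 0 ≤ t → IntervalIntegrable Y volume 0 t) :
    (∀ t, 0 ≤ t → C.invRoot (w t) + ν • (∫ s in (0 : ℝ)..t, Y s) + ∫ s in (0 : ℝ)..t, F s
      = C.invRoot x) ↔ ∀ t, 0 ≤ t → w t = C.mild ν x F t := by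
  -- The strong identity lives half a power of the generator too low. Applying the truncated root
  -- restores that half power and produces the integrated ODE of the truncated curve; conversely,
  -- the truncated roots for all N determine a vector, since `invRoot` turns them into projections.
  have hcut : ∀ N t, 0 ≤ t → C.rootCut N (C.invRoot (w t) + ν • (∫ s in (0 : ℝ)..t, Y s)
      + ∫ s in (0 : ℝ)..t, F s) = C.op (cutoff N) (w t)
        + ∫ s in (0 : ℝ)..t, ((ν • C.genCut N) (C.op (cutoff N) (w s)) + C.rootCut N (F s)) := by
    intro N t ht
    have e1 : ∫ s in (0 : ℝ)..t, C.rootCut N (Y s) = ∫ s in (0 : ℝ)..t, C.genCut N (w s) := by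
      refine intervalIntegral.integral_congr_ae ?_
      filter_upwards [hY] with s hs h
      rw [uIoc_of_le ht] at h
      rw [← hs h.1.le, C.genCut_invRoot]
    rw [map_add, map_add, map_smul, C.rootCut_invRoot,
      ← (C.rootCut N).intervalIntegral_comp_comm (hYi t ht),
      ← (C.rootCut N).intervalIntegral_comp_comm (hF.intervalIntegrable _ _), e1, add_assoc,
      ← intervalIntegral.integral_smul, ← intervalIntegral.integral_add
        (Continuous.intervalIntegrable (by fun_prop) _ _)
        (Continuous.intervalIntegrable (by fun_prop) _ _)]
    simp only [smul_apply, C.genCut_cutoff]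
  constructor
  · intro h t ht
    refine C.eq_of_cutoff_eq fun N => ?_
    rw [C.cutoff_mild hν hF x ht N]
    refine eq_duhamel_of_integral_eq (C.hasDerivAt_group ν N) (C.group_comm ν N)
      (C.group_add ν N) ((C.rootCut N).continuous.comp hF) (fun s => ?_)
      (y := fun s => C.op (cutoff N) (w s)) ((C.op (cutoff N)).continuous.comp hw)
      (fun s => ?_) (fun s hs => ?_) ht
    · rw [C.group_zero]; exact C.cutoff_rootCut N _
    · rw [C.group_zero]; exact C.cutoff_cutoff N _
    · rw [C.group_zero, ← C.rootCut_invRoot N x, ← h s hs, hcut N s hs]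
      rfl
  · intro h t ht
    have key : ∀ N, C.rootCut N (C.invRoot (w t) + ν • (∫ s in (0 : ℝ)..t, Y s)
        + ∫ s in (0 : ℝ)..t, F s) = C.rootCut N (C.invRoot x) := by
      intro N
      rw [hcut N t ht, C.rootCut_invRoot, ← C.cutoff_mild_add_integral hν hF x ht N, h t ht]
      congr 1
      refine intervalIntegral.integral_congr fun s hs => ?_
      rw [uIcc_of_le ht] at hs
      simp only [smul_apply, C.genCut_cutoff, h s hs.1]
    refine C.eq_of_cutoff_eq fun N => ?_
    rw [← C.invRoot_rootCut, key, C.invRoot_rootCut]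

/-- The energy equality two levels of regularity below the one of the mild solution. -/
theorem low_energy_mild (hν : 0 < ν) {F : ℝ → X} (hF : Continuous F) (x : X) {t : ℝ}
    (ht : 0 ≤ t) :
    ‖C.invRoot (C.invRoot (C.mild ν x F t))‖ ^ 2
      + 2 * ν * ∫ s in (0 : ℝ)..t, ‖C.invRoot (C.mild ν x F s)‖ ^ 2
      = ‖C.invRoot (C.invRoot x)‖ ^ 2 - 2 * ∫ s in (0 : ℝ)..t,
          inner ℝ (C.invRoot (C.invRoot (C.invRoot (C.mild ν x F s)))) (F s) := by
  set J2 : X →L[ℝ] X := C.invRoot ∘L C.invRoot with hJ2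
  have hJ2' : ∀ u, J2 u = C.op (fun x => (√x)⁻¹ * (√x)⁻¹) u := fun u =>
    C.op_comp isBddSymbol_inv_sqrt isBddSymbol_inv_sqrt u
  have hGc : Continuous fun s => J2 (F s) := J2.continuous.comp hF
  -- The lowered curve is again mild, and its truncated root is a projection of the continuous curve
  -- `invRoot` of the solution. The truncated energy equalities therefore pass to the limit by
  -- dominated convergence without becoming inequalities.
  have hmild : ∀ s, 0 ≤ s → C.mild ν (J2 x) (fun s => J2 (F s)) s = J2 (C.mild ν x F s) := by
    intro s hs
    simp only [hJ2']
    rw [C.op_mild hν hF x hs (isBddSymbol_inv_sqrt.mul isBddSymbol_inv_sqrt)]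
  have hwc : ContinuousOn (fun s => C.invRoot (C.mild ν x F s)) (Icc 0 t) :=
    (C.invRoot.continuous.comp_continuousOn (C.continuousOn_mild hν hF x)).mono fun s hs => hs.1
  have hroot : ∀ N, ∀ s ∈ uIcc 0 t, C.rootCut N (C.mild ν (J2 x) (fun s => J2 (F s)) s)
      = C.op (cutoff N) (C.invRoot (C.mild ν x F s)) := by
    intro N s hs
    rw [uIcc_of_le ht] at hs
    rw [hmild s hs.1]
    exact C.rootCut_invRoot N _
  have hN : ∀ N, ‖C.op (cutoff N) (J2 (C.mild ν x F t))‖ ^ 2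
      + 2 * ν * ∫ s in (0 : ℝ)..t, ‖C.op (cutoff N) (C.invRoot (C.mild ν x F s))‖ ^ 2
      = ‖C.op (cutoff N) (J2 x)‖ ^ 2 - 2 * ∫ s in (0 : ℝ)..t,
        inner ℝ (C.op (cutoff N) (C.invRoot (C.mild ν x F s))) (J2 (F s)) := by
    intro N
    have h1 := C.energy_cutoff_mild hν hGc (J2 x) ht N
    rw [intervalIntegral.integral_congr fun s hs => congrArg (fun u => ‖u‖ ^ 2) (hroot N s hs),
      intervalIntegral.integral_congr fun s hs =>
        congrArg (fun u => inner ℝ u (J2 (F s))) (hroot N s hs), hmild t ht] at h1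
    exact h1
  have hcutc : ∀ N, ContinuousOn (fun s => C.op (cutoff N) (C.invRoot (C.mild ν x F s)))
      (Icc 0 t) := fun N => (C.op (cutoff N)).continuous.comp_continuousOn hwc
  have hl1 : Tendsto (fun N => ∫ s in (0 : ℝ)..t,
      ‖C.op (cutoff N) (C.invRoot (C.mild ν x F s))‖ ^ 2) atTop
      (𝓝 (∫ s in (0 : ℝ)..t, ‖C.invRoot (C.mild ν x F s)‖ ^ 2)) := by
    refine intervalIntegral.tendsto_integral_filter_of_dominated_convergence
      (fun s => ‖C.invRoot (C.mild ν x F s)‖ ^ 2) (Eventually.of_forall fun N => ?_)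
      (Eventually.of_forall fun N => Eventually.of_forall fun s _ => ?_)
      ((hwc.norm.pow 2).intervalIntegrable_of_Icc ht) (Eventually.of_forall fun s _ =>
        (C.tendsto_op_cutoff _).norm.pow 2)
    · rw [uIoc_of_le ht]
      exact (((hcutc N).norm.pow 2).mono Ioc_subset_Icc_self).aestronglyMeasurable
        measurableSet_Ioc
    · rw [Real.norm_of_nonneg (by positivity)]
      exact pow_le_pow_left₀ (norm_nonneg _) (C.norm_op_cutoff_le N _) 2
  have hl2 : Tendsto (fun N => ∫ s in (0 : ℝ)..t,
      inner ℝ (C.op (cutoff N) (C.invRoot (C.mild ν x F s))) (J2 (F s))) atTop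
      (𝓝 (∫ s in (0 : ℝ)..t, inner ℝ (C.invRoot (C.mild ν x F s)) (J2 (F s)))) := by
    refine intervalIntegral.tendsto_integral_filter_of_dominated_convergence
      (fun s => ‖C.invRoot (C.mild ν x F s)‖ * ‖J2 (F s)‖) (Eventually.of_forall fun N => ?_)
      (Eventually.of_forall fun N => Eventually.of_forall fun s _ => ?_)
      ((hwc.norm.mul hGc.norm.continuousOn).intervalIntegrable_of_Icc ht)
      (Eventually.of_forall fun s _ => (C.tendsto_op_cutoff _).inner tendsto_const_nhds)
    · rw [uIoc_of_le ht]
      exact (((hcutc N).inner hGc.continuousOn).mono Ioc_subset_Icc_self).aestronglyMeasurable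
        measurableSet_Ioc
    · exact (norm_inner_le_norm _ _).trans
        (mul_le_mul_of_nonneg_right (C.norm_op_cutoff_le N _) (norm_nonneg _))
  have hlim1 := ((C.tendsto_op_cutoff (J2 (C.mild ν x F t))).norm.pow 2).add
    (hl1.const_mul (2 * ν))
  have hlim2 := ((C.tendsto_op_cutoff (J2 x)).norm.pow 2).sub (hl2.const_mul 2)
  have := tendsto_nhds_unique (hlim1.congr fun N => hN N) hlim2
  rw [hJ2] at this
  simpa only [ContinuousLinearMap.comp_apply, C.inner_invRoot] using this

end SymbolCalculus

end HyperNS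

end

/-! ### Gronwall, radial retraction, and the globally Lipschitz problem. -/

noncomputable section

namespace HyperNS

open Filter Topology Set

/-- Gronwall's inequality in integral form, with a variable coefficient. -/
theorem le_mul_exp_of_le_integral {φ k : ℝ → ℝ} (hφ : Continuous φ) (hk : Continuous k)
    (hk0 : ∀ t, 0 ≤ k t) {a T : ℝ}
    (h : ∀ t ∈ Icc 0 T, φ t ≤ a + ∫ s in (0 : ℝ)..t, k s * φ s) {t : ℝ} (ht : t ∈ Icc 0 T) :
    φ t ≤ a * Real.exp (∫ s in (0 : ℝ)..t, k s) := by
  set Ψ : ℝ → ℝ := fun t => a + ∫ s in (0 : ℝ)..t, k s * φ s with hΨ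
  set κ : ℝ → ℝ := fun t => ∫ s in (0 : ℝ)..t, k s with hκ
  have hdΨ : ∀ t, HasDerivAt Ψ (k t * φ t) t := fun t =>
    ((hk.mul hφ).integral_hasStrictDerivAt 0 t).hasDerivAt.const_add a
  have hdκ : ∀ t, HasDerivAt κ (k t) t := fun t => (hk.integral_hasStrictDerivAt 0 t).hasDerivAt
  have hd : ∀ t, HasDerivAt (fun t => Ψ t * Real.exp (-κ t))
      (k t * φ t * Real.exp (-κ t) + Ψ t * (Real.exp (-κ t) * -k t)) t := fun t =>
    (hdΨ t).mul (hdκ t).neg.exp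
  have hanti : AntitoneOn (fun t => Ψ t * Real.exp (-κ t)) (Icc 0 T) := by
    refine antitoneOn_of_deriv_nonpos (convex_Icc 0 T)
      (fun t _ => (hd t).continuousAt.continuousWithinAt)
      (fun t _ => (hd t).differentiableAt.differentiableWithinAt) fun t ht => ?_
    rw [interior_Icc] at ht
    rw [(hd t).deriv]
    have h1 := h t ⟨ht.1.le, ht.2.le⟩
    have h2 := mul_nonneg (mul_nonneg (hk0 t) (sub_nonneg.2 h1)) (Real.exp_pos (-κ t)).le
    simp only [hΨ]
    linarith
  have h1 := hanti ⟨le_rfl, ht.1.trans ht.2⟩ ht ht.1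
  have h0 : Ψ 0 * Real.exp (-κ 0) = a := by simp [hΨ, hκ]
  simp only [h0] at h1
  refine (h t ht).trans ?_
  rw [Real.exp_neg, ← div_eq_mul_inv, div_le_iff₀ (Real.exp_pos _)] at h1
  exact h1

/-- Bounds on the intervals [0, n] are merged into one continuous radius. After making K increasing,
the constant K'⌈t+1⌉ is admissible near t; the admissible sets are convex, so a partition of unity
glues these constants. -/
theorem exists_continuous_ge (K : ℕ → ℝ) :
    ∃ M : ℝ → ℝ, Continuous M ∧ (∀ t, 1 ≤ M t) ∧ ∀ t, K ⌈t⌉₊ ≤ M t := by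
  set K' : ℕ → ℝ := fun n => 1 + ∑ j ∈ Finset.range (n + 1), |K j| with hK'
  have hmono : Monotone K' := fun m n h => by
    have := Finset.sum_le_sum_of_subset_of_nonneg
      (Finset.range_subset_range.2 (Nat.succ_le_succ h)) (f := fun j => |K j|)
      (fun i _ _ => abs_nonneg (K i))
    simp only [hK']
    linarith
  have hle : ∀ n, K n ≤ K' n := fun n => by
    have := Finset.single_le_sum (f := fun j => |K j|) (fun i _ => abs_nonneg (K i))
      (Finset.self_mem_range_succ n)
    simp only [hK']
    linarith [le_abs_self (K n)]
  have h1 : ∀ n, 1 ≤ K' n := fun n =>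
    le_add_of_nonneg_right (Finset.sum_nonneg fun i _ => abs_nonneg _)
  obtain ⟨M, hM⟩ := exists_continuous_forall_mem_convex_of_local_const
    (t := fun t : ℝ => Ici (K' ⌈t⌉₊)) (fun t => convex_Ici _) (fun t => by
      refine ⟨K' ⌈t + 1⌉₊, ?_⟩
      filter_upwards [Iic_mem_nhds (show t < t + 1 by linarith)] with y hy
      exact hmono (Nat.ceil_mono hy))
  exact ⟨M, M.continuous, fun t => (h1 _).trans (hM t), fun t => (hle _).trans (hM t)⟩

section Retraction

variable {X : Type*} [NormedAddCommGroup X]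

/-- The scaling factor of the radial retraction onto the ball of radius `m`. -/
def shrink (m : ℝ) (u : X) : ℝ := m / max m ‖u‖

theorem shrink_nonneg {m : ℝ} (hm : 0 < m) (u : X) : 0 ≤ shrink m u := by
  unfold shrink; positivity

theorem shrink_le_one {m : ℝ} (hm : 0 < m) (u : X) : shrink m u ≤ 1 :=
  (div_le_one (lt_max_of_lt_left hm)).2 (le_max_left _ _)

theorem shrink_eq_one {m : ℝ} (hm : 0 < m) {u : X} (h : ‖u‖ ≤ m) : shrink m u = 1 := by
  rw [shrink, max_eq_left h, div_self hm.ne']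

theorem norm_shrink_smul_le [NormedSpace ℝ X] {m : ℝ} (hm : 0 < m) (u : X) : ‖shrink m u • u‖ ≤ m := by
  rw [norm_smul, Real.norm_of_nonneg (shrink_nonneg hm u), shrink, div_mul_eq_mul_div,
    div_le_iff₀ (lt_max_of_lt_left hm)]
  exact mul_le_mul_of_nonneg_left (le_max_right _ _) hm.le

theorem norm_shrink_smul_sub_le [NormedSpace ℝ X] {m : ℝ} (hm : 0 < m) (u v : X) :
    ‖shrink m u • u - shrink m v • v‖ ≤ 2 * ‖u - v‖ := by
  have h1 : shrink m u • u - shrink m v • v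
      = shrink m u • (u - v) + (shrink m u - shrink m v) • v := by
    rw [smul_sub, sub_smul]; abel
  have h2 : ‖shrink m u • (u - v)‖ ≤ ‖u - v‖ := by
    rw [norm_smul, Real.norm_of_nonneg (shrink_nonneg hm u)]
    exact mul_le_of_le_one_left (norm_nonneg _) (shrink_le_one hm u)
  have h3 : ‖(shrink m u - shrink m v) • v‖ ≤ ‖u - v‖ := by
    have hu : 0 < max m ‖u‖ := lt_max_of_lt_left hm
    have hv : 0 < max m ‖v‖ := lt_max_of_lt_left hm
    -- The difference of the factors is bounded by ‖u - v‖ times m / (max m ‖u‖ · max m ‖v‖), and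
    -- the latter compensates the factor ‖v‖.
    have e : shrink m u - shrink m v
        = (max m ‖v‖ - max m ‖u‖) * (m / (max m ‖u‖ * max m ‖v‖)) := by
      unfold shrink; field_simp
    have h4 : |max m ‖v‖ - max m ‖u‖| ≤ ‖u - v‖ := by
      refine (abs_max_sub_max_le_max _ _ _ _).trans ?_
      rw [sub_self, abs_zero, max_eq_right (abs_nonneg _), norm_sub_rev]
      exact abs_norm_sub_norm_le v u
    have h5 : m / (max m ‖u‖ * max m ‖v‖) * ‖v‖ ≤ 1 := by
      rw [div_mul_eq_mul_div, div_le_one (by positivity)]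
      exact mul_le_mul (le_max_left _ _) (le_max_right _ _) (norm_nonneg _) hu.le
    rw [norm_smul, e, norm_mul, mul_assoc, Real.norm_of_nonneg (by positivity :
      0 ≤ m / (max m ‖u‖ * max m ‖v‖)), Real.norm_eq_abs]
    calc _ ≤ ‖u - v‖ * 1 := mul_le_mul h4 h5 (by positivity) (norm_nonneg _)
      _ = _ := mul_one _
  rw [h1]
  linarith [norm_add_le (shrink m u • (u - v)) ((shrink m u - shrink m v) • v)]

theorem continuous_shrink {m : ℝ → ℝ} (hm : Continuous m) (hm0 : ∀ t, 0 < m t) {u : ℝ → X}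
    (hu : Continuous u) : Continuous fun t => shrink (m t) (u t) := by
  unfold shrink
  exact hm.div (hm.max hu.norm) fun t => (lt_max_of_lt_left (hm0 t)).ne'

end Retraction

namespace SymbolCalculus

variable {X : Type*} [NormedAddCommGroup X] [InnerProductSpace ℝ X] [CompleteSpace X]
  (C : SymbolCalculus X) {ν : ℝ}

/-- Existence of global solutions for a nonlinearity which is bounded and Lipschitz, locally
uniformly in time. -/
theorem exists_mild_of_lipschitz (hν : 0 < ν) {G : ℝ → X → X} {h : ℝ → ℝ} (hh : Continuous h)
    (hG : ∀ u : ℝ → X, Continuous u → Continuous fun s => G s (u s))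
    (hb : ∀ s u, ‖G s u‖ ≤ h s) (hl : ∀ s u v, ‖G s u - G s v‖ ≤ h s * ‖u - v‖) (x : X) :
    ∃ w : C(ℝ≥0, X), ∀ t : ℝ≥0, w t = C.mild ν x (fun s => G s (w s.toNNReal)) t := by
  -- A weighted sup norm makes the fixed point global in time: the unknown is ω = e^{-g}w. With this
  -- g, the function h² e^{2g} is (ν/4) times the derivative of e^{2g}, so the energy bound for a
  -- difference gives d²(e^{2g} - 1)/4, a contraction by 1/2.
  set g : ℝ → ℝ := fun t => ∫ s in (0 : ℝ)..t, 2 * ν⁻¹ * h s ^ 2 with hg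
  have hkc : Continuous fun s => 2 * ν⁻¹ * h s ^ 2 := by fun_prop
  have hdg : ∀ t, HasDerivAt g (2 * ν⁻¹ * h t ^ 2) t := fun t =>
    (hkc.integral_hasStrictDerivAt 0 t).hasDerivAt
  have hgc : Continuous g := continuous_iff_continuousAt.2 fun t => (hdg t).continuousAt
  have hg0 : ∀ t, 0 ≤ t → 0 ≤ g t := fun t ht =>
    intervalIntegral.integral_nonneg ht fun s _ => by positivity
  have hcurve : ∀ ω : BoundedContinuousFunction ℝ≥0 X,
      Continuous fun s : ℝ => G s (Real.exp (g s) • ω s.toNNReal) := fun ω =>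
    hG _ ((Real.continuous_exp.comp hgc).smul (ω.continuous.comp continuous_real_toNNReal))
  set Φ : BoundedContinuousFunction ℝ≥0 X → ℝ → X := fun ω t =>
    C.mild ν x (fun s => G s (Real.exp (g s) • ω s.toNNReal)) t with hΦ
  have hexp : ∀ t, Real.exp (-g t) ^ 2 * Real.exp (g t) ^ 2 = 1 := fun t => by
    rw [← mul_pow, ← Real.exp_add]; simp
  -- The energy bound gives ‖Φ‖² ≤ ‖x‖² + g, and g ≤ e^{2g}: the rescaled curve is bounded on all of
  -- ℝ₊, uniformly in ω.
  have hbound : ∀ ω (t : ℝ≥0), ‖Real.exp (-g t) • Φ ω t‖ ≤ ‖x‖ + 1 := by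
    intro ω t
    have h1 := C.sq_norm_mild_le hν (hcurve ω) x t.coe_nonneg
    have h2 : ∫ s in (0 : ℝ)..t, ‖G s (Real.exp (g s) • ω s.toNNReal)‖ ^ 2
        ≤ ∫ s in (0 : ℝ)..t, h s ^ 2 := by
      refine intervalIntegral.integral_mono_on t.coe_nonneg
        (((hcurve ω).norm.pow 2).intervalIntegrable _ _) ((hh.pow 2).intervalIntegrable _ _)
        fun s _ => pow_le_pow_left₀ (norm_nonneg _) (hb _ _) 2
    have h3 : g t = 2 * (ν⁻¹ * ∫ s in (0 : ℝ)..t, h s ^ 2) := by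
      simp only [hg]
      rw [intervalIntegral.integral_const_mul, mul_assoc]
    have h4 := mul_le_mul_of_nonneg_left h2 (inv_pos.2 hν).le
    have h5 : ‖Φ ω t‖ ^ 2 ≤ ‖x‖ ^ 2 + g t := by
      have := hg0 t t.coe_nonneg
      linarith
    have h6 : ‖Φ ω t‖ ^ 2 ≤ (‖x‖ + 1) ^ 2 * Real.exp (g t) ^ 2 := by
      have e1 : 1 ≤ Real.exp (g t) := Real.one_le_exp (hg0 t t.coe_nonneg)
      have e2 : g t ≤ Real.exp (g t) ^ 2 := by
        nlinarith [Real.add_one_le_exp (g t)]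
      have e3 : 1 ≤ Real.exp (g t) ^ 2 := one_le_pow₀ e1
      have e4 : 0 ≤ ‖x‖ := norm_nonneg x
      nlinarith [mul_nonneg e4 e4, mul_nonneg (mul_nonneg e4 e4) (sub_nonneg.2 e3),
        mul_nonneg e4 (zero_le_one.trans e3)]
    refine (pow_le_pow_iff_left₀ (norm_nonneg _) (by positivity) two_ne_zero).1 ?_
    rw [norm_smul, Real.norm_of_nonneg (Real.exp_pos _).le, mul_pow]
    calc _ ≤ Real.exp (-g t) ^ 2 * ((‖x‖ + 1) ^ 2 * Real.exp (g t) ^ 2) :=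
          mul_le_mul_of_nonneg_left h6 (by positivity)
      _ = (‖x‖ + 1) ^ 2 * (Real.exp (-g t) ^ 2 * Real.exp (g t) ^ 2) := by ring
      _ = _ := by rw [hexp, mul_one]
  have hcont : ∀ ω, Continuous fun t : ℝ≥0 => Real.exp (-g t) • Φ ω t := by
    intro ω
    refine Continuous.smul (by fun_prop) ?_
    exact (C.continuousOn_mild hν (hcurve ω) x).comp_continuous NNReal.continuous_coe
      fun t => t.coe_nonneg
  set Ψ : BoundedContinuousFunction ℝ≥0 X → BoundedContinuousFunction ℝ≥0 X := fun ω =>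
    BoundedContinuousFunction.ofNormedAddCommGroup _ (hcont ω) _ (hbound ω) with hΨ
  have hcontr : ContractingWith (1 / 2 : ℝ≥0) Ψ := by
    refine ⟨by norm_num, LipschitzWith.of_dist_le_mul fun ω₁ ω₂ => ?_⟩
    refine (BoundedContinuousFunction.dist_le (by positivity)).2 fun t => ?_
    set d := dist ω₁ ω₂ with hd
    have hd0 : 0 ≤ d := dist_nonneg
    rw [dist_eq_norm]
    have e0 : Ψ ω₁ t - Ψ ω₂ t = Real.exp (-g t) • (Φ ω₁ t - Φ ω₂ t) := (smul_sub _ _ _).symm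
    have e1 : Φ ω₁ t - Φ ω₂ t = C.mild ν 0 (fun s => G s (Real.exp (g s) • ω₁ s.toNNReal)
        - G s (Real.exp (g s) • ω₂ s.toNNReal)) t := by
      rw [← sub_self x, ← C.mild_sub_mild hν (hcurve ω₁) (hcurve ω₂) x x t.coe_nonneg]
    have h1 := C.sq_norm_mild_le hν (F := fun s => G s (Real.exp (g s) • ω₁ s.toNNReal)
        - G s (Real.exp (g s) • ω₂ s.toNNReal)) ((hcurve ω₁).sub (hcurve ω₂)) 0 t.coe_nonneg
    have h2 : ∫ s in (0 : ℝ)..t, ‖G s (Real.exp (g s) • ω₁ s.toNNReal)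
        - G s (Real.exp (g s) • ω₂ s.toNNReal)‖ ^ 2
        ≤ ∫ s in (0 : ℝ)..t, ν * d ^ 2 / 4 * (Real.exp (2 * g s) * (2 * (2 * ν⁻¹ * h s ^ 2))) := by
      refine intervalIntegral.integral_mono_on t.coe_nonneg
        ((((hcurve ω₁).sub (hcurve ω₂)).norm.pow 2).intervalIntegrable _ _)
        (Continuous.intervalIntegrable (by fun_prop) _ _) fun s _ => ?_
      have h3 : ‖G s (Real.exp (g s) • ω₁ s.toNNReal) - G s (Real.exp (g s) • ω₂ s.toNNReal)‖
          ≤ h s * (Real.exp (g s) * d) := by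
        have hh0 : 0 ≤ h s := (norm_nonneg _).trans (hb s 0)
        refine (hl _ _ _).trans (mul_le_mul_of_nonneg_left ?_ hh0)
        rw [← smul_sub, norm_smul, Real.norm_of_nonneg (Real.exp_pos _).le, ← dist_eq_norm]
        exact mul_le_mul_of_nonneg_left (BoundedContinuousFunction.dist_coe_le_dist _)
          (Real.exp_pos _).le
      refine (pow_le_pow_left₀ (norm_nonneg _) h3 2).trans (le_of_eq ?_)
      rw [show 2 * g s = g s + g s by ring, Real.exp_add]
      field_simp
      ring
    have h3 : ∫ s in (0 : ℝ)..t, Real.exp (2 * g s) * (2 * (2 * ν⁻¹ * h s ^ 2))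
        = Real.exp (2 * g t) - 1 := by
      have := intervalIntegral.integral_eq_sub_of_hasDerivAt (a := 0) (b := t)
        (f := fun s => Real.exp (2 * g s)) (fun s _ => ((hdg s).const_mul 2).exp)
        (Continuous.intervalIntegrable (by fun_prop) _ _)
      rw [this]
      simp [hg]
    rw [intervalIntegral.integral_const_mul, h3] at h2
    have h4 : ‖Φ ω₁ t - Φ ω₂ t‖ ^ 2 ≤ d ^ 2 / 4 * Real.exp (g t) ^ 2 := by
      rw [e1]
      refine h1.trans ?_
      have := mul_le_mul_of_nonneg_left h2 (inv_pos.2 hν).le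
      have e2 : ν⁻¹ * (ν * d ^ 2 / 4 * (Real.exp (2 * g t) - 1))
          = d ^ 2 / 4 * Real.exp (g t) ^ 2 - d ^ 2 / 4 := by
        rw [show 2 * g t = g t + g t by ring, Real.exp_add]
        field_simp
      rw [e2] at this
      rw [norm_zero]
      nlinarith [sq_nonneg d]
    rw [e0]
    refine (pow_le_pow_iff_left₀ (norm_nonneg _) (by positivity) two_ne_zero).1 ?_
    rw [norm_smul, Real.norm_of_nonneg (Real.exp_pos _).le, mul_pow]
    calc _ ≤ Real.exp (-g t) ^ 2 * (d ^ 2 / 4 * Real.exp (g t) ^ 2) :=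
          mul_le_mul_of_nonneg_left h4 (by positivity)
      _ = d ^ 2 / 4 * (Real.exp (-g t) ^ 2 * Real.exp (g t) ^ 2) := by ring
      _ = _ := by rw [hexp]; push_cast; ring
  set ω := hcontr.fixedPoint Ψ with hω
  have hfix : Ψ ω = ω := hcontr.fixedPoint_isFixedPt
  have hval : ∀ t : ℝ≥0, Real.exp (g t) • ω t = Φ ω t := by
    intro t
    have : ω t = Real.exp (-g t) • Φ ω t := by
      conv_lhs => rw [← hfix]
      rfl
    rw [this, smul_smul, ← Real.exp_add, add_neg_cancel, Real.exp_zero, one_smul]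
  refine ⟨⟨fun t => Real.exp (g t) • ω t, by fun_prop⟩, fun t => ?_⟩
  simp only [ContinuousMap.coe_mk]
  rw [hval t]
  refine C.mild_congr x t.coe_nonneg fun s hs => ?_
  simp only [Real.coe_toNNReal s hs.1]

/-- Stability of mild solutions with respect to the data. -/
theorem mild_stability (hν : 0 < ν) (L T : ℝ) (hT : 0 ≤ T) :
    ∃ c, 0 < c ∧ ∀ (x₁ x₂ : X) (w₁ w₂ F₁ F₂ : ℝ → X) (δ : ℝ), 0 ≤ δ → Continuous w₁ →
      Continuous w₂ → Continuous F₁ → Continuous F₂ →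
      (∀ t ∈ Icc 0 T, w₁ t = C.mild ν x₁ F₁ t) → (∀ t ∈ Icc 0 T, w₂ t = C.mild ν x₂ F₂ t) →
      (∀ t ∈ Icc 0 T, ‖F₁ t - F₂ t‖ ≤ L * (‖w₁ t - w₂ t‖ + δ)) →
      (∀ t ∈ Icc 0 T, ‖w₁ t - w₂ t‖ ^ 2 ≤ c * (‖x₁ - x₂‖ ^ 2 + δ ^ 2)) ∧
      ‖x₁ - x₂‖ ^ 2 + ν⁻¹ * ∫ s in (0 : ℝ)..T, ‖F₁ s - F₂ s‖ ^ 2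
        ≤ c * (‖x₁ - x₂‖ ^ 2 + δ ^ 2) := by
  set k := ν⁻¹ * (2 * L ^ 2) with hk
  have hk0 : 0 ≤ k := by positivity
  set E := Real.exp (k * T) with hE
  have hE0 : 0 < E := Real.exp_pos _
  -- Gronwall is applied to ‖w₁ - w₂‖² + δ², the δ² making the inequality homogeneous. The term E
  -- serves the pointwise bound, and 1 + kTE the bound on the data of the difference.
  refine ⟨E + 1 + k * T * E, by positivity, ?_⟩
  intro x₁ x₂ w₁ w₂ F₁ F₂ δ hδ hw₁ hw₂ hF₁ hF₂ h₁ h₂ hL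
  set D := ‖x₁ - x₂‖ ^ 2 + δ ^ 2 with hD
  have hD0 : 0 ≤ D := by positivity
  have hFsq : ∀ s ∈ Icc 0 T, ‖F₁ s - F₂ s‖ ^ 2
      ≤ 2 * L ^ 2 * (‖w₁ s - w₂ s‖ ^ 2 + δ ^ 2) := by
    intro s hs
    refine (pow_le_pow_left₀ (norm_nonneg _) (hL s hs) 2).trans ?_
    nlinarith [mul_nonneg (sq_nonneg L) (sq_nonneg (‖w₁ s - w₂ s‖ - δ))]
  have hwsq : ∀ t ∈ Icc 0 T, ‖w₁ t - w₂ t‖ ^ 2 + δ ^ 2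
      ≤ D + ∫ s in (0 : ℝ)..t, k * (‖w₁ s - w₂ s‖ ^ 2 + δ ^ 2) := by
    intro t ht
    have e : w₁ t - w₂ t = C.mild ν (x₁ - x₂) (fun s => F₁ s - F₂ s) t := by
      rw [h₁ t ht, h₂ t ht, C.mild_sub_mild hν hF₁ hF₂ x₁ x₂ ht.1]
    have h3 := C.sq_norm_mild_le hν (F := fun s => F₁ s - F₂ s) (hF₁.sub hF₂) (x₁ - x₂) ht.1
    rw [← e] at h3
    have h4 : ∫ s in (0 : ℝ)..t, ‖F₁ s - F₂ s‖ ^ 2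
        ≤ ∫ s in (0 : ℝ)..t, 2 * L ^ 2 * (‖w₁ s - w₂ s‖ ^ 2 + δ ^ 2) :=
      intervalIntegral.integral_mono_on ht.1 (Continuous.intervalIntegrable (by fun_prop) _ _)
        (Continuous.intervalIntegrable (by fun_prop) _ _)
        fun s hs => hFsq s ⟨hs.1, hs.2.trans ht.2⟩
    have h5 := mul_le_mul_of_nonneg_left h4 (inv_pos.2 hν).le
    have e2 : ∀ s, k * (‖w₁ s - w₂ s‖ ^ 2 + δ ^ 2)
        = ν⁻¹ * (2 * L ^ 2 * (‖w₁ s - w₂ s‖ ^ 2 + δ ^ 2)) := fun s => mul_assoc _ _ _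
    simp only [e2]
    rw [intervalIntegral.integral_const_mul]
    linarith
  have hG : ∀ t ∈ Icc 0 T, ‖w₁ t - w₂ t‖ ^ 2 + δ ^ 2 ≤ D * E := by
    intro t ht
    refine (le_mul_exp_of_le_integral (φ := fun s => ‖w₁ s - w₂ s‖ ^ 2 + δ ^ 2)
      (by fun_prop) continuous_const (fun _ => hk0) hwsq ht).trans ?_
    refine mul_le_mul_of_nonneg_left (Real.exp_le_exp.2 ?_) hD0
    rw [intervalIntegral.integral_const, sub_zero, smul_eq_mul, mul_comm]
    exact mul_le_mul_of_nonneg_left ht.2 hk0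
  have hrest : 0 ≤ (1 + k * T * E) * D := by positivity
  refine ⟨fun t ht => ?_, ?_⟩
  · nlinarith [hG t ht, sq_nonneg δ]
  · have h4 : ∫ s in (0 : ℝ)..T, ‖F₁ s - F₂ s‖ ^ 2 ≤ ∫ s in (0 : ℝ)..T, 2 * L ^ 2 * (D * E) := by
      refine intervalIntegral.integral_mono_on hT (Continuous.intervalIntegrable (by fun_prop) _ _)
        (Continuous.intervalIntegrable (by fun_prop) _ _) fun s hs => (hFsq s hs).trans ?_
      exact mul_le_mul_of_nonneg_left (hG s hs) (by positivity)
    rw [intervalIntegral.integral_const, sub_zero, smul_eq_mul] at h4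
    have h5 := mul_le_mul_of_nonneg_left h4 (inv_pos.2 hν).le
    have e2 : ν⁻¹ * (T * (2 * L ^ 2 * (D * E))) = k * T * E * D := by rw [hk]; ring
    have h6 : 0 ≤ E * D := by positivity
    rw [e2] at h5
    have h7 : ‖x₁ - x₂‖ ^ 2 ≤ D := by rw [hD]; nlinarith [sq_nonneg δ]
    linarith

end SymbolCalculus

end HyperNS

end

/-! ### The abstract Navier-Stokes equation. -/

noncomputable section

namespace HyperNS

open Filter Topology Set

namespace SymbolCalculus

variable {X : Type*} [NormedAddCommGroup X] [InnerProductSpace ℝ X]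
  (C : SymbolCalculus X) {ν : ℝ} {B : X →L[ℝ] X →L[ℝ] X} {K : ℝ}

/-- Mild solutions of the abstract Navier-Stokes equation. -/
def IsMild (ν : ℝ) (B : X →L[ℝ] X →L[ℝ] X) (x : X) (z w : C(ℝ≥0, X)) : Prop :=
  ∀ t : ℝ≥0, w t = C.mild ν x
    (fun s => B (w s.toNNReal + z s.toNNReal) (w s.toNNReal + z s.toNNReal)) t

theorem IsMild.apply {C : SymbolCalculus X} {x : X} {z w : C(ℝ≥0, X)} (h : C.IsMild ν B x z w)
    {t : ℝ} (ht : 0 ≤ t) : w t.toNNReal = C.mild ν x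
      (fun s => B (w s.toNNReal + z s.toNNReal) (w s.toNNReal + z s.toNNReal)) t := by
  have := h t.toNNReal
  rwa [Real.coe_toNNReal t ht] at this

theorem continuous_curve {X : Type*} [TopologicalSpace X] (w : C(ℝ≥0, X)) : Continuous fun t : ℝ => w t.toNNReal :=
  w.continuous.comp continuous_real_toNNReal

theorem continuous_nonlinearity (B : X →L[ℝ] X →L[ℝ] X) (z w : C(ℝ≥0, X)) : Continuous fun s : ℝ =>
    B (w s.toNNReal + z s.toNNReal) (w s.toNNReal + z s.toNNReal) := by
  have h1 := (continuous_curve w).add (continuous_curve z)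
  exact (B.continuous.comp h1).clm_apply h1

/-- Lipschitz bound for the nonlinearity on bounded sets. -/
theorem norm_bilin_sub_le (hBle : ∀ u w : X, ‖B u w‖ ≤ K * ‖u‖ * ‖w‖) (hK : 0 ≤ K) {M : ℝ}
    {p q : X} (hp : ‖p‖ ≤ M) (hq : ‖q‖ ≤ M) : ‖B p p - B q q‖ ≤ 2 * K * M * ‖p - q‖ := by
  have e : B p p - B q q = B (p - q) p + B q (p - q) := by
    simp only [map_sub, sub_apply]; abel
  have hM := (norm_nonneg p).trans hp
  rw [e]
  refine (norm_add_le _ _).trans ((add_le_add (hBle _ _) (hBle _ _)).trans ?_)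
  have h1 := mul_le_mul_of_nonneg_left hp (mul_nonneg hK (norm_nonneg (p - q)))
  have h2 := mul_le_mul_of_nonneg_left hq (mul_nonneg hK (norm_nonneg (p - q)))
  linarith

variable [CompleteSpace X]

/-- A priori bound for solutions of the equation with a possibly damped nonlinearity. -/
theorem exists_apriori_bound (hν : 0 < ν) (hK : 0 ≤ K)
    (hB : ∀ u w, ‖B u w‖ ≤ K * ‖C.invRoot u‖ * ‖w‖)
    (hB0 : ∀ u w, inner ℝ (C.invRoot (C.invRoot (C.invRoot w))) (B u w) = 0) (T R : ℝ)
    (hT : 0 ≤ T) :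
    ∃ M, ∀ (x : X) (w z : ℝ → X) (θ : ℝ → ℝ), Continuous w → Continuous z → Continuous θ →
      (∀ t, 0 ≤ θ t) → (∀ t, θ t ≤ 1) → ‖x‖ ≤ R → (∀ t ∈ Icc 0 T, ‖z t‖ ≤ R) →
      (∀ t, 0 ≤ t → w t = C.mild ν x (fun s => θ s • B (w s + z s) (w s + z s)) t) →
      ∀ t ∈ Icc 0 T, ‖w t‖ ≤ M := by
  -- With J = Λ^{-1/2}, the L² energy leaves 2‖J²w‖·K(‖Jw‖+R)R. Its first half is at most ν‖Jw‖² +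
  -- K²R²ν⁻¹‖J²w‖², its second at most ‖J²w‖² + K²R⁴; this gives k₁ and a₁. Then E₁ bounds ‖J²w‖², D
  -- bounds ∫‖Jw‖², and E₂ is the Gronwall factor for ‖w‖².
  set k₁ := K ^ 2 * R ^ 2 * ν⁻¹ + 1 with hk₁
  have hk₁0 : 0 ≤ k₁ := by positivity
  set a₁ := R ^ 2 + K ^ 2 * R ^ 4 * T with ha₁
  have ha₁0 : 0 ≤ a₁ := by positivity
  set E₁ := a₁ * Real.exp (k₁ * T) with hE₁
  have hE₁0 : 0 ≤ E₁ := by positivity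
  set D := ν⁻¹ * (a₁ + k₁ * E₁ * T) with hD
  set E₂ := Real.exp (4 * K ^ 2 * ν⁻¹ * (D + R ^ 2 * T)) with hE₂
  refine ⟨√(2 * R ^ 2 * E₂), ?_⟩
  intro x w z θ hw hz hθ hθ0 hθ1 hx hzR hsol
  set F : ℝ → X := fun s => θ s • B (w s + z s) (w s + z s) with hF
  have hFc : Continuous F := by fun_prop
  set J := C.invRoot with hJ
  have hJle : ∀ u, ‖J u‖ ≤ ‖u‖ := C.norm_invRoot_le
  have hR : 0 ≤ R := (norm_nonneg x).trans hx
  -- the energy inequality two levels below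
  have hen : ∀ t ∈ Icc 0 T, ‖J (J (w t))‖ ^ 2 + ν * ∫ s in (0 : ℝ)..t, ‖J (w s)‖ ^ 2
      ≤ a₁ + ∫ s in (0 : ℝ)..t, k₁ * ‖J (J (w s))‖ ^ 2 := by
    intro t ht
    have h1 := C.low_energy_mild hν hFc x ht.1
    have e1 : ∫ s in (0 : ℝ)..t, ‖J (C.mild ν x F s)‖ ^ 2 = ∫ s in (0 : ℝ)..t, ‖J (w s)‖ ^ 2 := by
      refine intervalIntegral.integral_congr fun s hs => ?_
      rw [uIcc_of_le ht.1] at hs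
      simp only [hsol s hs.1, hF]
    have e2 : ∫ s in (0 : ℝ)..t, inner ℝ (J (J (J (C.mild ν x F s)))) (F s)
        = ∫ s in (0 : ℝ)..t, inner ℝ (J (J (J (w s)))) (F s) := by
      refine intervalIntegral.integral_congr fun s hs => ?_
      rw [uIcc_of_le ht.1] at hs
      simp only [hsol s hs.1, hF]
    rw [← hJ, e1, e2, ← hsol t ht.1] at h1
    have h2 : -2 * ∫ s in (0 : ℝ)..t, inner ℝ (J (J (J (w s)))) (F s)
        ≤ ∫ s in (0 : ℝ)..t, (ν * ‖J (w s)‖ ^ 2 + k₁ * ‖J (J (w s))‖ ^ 2 + K ^ 2 * R ^ 4) := by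
      rw [← intervalIntegral.integral_const_mul]
      refine intervalIntegral.integral_mono_on ht.1
        (Continuous.intervalIntegrable (by fun_prop) _ _)
        (Continuous.intervalIntegrable (by fun_prop) _ _) fun s hs => ?_
      have hzs := hzR s ⟨hs.1, hs.2.trans ht.2⟩
      -- The cancellation removes B(w + z, w). What remains contains w only once, through Jw, so
      -- together with ‖J²w‖ it is absorbed by the dissipation.
      have e1 : inner ℝ (J (J (J (w s)))) (F s)
          = θ s * inner ℝ (J (J (J (w s)))) (B (w s + z s) (z s)) := by
        simp only [hF, inner_smul_right]
        rw [map_add (B (w s + z s)), inner_add_right, hB0, zero_add]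
      have e2 : |inner ℝ (J (J (J (w s)))) (B (w s + z s) (z s))|
          ≤ ‖J (J (w s))‖ * (K * (‖J (w s)‖ + R) * R) := by
        refine (abs_real_inner_le_norm _ _).trans ?_
        refine mul_le_mul (hJle _) ((hB _ _).trans ?_) (norm_nonneg _) (norm_nonneg _)
        refine mul_le_mul ?_ hzs (norm_nonneg _) (by positivity)
        refine mul_le_mul_of_nonneg_left ?_ hK
        rw [map_add]
        exact (norm_add_le _ _).trans (by linarith [hJle (z s)])
      have e3 : -2 * inner ℝ (J (J (J (w s)))) (F s)
          ≤ 2 * (‖J (J (w s))‖ * (K * (‖J (w s)‖ + R) * R)) := by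
        rw [e1]
        have := mul_le_mul (hθ1 s) e2 (abs_nonneg _) zero_le_one
        have h3 : |θ s * inner ℝ (J (J (J (w s)))) (B (w s + z s) (z s))|
            = θ s * |inner ℝ (J (J (J (w s)))) (B (w s + z s) (z s))| := by
          rw [abs_mul, abs_of_nonneg (hθ0 s)]
        have h4 := neg_le_abs (θ s * inner ℝ (J (J (J (w s)))) (B (w s + z s) (z s)))
        linarith
      refine e3.trans ?_
      have e4 : 0 ≤ ν⁻¹ * (ν * ‖J (w s)‖ - K * R * ‖J (J (w s))‖) ^ 2 := by positivity
      have e5 : ν⁻¹ * (ν * ‖J (w s)‖ - K * R * ‖J (J (w s))‖) ^ 2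
          = ν * ‖J (w s)‖ ^ 2 - 2 * (K * R * ‖J (w s)‖ * ‖J (J (w s))‖)
            + K ^ 2 * R ^ 2 * ν⁻¹ * ‖J (J (w s))‖ ^ 2 := by
        field_simp
        ring
      rw [hk₁]
      nlinarith [sq_nonneg (‖J (J (w s))‖ - K * R ^ 2)]
    rw [intervalIntegral.integral_add (Continuous.intervalIntegrable (by fun_prop) _ _)
      (Continuous.intervalIntegrable (by fun_prop) _ _),
      intervalIntegral.integral_add (Continuous.intervalIntegrable (by fun_prop) _ _)
      (Continuous.intervalIntegrable (by fun_prop) _ _), intervalIntegral.integral_const_mul,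
      intervalIntegral.integral_const, sub_zero, smul_eq_mul] at h2
    have h3 : ‖J (J x)‖ ^ 2 ≤ R ^ 2 :=
      pow_le_pow_left₀ (norm_nonneg _) (((hJle _).trans (hJle _)).trans hx) 2
    have h4 : t * (K ^ 2 * R ^ 4) ≤ K ^ 2 * R ^ 4 * T := by
      rw [mul_comm]; exact mul_le_mul_of_nonneg_left ht.2 (by positivity)
    linarith
  have hd0 : ∀ t, 0 ≤ t → 0 ≤ ν * ∫ s in (0 : ℝ)..t, ‖J (w s)‖ ^ 2 := fun t ht =>
    mul_nonneg hν.le (intervalIntegral.integral_nonneg ht fun s _ => by positivity)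
  have hlow : ∀ t ∈ Icc 0 T, ‖J (J (w t))‖ ^ 2 ≤ E₁ := by
    intro t ht
    refine (le_mul_exp_of_le_integral (φ := fun s => ‖J (J (w s))‖ ^ 2) (a := a₁)
      (by fun_prop) continuous_const (fun _ => hk₁0)
      (fun t ht => by linarith [hen t ht, hd0 t ht.1]) ht).trans ?_
    refine mul_le_mul_of_nonneg_left (Real.exp_le_exp.2 ?_) ha₁0
    rw [intervalIntegral.integral_const, sub_zero, smul_eq_mul, mul_comm]
    exact mul_le_mul_of_nonneg_left ht.2 hk₁0
  have hdiss : ∀ t ∈ Icc 0 T, ∫ s in (0 : ℝ)..t, ‖J (w s)‖ ^ 2 ≤ D := by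
    intro t ht
    have h1 : ∫ s in (0 : ℝ)..t, k₁ * ‖J (J (w s))‖ ^ 2 ≤ ∫ s in (0 : ℝ)..t, k₁ * E₁ :=
      intervalIntegral.integral_mono_on ht.1 (Continuous.intervalIntegrable (by fun_prop) _ _)
        (Continuous.intervalIntegrable (by fun_prop) _ _) fun s hs =>
        mul_le_mul_of_nonneg_left (hlow s ⟨hs.1, hs.2.trans ht.2⟩) hk₁0
    rw [intervalIntegral.integral_const, sub_zero, smul_eq_mul] at h1
    have h2 : t * (k₁ * E₁) ≤ k₁ * E₁ * T := by
      rw [mul_comm]; exact mul_le_mul_of_nonneg_left ht.2 (by positivity)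
    have h3 := hen t ht
    rw [hD, ← div_eq_inv_mul, le_div_iff₀' hν]
    nlinarith [sq_nonneg ‖J (J (w t))‖]
  have hFsq : ∀ s ∈ Icc 0 T, ‖F s‖ ^ 2
      ≤ 4 * K ^ 2 * (‖J (w s)‖ ^ 2 + R ^ 2) * (‖w s‖ ^ 2 + R ^ 2) := by
    intro s hs
    have hzs := hzR s hs
    have h1 : ‖F s‖ ≤ K * (‖J (w s)‖ + R) * (‖w s‖ + R) := by
      simp only [hF, norm_smul, Real.norm_of_nonneg (hθ0 s)]
      refine (mul_le_of_le_one_left (norm_nonneg _) (hθ1 s)).trans ((hB _ _).trans ?_)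
      refine mul_le_mul (mul_le_mul_of_nonneg_left ?_ hK) ?_ (norm_nonneg _) (by positivity)
      · rw [map_add]
        exact (norm_add_le _ _).trans (by linarith [hJle (z s)])
      · exact (norm_add_le _ _).trans (by linarith)
    refine (pow_le_pow_left₀ (norm_nonneg _) h1 2).trans ?_
    have h2 : (‖J (w s)‖ + R) ^ 2 ≤ 2 * (‖J (w s)‖ ^ 2 + R ^ 2) := by
      nlinarith [sq_nonneg (‖J (w s)‖ - R)]
    have h3 : (‖w s‖ + R) ^ 2 ≤ 2 * (‖w s‖ ^ 2 + R ^ 2) := by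
      nlinarith [sq_nonneg (‖w s‖ - R)]
    calc (K * (‖J (w s)‖ + R) * (‖w s‖ + R)) ^ 2
        = K ^ 2 * ((‖J (w s)‖ + R) ^ 2 * (‖w s‖ + R) ^ 2) := by ring
      _ ≤ K ^ 2 * ((2 * (‖J (w s)‖ ^ 2 + R ^ 2)) * (2 * (‖w s‖ ^ 2 + R ^ 2))) :=
          mul_le_mul_of_nonneg_left (mul_le_mul h2 h3 (by positivity) (by positivity))
            (by positivity)
      _ = _ := by ring
  -- The nonlinearity is quadratic, but one of its two factors is ‖Jw‖, whose square has integral at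
  -- most D. The inequality is thus linear in ‖w‖² with an integrable coefficient; adding R² on the
  -- left accounts for z.
  have hhigh : ∀ t ∈ Icc 0 T, ‖w t‖ ^ 2 + R ^ 2 ≤ 2 * R ^ 2
      + ∫ s in (0 : ℝ)..t, 4 * K ^ 2 * ν⁻¹ * (‖J (w s)‖ ^ 2 + R ^ 2) * (‖w s‖ ^ 2 + R ^ 2) := by
    intro t ht
    have h1 := C.sq_norm_mild_le hν hFc x ht.1
    rw [← hsol t ht.1, ← intervalIntegral.integral_const_mul] at h1
    have h2 : ∫ s in (0 : ℝ)..t, ν⁻¹ * ‖F s‖ ^ 2 ≤ ∫ s in (0 : ℝ)..t,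
        4 * K ^ 2 * ν⁻¹ * (‖J (w s)‖ ^ 2 + R ^ 2) * (‖w s‖ ^ 2 + R ^ 2) := by
      refine intervalIntegral.integral_mono_on ht.1
        (Continuous.intervalIntegrable (by fun_prop) _ _)
        (Continuous.intervalIntegrable (by fun_prop) _ _) fun s hs => ?_
      refine (mul_le_mul_of_nonneg_left (hFsq s ⟨hs.1, hs.2.trans ht.2⟩)
        (inv_pos.2 hν).le).trans (le_of_eq (by ring))
    have h3 : ‖x‖ ^ 2 ≤ R ^ 2 := pow_le_pow_left₀ (norm_nonneg _) hx 2
    linarith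
  intro t ht
  refine Real.le_sqrt_of_sq_le ?_
  have h1 := le_mul_exp_of_le_integral (φ := fun s => ‖w s‖ ^ 2 + R ^ 2)
    (k := fun s => 4 * K ^ 2 * ν⁻¹ * (‖J (w s)‖ ^ 2 + R ^ 2)) (by fun_prop) (by fun_prop)
    (fun s => by positivity) hhigh ht
  have h2 : ∫ s in (0 : ℝ)..t, 4 * K ^ 2 * ν⁻¹ * (‖J (w s)‖ ^ 2 + R ^ 2)
      ≤ 4 * K ^ 2 * ν⁻¹ * (D + R ^ 2 * T) := by
    rw [intervalIntegral.integral_const_mul, intervalIntegral.integral_add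
      (Continuous.intervalIntegrable (by fun_prop) _ _)
      (Continuous.intervalIntegrable (by fun_prop) _ _), intervalIntegral.integral_const, sub_zero,
      smul_eq_mul, mul_comm t]
    have := mul_le_mul_of_nonneg_left ht.2 (sq_nonneg R)
    exact mul_le_mul_of_nonneg_left (add_le_add (hdiss t ht) this) (by positivity)
  have h3 := mul_le_mul_of_nonneg_left (Real.exp_le_exp.2 h2) (show 0 ≤ 2 * R ^ 2 by positivity)
  linarith [sq_nonneg R]

/-- The argument w + z of B is retracted to a ball of time-dependent radius M, which gives a
globally solvable problem. The a priori bound holds for the retracted problem with constants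
independent of M, so M can be chosen beforehand to exceed it, and the solution never meets the
retraction. -/
theorem exists_isMild (hν : 0 < ν) (hK : 0 ≤ K)
    (hB : ∀ u w, ‖B u w‖ ≤ K * ‖C.invRoot u‖ * ‖w‖)
    (hB0 : ∀ u w, inner ℝ (C.invRoot (C.invRoot (C.invRoot w))) (B u w) = 0) (x : X)
    (z : C(ℝ≥0, X)) : ∃ w, C.IsMild ν B x z w := by
  have hzc : Continuous fun t : ℝ => z t.toNNReal := z.continuous.comp continuous_real_toNNReal
  have hR : ∀ n : ℕ, ∃ R, ‖x‖ ≤ R ∧ ∀ t ∈ Icc (0 : ℝ) n, ‖z t.toNNReal‖ ≤ R := by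
    intro n
    obtain ⟨b, hb⟩ := (isCompact_Icc (a := (0 : ℝ)) (b := n)).exists_bound_of_continuousOn
      hzc.continuousOn
    exact ⟨max ‖x‖ b, le_max_left _ _, fun t ht => (hb t ht).trans (le_max_right _ _)⟩
  choose R hRx hRz using hR
  choose A hA using fun n : ℕ => C.exists_apriori_bound hν hK hB hB0 n (R n) (Nat.cast_nonneg n)
  obtain ⟨M, hMc, hM1, hMA⟩ := exists_continuous_ge fun n => A n + R n
  have hM0 : ∀ t, 0 < M t := fun t => zero_lt_one.trans_le (hM1 t)
  have hBle : ∀ u w, ‖B u w‖ ≤ K * ‖u‖ * ‖w‖ := fun u w => (hB u w).trans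
    (mul_le_mul_of_nonneg_right (mul_le_mul_of_nonneg_left (C.norm_invRoot_le u) hK)
      (norm_nonneg _))
  set G : ℝ → X → X := fun s u =>
    B (shrink (M s) (u + z s.toNNReal) • (u + z s.toNNReal))
      (shrink (M s) (u + z s.toNNReal) • (u + z s.toNNReal)) with hG
  have hGc : ∀ u : ℝ → X, Continuous u → Continuous fun s => G s (u s) := by
    intro u hu
    have h1 : Continuous fun s => shrink (M s) (u s + z s.toNNReal) • (u s + z s.toNNReal) :=
      (continuous_shrink hMc hM0 (hu.add hzc)).smul (hu.add hzc)
    exact (B.continuous.comp h1).clm_apply h1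
  obtain ⟨w, hw⟩ := C.exists_mild_of_lipschitz hν (G := G)
    (h := fun s => K * M s * M s + 4 * K * M s) (by fun_prop) hGc
    (fun s u => by
      have h1 := norm_shrink_smul_le (hM0 s) (u + z s.toNNReal)
      refine (hBle _ _).trans ?_
      have h2 : 0 ≤ 4 * K * M s := mul_nonneg (by positivity) (hM0 s).le
      have h3 := mul_le_mul (mul_le_mul_of_nonneg_left h1 hK) h1 (norm_nonneg _)
        (mul_nonneg hK (hM0 s).le)
      linarith)
    (fun s u v => by
      have hu := norm_shrink_smul_le (hM0 s) (u + z s.toNNReal)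
      have hv := norm_shrink_smul_le (hM0 s) (v + z s.toNNReal)
      have huv := norm_shrink_smul_sub_le (hM0 s) (u + z s.toNNReal) (v + z s.toNNReal)
      rw [add_sub_add_right_eq_sub] at huv
      simp only [hG]
      set p := shrink (M s) (u + z s.toNNReal) • (u + z s.toNNReal)
      set q := shrink (M s) (v + z s.toNNReal) • (v + z s.toNNReal)
      have e : B p p - B q q = B (p - q) p + B q (p - q) := by
        simp only [map_sub, sub_apply]; abel
      rw [e]
      refine (norm_add_le _ _).trans ((add_le_add (hBle _ _) (hBle _ _)).trans ?_)
      have hKM : 0 ≤ K * M s := mul_nonneg hK (hM0 s).le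
      have h1 : K * ‖p - q‖ * ‖p‖ ≤ K * (2 * ‖u - v‖) * M s :=
        mul_le_mul (mul_le_mul_of_nonneg_left huv hK) hu (norm_nonneg _) (by positivity)
      have h2 : K * ‖q‖ * ‖p - q‖ ≤ K * M s * (2 * ‖u - v‖) :=
        mul_le_mul (mul_le_mul_of_nonneg_left hv hK) huv (norm_nonneg _) hKM
      have h3 : 0 ≤ K * M s * M s * ‖u - v‖ :=
        mul_nonneg (mul_nonneg hKM (hM0 s).le) (norm_nonneg _)
      linarith) x
  have hwc : Continuous fun t : ℝ => w t.toNNReal := w.continuous.comp continuous_real_toNNReal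
  set θ : ℝ → ℝ := fun s => shrink (M s) (w s.toNNReal + z s.toNNReal) with hθ
  have hθ0 : ∀ s, 0 ≤ θ s := fun s => shrink_nonneg (hM0 s) _
  have hθ1 : ∀ s, θ s ≤ 1 := fun s => shrink_le_one (hM0 s) _
  -- Bilinearity turns the retraction into the scalar θ² ∈ [0, 1], the damping allowed in
  -- `exists_apriori_bound`.
  have hGθ : ∀ s, G s (w s.toNNReal)
      = θ s ^ 2 • B (w s.toNNReal + z s.toNNReal) (w s.toNNReal + z s.toNNReal) := by
    intro s
    simp only [hG, hθ, map_smul, smul_apply, smul_smul, sq]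
  have hsol : ∀ t : ℝ, 0 ≤ t → w t.toNNReal = C.mild ν x (fun s => θ s ^ 2 •
      B (w s.toNNReal + z s.toNNReal) (w s.toNNReal + z s.toNNReal)) t := by
    intro t ht
    have := hw t.toNNReal
    simp only [hGθ] at this
    rwa [Real.coe_toNNReal t ht] at this
  have hbound : ∀ t : ℝ, 0 ≤ t → ‖w t.toNNReal + z t.toNNReal‖ ≤ M t := by
    intro t ht
    have ht' : t ∈ Icc (0 : ℝ) ⌈t⌉₊ := ⟨ht, Nat.le_ceil t⟩
    have h1 := hA ⌈t⌉₊ x (fun t => w t.toNNReal) (fun t => z t.toNNReal) (fun s => θ s ^ 2) hwc hzc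
      ((continuous_shrink hMc hM0 (hwc.add hzc)).pow 2) (fun s => sq_nonneg _)
      (fun s => pow_le_one₀ (hθ0 s) (hθ1 s)) (hRx _) (hRz _) hsol t ht'
    exact (norm_add_le _ _).trans ((add_le_add h1 (hRz _ t ht')).trans (hMA t))
  refine ⟨w, fun t => ?_⟩
  have h1 := hsol t t.coe_nonneg
  rw [Real.toNNReal_coe] at h1
  rw [h1]
  refine C.mild_congr x t.coe_nonneg fun s hs => ?_
  simp only [hθ]
  rw [shrink_eq_one (hM0 s) (hbound s hs.1)]
  simp

/-- Two continuous solutions are bounded on [0, T], where B is Lipschitz; stability with equal data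
and δ = 0 concludes. No cancellation is needed. -/
theorem isMild_unique (hν : 0 < ν) (hK : 0 ≤ K)
    (hB : ∀ u w, ‖B u w‖ ≤ K * ‖C.invRoot u‖ * ‖w‖) {x : X} {z w₁ w₂ : C(ℝ≥0, X)}
    (h₁ : C.IsMild ν B x z w₁) (h₂ : C.IsMild ν B x z w₂) : w₁ = w₂ := by
  have hBle : ∀ u w, ‖B u w‖ ≤ K * ‖u‖ * ‖w‖ := fun u w => (hB u w).trans
    (mul_le_mul_of_nonneg_right (mul_le_mul_of_nonneg_left (C.norm_invRoot_le u) hK)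
      (norm_nonneg _))
  ext T
  obtain ⟨b₁, hb₁⟩ := (isCompact_Icc (a := (0 : ℝ)) (b := T)).exists_bound_of_continuousOn
    ((continuous_curve w₁).add (continuous_curve z)).continuousOn
  obtain ⟨b₂, hb₂⟩ := (isCompact_Icc (a := (0 : ℝ)) (b := T)).exists_bound_of_continuousOn
    ((continuous_curve w₂).add (continuous_curve z)).continuousOn
  obtain ⟨c, -, hc⟩ := C.mild_stability hν (2 * K * max b₁ b₂) T T.coe_nonneg
  have h := (hc x x _ _ _ _ 0 le_rfl (continuous_curve w₁) (continuous_curve w₂)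
    (continuous_nonlinearity B z w₁) (continuous_nonlinearity B z w₂)
    (fun t ht => h₁.apply ht.1) (fun t ht => h₂.apply ht.1) (fun t ht => by
      refine (norm_bilin_sub_le hBle hK ((hb₁ t ht).trans (le_max_left _ _))
        ((hb₂ t ht).trans (le_max_right _ _))).trans (le_of_eq ?_)
      simp)).1 T ⟨T.coe_nonneg, le_rfl⟩
  simp only [Real.toNNReal_coe, sub_self, norm_zero] at h
  have h0 : ‖w₁ T - w₂ T‖ ^ 2 ≤ 0 := by simpa using h
  exact sub_eq_zero.1 (norm_eq_zero.1 (pow_eq_zero_iff two_ne_zero |>.1 (h0.antisymm (sq_nonneg _))))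

/-- The solution map is Lipschitz on bounded sets. -/
theorem isMild_lipschitz (hν : 0 < ν) (hK : 0 ≤ K)
    (hB : ∀ u w, ‖B u w‖ ≤ K * ‖C.invRoot u‖ * ‖w‖)
    (hB0 : ∀ u w, inner ℝ (C.invRoot (C.invRoot (C.invRoot w))) (B u w) = 0) (T R : ℝ)
    (hT : 0 ≤ T) : ∃ c, 0 < c ∧ ∀ (x₁ x₂ : X) (z₁ z₂ w₁ w₂ : C(ℝ≥0, X)) (Y : ℝ → X) (δ : ℝ),
      0 ≤ δ → C.IsMild ν B x₁ z₁ w₁ → C.IsMild ν B x₂ z₂ w₂ → ‖x₁‖ ≤ R → ‖x₂‖ ≤ R →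
      (∀ t ∈ Icc 0 T, ‖z₁ t.toNNReal‖ ≤ R) → (∀ t ∈ Icc 0 T, ‖z₂ t.toNNReal‖ ≤ R) →
      (∀ t ∈ Icc 0 T, ‖z₁ t.toNNReal - z₂ t.toNNReal‖ ≤ δ) →
      (∀ᵐ s : ℝ, 0 ≤ s → C.invRoot (Y s) = w₁ s.toNNReal - w₂ s.toNNReal) →
      (∀ t ∈ Icc 0 T, ‖w₁ t.toNNReal - w₂ t.toNNReal‖ ^ 2 ≤ c * (‖x₁ - x₂‖ ^ 2 + δ ^ 2)) ∧
      ∫ s in (0 : ℝ)..T, ‖Y s‖ ^ 2 ≤ c * (‖x₁ - x₂‖ ^ 2 + δ ^ 2) := by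
  have hBle : ∀ u w, ‖B u w‖ ≤ K * ‖u‖ * ‖w‖ := fun u w => (hB u w).trans
    (mul_le_mul_of_nonneg_right (mul_le_mul_of_nonneg_left (C.norm_invRoot_le u) hK)
      (norm_nonneg _))
  obtain ⟨M, hM⟩ := C.exists_apriori_bound hν hK hB hB0 T R hT
  obtain ⟨c, hc0, hc⟩ := C.mild_stability hν (2 * K * (M + R)) T hT
  refine ⟨c + ν⁻¹ * c, by positivity, ?_⟩
  intro x₁ x₂ z₁ z₂ w₁ w₂ Y δ hδ h₁ h₂ hx₁ hx₂ hz₁ hz₂ hδz hY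
  have hbd : ∀ (x : X) (z w : C(ℝ≥0, X)), C.IsMild ν B x z w → ‖x‖ ≤ R →
      (∀ t ∈ Icc 0 T, ‖z t.toNNReal‖ ≤ R) →
      ∀ t ∈ Icc 0 T, ‖w t.toNNReal + z t.toNNReal‖ ≤ M + R := by
    intro x z w h hx hz t ht
    refine (norm_add_le _ _).trans (add_le_add ?_ (hz t ht))
    refine hM x (fun t => w t.toNNReal) (fun t => z t.toNNReal) (fun _ => 1)
      (continuous_curve w) (continuous_curve z) continuous_const (fun _ => zero_le_one)
      (fun _ => le_rfl) hx hz (fun t ht => ?_) t ht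
    simpa only [one_smul] using h.apply ht
  have hb₁ := hbd x₁ z₁ w₁ h₁ hx₁ hz₁
  have hb₂ := hbd x₂ z₂ w₂ h₂ hx₂ hz₂
  have hMR : 0 ≤ M + R := (norm_nonneg _).trans (hb₁ 0 ⟨le_rfl, hT⟩)
  have hF₁ := continuous_nonlinearity B z₁ w₁
  have hF₂ := continuous_nonlinearity B z₂ w₂
  obtain ⟨hs1, hs2⟩ := hc x₁ x₂ _ _ _ _ δ hδ (continuous_curve w₁) (continuous_curve w₂)
    hF₁ hF₂ (fun t ht => h₁.apply ht.1) (fun t ht => h₂.apply ht.1) (fun t ht => by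
      refine (norm_bilin_sub_le hBle hK (hb₁ t ht) (hb₂ t ht)).trans ?_
      refine mul_le_mul_of_nonneg_left ?_ (by positivity)
      rw [add_sub_add_comm]
      exact (norm_add_le _ _).trans (add_le_add le_rfl (hδz t ht)))
  have hD0 : 0 ≤ ‖x₁ - x₂‖ ^ 2 + δ ^ 2 := by positivity
  have hνc : 0 ≤ ν⁻¹ * c * (‖x₁ - x₂‖ ^ 2 + δ ^ 2) := by positivity
  refine ⟨fun t ht => (hs1 t ht).trans (by linarith), ?_⟩
  obtain ⟨Z, hZ, hZb⟩ := C.exists_root_mild hν (F := fun s =>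
    B (w₁ s.toNNReal + z₁ s.toNNReal) (w₁ s.toNNReal + z₁ s.toNNReal)
    - B (w₂ s.toNNReal + z₂ s.toNNReal) (w₂ s.toNNReal + z₂ s.toNNReal)) (hF₁.sub hF₂) (x₁ - x₂)
  -- The difference of two solutions is a mild solution of a linear problem, so regularity provides
  -- a root Z with an energy bound; injectivity of `invRoot` identifies it with Y.
  have hYZ : ∫ s in (0 : ℝ)..T, ‖Y s‖ ^ 2 = ∫ s in (0 : ℝ)..T, ‖Z s‖ ^ 2 := by
    refine intervalIntegral.integral_congr_ae ?_
    filter_upwards [hY, hZ] with s h1 h2 hs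
    rw [uIoc_of_le hT] at hs
    have h3 := h1 hs.1.le
    rw [h₁.apply hs.1.le, h₂.apply hs.1.le, C.mild_sub_mild hν hF₁ hF₂ x₁ x₂ hs.1.le,
      ← h2 hs.1.le] at h3
    rw [C.invRoot_injective h3]
  have h3 := (hZb T hT).2.trans hs2
  have h4 : ν * ∫ s in (0 : ℝ)..T, ‖Z s‖ ^ 2 ≤ c * (‖x₁ - x₂‖ ^ 2 + δ ^ 2) := by
    linarith [sq_nonneg ‖C.mild ν (x₁ - x₂) (fun s =>
      B (w₁ s.toNNReal + z₁ s.toNNReal) (w₁ s.toNNReal + z₁ s.toNNReal)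
      - B (w₂ s.toNNReal + z₂ s.toNNReal) (w₂ s.toNNReal + z₂ s.toNNReal)) T‖]
  rw [hYZ]
  have h5 : ∫ s in (0 : ℝ)..T, ‖Z s‖ ^ 2 ≤ ν⁻¹ * c * (‖x₁ - x₂‖ ^ 2 + δ ^ 2) := by
    rw [mul_assoc, ← div_eq_inv_mul, le_div_iff₀' hν]; exact h4
  have h6 : 0 ≤ c * (‖x₁ - x₂‖ ^ 2 + δ ^ 2) := by positivity
  linarith

end SymbolCalculus

end HyperNS

end

/-! ### Fourier transform of real square integrable fields. -/

noncomputable section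

namespace HyperNS

open Filter Topology Set
open scoped ContDiff

section FourierIntegral

variable {V F : Type*} [NormedAddCommGroup V] [InnerProductSpace ℝ V] [FiniteDimensional ℝ V]
  [MeasurableSpace V] [BorelSpace V] [NormedAddCommGroup F] [InnerProductSpace ℂ F]
  [CompleteSpace F]

theorem integral_fourierInv_smul_eq {f : V → ℂ} {g : V → F} (hf : Integrable f)
    (hg : Integrable g) : ∫ ξ, 𝓕⁻ f ξ • g ξ = ∫ x, f x • 𝓕⁻ g x := by
  have hflip : (-innerₗ V).flip = -innerₗ V := by
    ext x y; simp [real_inner_comm]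
  have h := VectorFourier.integral_fourierIntegral_smul_eq_flip (L := -innerₗ V)
    (μ := volume) (ν := volume) Real.continuous_fourierChar 
    (continuous_inner (𝕜 := ℝ) (E := V)).neg hf hg
  rw [hflip] at h
  exact h

theorem continuous_fourierInv {g : V → F} (hg : Integrable g) : Continuous (𝓕⁻ g : V → F) :=
  VectorFourier.fourierIntegral_continuous Real.continuous_fourierChar
    (continuous_inner (𝕜 := ℝ) (E := V)).neg hg

/-- On `L¹ ∩ L²` the inverse Fourier transform is given by the integral. -/
theorem coeFn_fourierInv {G : Lp F 2 (volume : Measure V)} (h1 : Integrable G) :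
    (𝓕⁻ G : Lp F 2 (volume : Measure V)) =ᵐ[volume] (𝓕⁻ (G : V → F) : V → F) := by
  -- The two transforms are compared as distributions: against a test function, the L² transform is
  -- evaluated through tempered distributions and the integral transform by Fubini, both moving 𝓕⁻
  -- onto the test function.
  refine ae_eq_of_integral_contDiff_smul_eq
    ((Lp.memLp _).locallyIntegrable (by norm_num))
    (continuous_fourierInv h1).locallyIntegrable fun φ hφ hφc => ?_
  have hφc' : HasCompactSupport fun x => (φ x : ℂ) := hφc.comp_left (g := fun r : ℝ => (r : ℂ)) rfl
  set Φ : SchwartzMap V ℂ := hφc'.toSchwartzMap (Complex.ofRealCLM.contDiff.comp hφ) with hΦ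
  have hΦx : ∀ x, Φ x = (φ x : ℂ) := fun x => rfl
  have e1 : ∫ x, φ x • (𝓕⁻ G : Lp F 2 (volume : Measure V)) x
      = (Lp.toTemperedDistribution (𝓕⁻ G : Lp F 2 (volume : Measure V))) Φ := by
    rw [Lp.toTemperedDistribution_apply]
    refine integral_congr_ae (Eventually.of_forall fun x => ?_)
    simp only [hΦx, Complex.coe_smul]
  rw [e1, ← Lp.fourierInv_toTemperedDistribution_eq, TemperedDistribution.fourierInv_apply,
    Lp.toTemperedDistribution_apply]
  rw [SchwartzMap.fourierInv_coe, integral_fourierInv_smul_eq Φ.integrable h1]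
  refine integral_congr_ae (Eventually.of_forall fun x => ?_)
  simp only [hΦx, Complex.coe_smul]

end FourierIntegral

/-- Componentwise complex conjugation on `ℂ²`. -/
def conjVec : CPlane →L[ℝ] CPlane :=
  LinearMap.toContinuousLinearMap
    { toFun := fun v => WithLp.toLp 2 (fun i => (starRingEnd ℂ) (v i))
      map_add' := fun v w => by ext i; simp
      map_smul' := fun c v => by ext i; simp }

@[simp]
theorem conjVec_apply (v : CPlane) (i : Fin 2) : conjVec v i = (starRingEnd ℂ) (v i) := rfl

@[simp]
theorem ofRealVec_apply (v : Plane) (i : Fin 2) : ofRealVec v i = (v i : ℂ) := rfl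

@[simp]
theorem reVec_apply (v : CPlane) (i : Fin 2) : reVec v i = (v i).re := rfl

theorem conjVec_smul (c : ℂ) (v : CPlane) : conjVec (c • v) = (starRingEnd ℂ) c • conjVec v := by
  ext i; simp

theorem conjVec_conjVec (v : CPlane) : conjVec (conjVec v) = v := by
  ext i; simp

theorem conjVec_ofRealVec (v : Plane) : conjVec (ofRealVec v) = ofRealVec v := by
  ext i; simp

theorem ofRealVec_reVec {v : CPlane} (h : conjVec v = v) : ofRealVec (reVec v) = v := by
  ext i
  have := congrArg (fun w : CPlane => w i) h
  simp only [conjVec_apply] at this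
  simp only [ofRealVec_apply, reVec_apply]
  exact Complex.conj_eq_iff_re.1 this

theorem reVec_ofRealVec (v : Plane) : reVec (ofRealVec v) = v := by
  ext i; simp

theorem norm_conjVec (v : CPlane) : ‖conjVec v‖ = ‖v‖ := by
  simp [EuclideanSpace.norm_eq]

theorem norm_ofRealVec (v : Plane) : ‖ofRealVec v‖ = ‖v‖ := by
  simp [EuclideanSpace.norm_eq]

/-- `g ↦ conj (g(-ξ))` on `L²`. -/
def conjRefl (g : CField) : CField :=
  conjVec.compLpL 2 volume (Lp.compMeasurePreserving _ (Measure.measurePreserving_neg volume) g)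

theorem continuous_conjRefl : Continuous conjRefl :=
  (conjVec.compLpL 2 volume).continuous.comp (Lp.isometry_compMeasurePreserving _).continuous

theorem coeFn_conjRefl (g : CField) : conjRefl g =ᵐ[volume] fun ξ => conjVec (g (-ξ)) := by
  have h1 := conjVec.coeFn_compLpL (p := 2) (μ := volume)
    (Lp.compMeasurePreserving _ (Measure.measurePreserving_neg volume) g)
  have h2 := Lp.coeFn_compMeasurePreserving g (Measure.measurePreserving_neg volume)
  filter_upwards [h1, h2] with ξ h1 h2
  rw [conjRefl, h1, h2]
  rfl

/-- `g(-ξ) = conj g(ξ)` almost everywhere. -/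
def IsConjSymm (g : Plane → CPlane) : Prop := ∀ᵐ ξ, g (-ξ) = conjVec (g ξ)

theorem fourierInv_conjVec (g : Plane → CPlane) (x : Plane) :
    𝓕⁻ (fun ξ => conjVec (g (-ξ))) x = conjVec (𝓕⁻ g x) := by
  have e1 : 𝓕⁻ (fun ξ => conjVec (g (-ξ))) = 𝓕 fun ξ => conjVec (g ξ) := by
    rw [Real.fourierInv_eq_fourier_comp_neg]
    simp only [neg_neg]
  have h : Isometry conjVec :=
    AddMonoidHomClass.isometry_of_norm conjVec norm_conjVec
  -- As an invertible real-linear map, conjugation commutes with the integral of every f, integrable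
  -- or not.
  have hcomm : ∀ f : Plane → CPlane, conjVec (∫ v, f v) = ∫ v, conjVec (f v) := fun f => by
    let e : CPlane ≃L[ℝ] CPlane := ContinuousLinearEquiv.equivOfInverse conjVec conjVec
      conjVec_conjVec conjVec_conjVec
    exact (e.integral_comp_comm f).symm
  rw [e1, Real.fourier_eq, Real.fourierInv_eq, hcomm]
  refine integral_congr_ae (Eventually.of_forall fun v => ?_)
  simp only [Circle.smul_def, conjVec_smul]
  rw [← Circle.coe_inv_eq_conj, ← AddChar.map_neg_eq_inv]

/-- Both sides are continuous in g, so Schwartz functions suffice, and for these the integral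
formula applies. This is the source of the equivalence between real fields and Hermitian transforms.
-/
theorem fourierInv_conjRefl (g : CField) :
    (Lp.fourierTransformₗᵢ Plane CPlane).symm (conjRefl g)
      = conjVec.compLpL 2 volume ((Lp.fourierTransformₗᵢ Plane CPlane).symm g) := by
  refine DenseRange.induction_on (p := fun g : CField =>
    (Lp.fourierTransformₗᵢ Plane CPlane).symm (conjRefl g)
      = conjVec.compLpL 2 volume ((Lp.fourierTransformₗᵢ Plane CPlane).symm g))
    (SchwartzMap.denseRange_toLpCLM (E := Plane) (F := CPlane) (p := 2) ENNReal.ofNat_ne_top) g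
    (isClosed_eq ((LinearIsometryEquiv.continuous _).comp continuous_conjRefl)
      ((ContinuousLinearMap.continuous _).comp (LinearIsometryEquiv.continuous _))) ?_
  intro φ
  set f : CField := SchwartzMap.toLpCLM ℝ CPlane 2 volume φ with hf
  have hfφ : f =ᵐ[volume] φ := φ.coeFn_toLp 2 volume
  have hfi : Integrable f := φ.integrable.congr hfφ.symm
  have hc := coeFn_conjRefl f
  have hci : Integrable (conjRefl f) :=
    (conjVec.integrable_comp hfi.comp_neg).congr hc.symm
  refine Lp.ext ?_
  filter_upwards [coeFn_fourierInv hci, coeFn_fourierInv hfi, conjVec.coeFn_compLpL (p := 2)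
    (μ := volume) ((Lp.fourierTransformₗᵢ Plane CPlane).symm f)] with x h1 h2 h3
  rw [h3]
  refine h1.trans ?_
  rw [Real.fourierInv_congr_ae hc, fourierInv_conjVec]
  exact congrArg conjVec h2.symm

theorem coeFn_fourier_neg (u : Field) : IsConjSymm (fourier u) := by
  set U : CField := ofRealVec.compLpL 2 volume u with hU
  have h1 : conjVec.compLpL 2 volume U = U := by
    refine Lp.ext ?_
    filter_upwards [conjVec.coeFn_compLpL (p := 2) (μ := volume) U,
      ofRealVec.coeFn_compLpL (p := 2) (μ := volume) u] with x h1 h2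
    rw [h1, hU, h2, conjVec_ofRealVec]
  have h2 : conjRefl (fourier u) = fourier u := by
    have h3 := fourierInv_conjRefl (fourier u)
    have h4 : (Lp.fourierTransformₗᵢ Plane CPlane).symm (fourier u) = U :=
      (Lp.fourierTransformₗᵢ Plane CPlane).symm_apply_apply U
    rw [h4, h1, ← h4] at h3
    exact (Lp.fourierTransformₗᵢ Plane CPlane).symm.injective h3
  have h3 := coeFn_conjRefl (fourier u)
  rw [h2] at h3
  filter_upwards [h3] with ξ h
  rw [h, conjVec_conjVec]

/-- Hermitian symmetry makes the inverse transform real, so the real part taken in `invFourier`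
loses nothing. Every multiplier below is reached through this lemma. -/
theorem fourier_invFourier {g : Plane → CPlane} (hg : MemLp g 2 (volume : Measure Plane))
    (hs : IsConjSymm g) : fourier (invFourier g) =ᵐ[volume] g := by
  set G : CField := hg.toLp g with hG
  have hGg : G =ᵐ[volume] g := hg.coeFn_toLp
  have h1 : conjRefl G = G := by
    refine Lp.ext ?_
    filter_upwards [coeFn_conjRefl G, hGg, hs,
      (Measure.measurePreserving_neg (volume : Measure Plane)).quasiMeasurePreserving.ae hGg]
      with ξ h1 h2 h3 h4
    rw [h1, h2, h4, h3, conjVec_conjVec]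
  have h2 := fourierInv_conjRefl G
  rw [h1] at h2
  have h3 : invFourier g = reVec.compLpL 2 volume ((Lp.fourierTransformₗᵢ Plane CPlane).symm G) :=
    dif_pos hg
  have h4 : ofRealVec.compLpL 2 volume (invFourier g)
      = (Lp.fourierTransformₗᵢ Plane CPlane).symm G := by
    refine Lp.ext ?_
    rw [h3]
    set f := (Lp.fourierTransformₗᵢ Plane CPlane).symm G
    have h5 : f =ᵐ[volume] conjVec.compLpL 2 volume f := by rw [← h2]
    filter_upwards [ofRealVec.coeFn_compLpL (p := 2) (μ := volume) (reVec.compLpL 2 volume f),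
      reVec.coeFn_compLpL (p := 2) (μ := volume) f, conjVec.coeFn_compLpL (p := 2) (μ := volume) f,
      h5] with x h6 h7 h8 h9
    rw [h6, h7]
    refine ofRealVec_reVec ?_
    rw [← h8, ← h9]
  have h5 : fourier (invFourier g) = G := by
    show Lp.fourierTransformₗᵢ Plane CPlane (ofRealVec.compLpL 2 volume (invFourier g)) = G
    rw [h4, LinearIsometryEquiv.apply_symm_apply]
  rw [h5]
  exact hGg

theorem eq_of_fourier_ae {u v : Field} (h : fourier u =ᵐ[volume] fourier v) : u = v :=
  HDiv.fourier_injective (Lp.ext h)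

end HyperNS

end

/-! ### Radial multipliers, the calculus of A^α and Sobolev coordinates. -/

noncomputable section

namespace HyperNS

open Filter Topology Set

theorem symbolA_neg (ξ : Plane) : symbolA (-ξ) = symbolA ξ := by
  simp [symbolA]

/-- The Fourier multiplier whose symbol is the function `ψ` of `1 + |2πξ|²`. -/
def radial (ψ : ℝ → ℝ) (u : Field) : Field := invFourier fun ξ => ψ (symbolA ξ) • fourier u ξ

theorem fourier_radial {ψ : ℝ → ℝ} {u : Field}
    (h : MemLp (fun ξ => ψ (symbolA ξ) • fourier u ξ) 2 (volume : Measure Plane)) :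
    fourier (radial ψ u) =ᵐ[volume] fun ξ => ψ (symbolA ξ) • fourier u ξ := by
  refine fourier_invFourier h ?_
  filter_upwards [coeFn_fourier_neg u] with ξ hξ
  rw [symbolA_neg, hξ, map_smul]

theorem radial_mem_divFree {ψ : ℝ → ℝ} {u : Field} (hu : u ∈ divFree)
    (h : MemLp (fun ξ => ψ (symbolA ξ) • fourier u ξ) 2 (volume : Measure Plane)) :
    radial ψ u ∈ divFree := by
  show ∀ᵐ ξ : Plane, ∑ i : Fin 2, ((ξ i : ℝ) : ℂ) * fourier (radial ψ u) ξ i = 0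
  have hu' : ∀ᵐ ξ : Plane, ∑ i : Fin 2, ((ξ i : ℝ) : ℂ) * fourier u ξ i = 0 := hu
  filter_upwards [fourier_radial h, hu'] with ξ h1 h2
  rw [h1]
  have : ∀ i : Fin 2, ((ξ i : ℝ) : ℂ) * (ψ (symbolA ξ) • fourier u ξ) i
      = (ψ (symbolA ξ) : ℂ) * (((ξ i : ℝ) : ℂ) * fourier u ξ i) := fun i => by
    simp only [PiLp.smul_apply, Complex.real_smul]
    ring
  simp only [this, ← Finset.mul_sum, h2, mul_zero]

theorem memLp_radial {ψ : ℝ → ℝ} (hψ : IsBddSymbol ψ) (u : Field) :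
    MemLp (fun ξ => ψ (symbolA ξ) • fourier u ξ) 2 (volume : Measure Plane) := by
  obtain ⟨hm, c, hc⟩ := hψ
  refine MemLp.of_le_mul (c := c) (Lp.memLp (fourier u)) ?_ (Eventually.of_forall fun ξ => ?_)
  · exact (hm.comp continuous_symbolA.measurable).aestronglyMeasurable.smul
      (Lp.aestronglyMeasurable _)
  · rw [norm_smul]
    exact mul_le_mul_of_nonneg_right (hc _ (one_le_symbolA ξ)) (norm_nonneg _)

/-- Plancherel. The real part accounts for comparing a real inner product with a complex one. -/
theorem inner_fourier (u v : Field) :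
    inner ℝ u v = ∫ ξ, (inner ℂ (fourier u ξ) (fourier v ξ)).re := by
  have h1 : inner ℂ (fourier u) (fourier v)
      = inner ℂ (ofRealVec.compLpL 2 volume u) (ofRealVec.compLpL 2 volume v) :=
    (Lp.fourierTransformₗᵢ Plane CPlane).inner_map_map _ _
  have h2 : ∫ ξ, (inner ℂ (fourier u ξ) (fourier v ξ)).re
      = (inner ℂ (fourier u) (fourier v) : ℂ).re := by
    rw [L2.inner_def]
    exact integral_re (L2.integrable_inner (𝕜 := ℂ) (fourier u) (fourier v))
  rw [h2, h1, L2.inner_def, L2.inner_def]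
  refine Eq.trans ?_ (integral_re (L2.integrable_inner (𝕜 := ℂ) (ofRealVec.compLpL 2 volume u)
    (ofRealVec.compLpL 2 volume v)))
  refine integral_congr_ae ?_
  filter_upwards [ofRealVec.coeFn_compLpL (p := 2) (μ := volume) u,
    ofRealVec.coeFn_compLpL (p := 2) (μ := volume) v] with x h3 h4
  simp only [h3, h4, PiLp.inner_apply, ofRealVec_apply, RCLike.inner_apply]
  simp

theorem sq_norm_eq_integral (u : Field) : ‖u‖ ^ 2 = ∫ ξ, ‖fourier u ξ‖ ^ 2 := by
  rw [← real_inner_self_eq_norm_sq, inner_fourier]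
  refine integral_congr_ae (Eventually.of_forall fun ξ => ?_)
  simp only
  rw [inner_self_eq_norm_sq_to_K]
  norm_cast

theorem integrable_sq_norm_fourier (u : Field) : Integrable fun ξ => ‖fourier u ξ‖ ^ 2 :=
  (memLp_two_iff_integrable_sq_norm (Lp.aestronglyMeasurable _)).1 (Lp.memLp (fourier u))

theorem fourier_add_ae (u v : Field) :
    fourier (u + v) =ᵐ[volume] fun ξ => fourier u ξ + fourier v ξ := by
  rw [map_add]; exact Lp.coeFn_add _ _

theorem fourier_sub_ae (u v : Field) :
    fourier (u - v) =ᵐ[volume] fun ξ => fourier u ξ - fourier v ξ := by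
  rw [map_sub]; exact Lp.coeFn_sub _ _

theorem fourier_smul_ae (c : ℝ) (u : Field) :
    fourier (c • u) =ᵐ[volume] fun ξ => c • fourier u ξ := by
  rw [map_smul]; exact Lp.coeFn_smul _ _

/-- The multiplier with a bounded symbol, acting on divergence-free fields. -/
def radialOp (ψ : ℝ → ℝ) (hψ : IsBddSymbol ψ) : divFree →L[ℝ] divFree :=
  LinearMap.mkContinuousOfExistsBound
    { toFun := fun u => ⟨radial ψ u, radial_mem_divFree u.2 (memLp_radial hψ u)⟩
      map_add' := fun u v => by
        refine Subtype.ext (eq_of_fourier_ae ?_)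
        filter_upwards [fourier_radial (memLp_radial hψ (u + v : divFree)),
          fourier_radial (memLp_radial hψ u), fourier_radial (memLp_radial hψ v),
          fourier_add_ae (u : Field) v, fourier_add_ae (radial ψ u) (radial ψ v)]
          with ξ h1 h2 h3 h4 h5
        simp only [Submodule.coe_add] at h1 ⊢
        rw [h1, h5, h2, h3, h4, smul_add]
      map_smul' := fun c u => by
        refine Subtype.ext (eq_of_fourier_ae ?_)
        filter_upwards [fourier_radial (memLp_radial hψ (c • u : divFree)),
          fourier_radial (memLp_radial hψ u), fourier_smul_ae c (u : Field),
          fourier_smul_ae c (radial ψ u)] with ξ h1 h2 h3 h4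
        simp only [Submodule.coe_smul, RingHom.id_apply] at h1 ⊢
        rw [h1, h4, h2, h3, smul_comm] }
    (by
      obtain ⟨hm, c, hc⟩ := id hψ
      refine ⟨c, fun u => ?_⟩
      show ‖radial ψ u‖ ≤ c * ‖(u : Field)‖
      rw [← HDiv.norm_fourier, ← HDiv.norm_fourier (u : Field)]
      refine Lp.norm_le_mul_norm_of_ae_le_mul ?_
      filter_upwards [fourier_radial (memLp_radial hψ u)] with ξ h
      rw [h, norm_smul]
      exact mul_le_mul_of_nonneg_right (hc _ (one_le_symbolA ξ)) (norm_nonneg _))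

theorem one_le_symbolA_rpow {α : ℝ} (hα : 0 ≤ α) (ξ : Plane) : 1 ≤ symbolA ξ ^ α :=
  Real.one_le_rpow (one_le_symbolA ξ) hα

theorem IsBddSymbol.comp_rpow {φ : ℝ → ℝ} (hφ : IsBddSymbol φ) {α : ℝ} (hα : 0 ≤ α) :
    IsBddSymbol fun x => φ (x ^ α) := by
  obtain ⟨hm, c, hc⟩ := hφ
  exact ⟨hm.comp (measurable_id.pow_const α), c, fun x hx => hc _ (Real.one_le_rpow hx hα)⟩

open Classical in
/-- The functional calculus of `A^α`. -/
def calcOp {α : ℝ} (hα : 0 ≤ α) (φ : ℝ → ℝ) : divFree →L[ℝ] divFree :=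
  if hφ : IsBddSymbol φ then radialOp (fun x => φ (x ^ α)) (hφ.comp_rpow hα) else 0

theorem calcOp_coe {α : ℝ} (hα : 0 ≤ α) {φ : ℝ → ℝ} (hφ : IsBddSymbol φ) (u : divFree) :
    (calcOp hα φ u : Field) = radial (fun x => φ (x ^ α)) u := by
  rw [calcOp, dif_pos hφ]; rfl

theorem fourier_calcOp {α : ℝ} (hα : 0 ≤ α) {φ : ℝ → ℝ} (hφ : IsBddSymbol φ) (u : divFree) :
    fourier (calcOp hα φ u) =ᵐ[volume] fun ξ => φ (symbolA ξ ^ α) • fourier u ξ := by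
  rw [calcOp_coe hα hφ]
  exact fourier_radial (memLp_radial (hφ.comp_rpow hα) u)

theorem divFree_ext {u v : divFree} (h : fourier u =ᵐ[volume] fourier v) : u = v :=
  Subtype.ext (eq_of_fourier_ae h)

/-- The bounded Borel functional calculus of `A^α` on divergence-free fields. -/
def stokesCalculus {α : ℝ} (hα : 0 ≤ α) : SymbolCalculus divFree where
  op := calcOp hα
  op_one := by
    ext1 u
    refine divFree_ext ?_
    filter_upwards [fourier_calcOp hα isBddSymbol_one u] with ξ h
    rw [h, one_smul]; rfl
  op_mul := fun {φ ψ} hφ hψ => by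
    ext1 u
    refine divFree_ext ?_
    filter_upwards [fourier_calcOp hα (hφ.mul hψ) u, fourier_calcOp hα hψ u,
      fourier_calcOp hα hφ (calcOp hα ψ u)] with ξ h1 h2 h3
    rw [h1, ContinuousLinearMap.comp_apply, h3, h2, smul_smul]
  op_add := fun {φ ψ} hφ hψ => by
    ext1 u
    refine divFree_ext ?_
    filter_upwards [fourier_calcOp hα (hφ.add hψ) u, fourier_calcOp hα hψ u,
      fourier_calcOp hα hφ u, fourier_add_ae (calcOp hα φ u : Field) (calcOp hα ψ u)]
      with ξ h1 h2 h3 h4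
    rw [h1, add_apply, Submodule.coe_add, h4, h2, h3, add_smul]
  op_const_mul := fun {φ} c hφ => by
    ext1 u
    refine divFree_ext ?_
    filter_upwards [fourier_calcOp hα (hφ.const_mul c) u, fourier_calcOp hα hφ u,
      fourier_smul_ae c (calcOp hα φ u : Field)] with ξ h1 h2 h3
    rw [h1, smul_apply, Submodule.coe_smul, h3, h2, smul_smul]
  norm_op_le := fun {φ c} hm hc h => by
    refine ContinuousLinearMap.opNorm_le_bound _ hc fun u => ?_
    show ‖(calcOp hα φ u : Field)‖ ≤ c * ‖(u : Field)‖
    rw [← HDiv.norm_fourier, ← HDiv.norm_fourier (u : Field)]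
    refine Lp.norm_le_mul_norm_of_ae_le_mul ?_
    filter_upwards [fourier_calcOp hα ⟨hm, c, h⟩ u] with ξ h1
    rw [h1, norm_smul]
    exact mul_le_mul_of_nonneg_right (h _ (one_le_symbolA_rpow hα ξ)) (norm_nonneg _)
  inner_op := fun {φ} hφ u v => by
    show inner ℝ (calcOp hα φ u : Field) (v : Field) = inner ℝ (u : Field) (calcOp hα φ v : Field)
    rw [inner_fourier, inner_fourier]
    refine integral_congr_ae ?_
    filter_upwards [fourier_calcOp hα hφ u, fourier_calcOp hα hφ v] with ξ h1 h2
    rw [h1, h2]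
    simp only [← Complex.coe_smul, inner_smul_left, inner_smul_right, Complex.conj_ofReal]
  tendsto_op := fun {φ ψ c} hm hψm hc hlim u => by
    have hφ : ∀ n, IsBddSymbol (φ n) := fun n => ⟨hm n, c, hc n⟩
    have hψ : IsBddSymbol ψ := ⟨hψm, c, fun x hx =>
      le_of_tendsto (hlim x hx).abs (Eventually.of_forall fun n => hc n x hx)⟩
    rw [tendsto_iff_norm_sub_tendsto_zero]
    -- Plancherel turns strong convergence into dominated convergence under (2c)²|û|².
    have hsq : ∀ n, ‖calcOp hα (φ n) u - calcOp hα ψ u‖ ^ 2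
        = ∫ ξ, ‖(φ n (symbolA ξ ^ α) - ψ (symbolA ξ ^ α)) • fourier u ξ‖ ^ 2 := by
      intro n
      show ‖(calcOp hα (φ n) u - calcOp hα ψ u : Field)‖ ^ 2 = _
      rw [sq_norm_eq_integral]
      refine integral_congr_ae ?_
      filter_upwards [fourier_sub_ae (calcOp hα (φ n) u : Field) (calcOp hα ψ u),
        fourier_calcOp hα (hφ n) u, fourier_calcOp hα hψ u] with ξ h1 h2 h3
      rw [h1, h2, h3, sub_smul]
    have h0 : Tendsto (fun n => ‖calcOp hα (φ n) u - calcOp hα ψ u‖ ^ 2) atTop (𝓝 0) := by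
      simp only [hsq]
      have hz : (0 : ℝ) = ∫ ξ : Plane, (0 : ℝ) := by simp
      rw [hz]
      have hsm : Measurable fun ξ : Plane => symbolA ξ ^ α :=
        continuous_symbolA.measurable.pow_const α
      refine tendsto_integral_of_dominated_convergence
        (fun ξ => (2 * c) ^ 2 * ‖fourier u ξ‖ ^ 2) (fun n => ?_)
        ((integrable_sq_norm_fourier (u : Field)).const_mul _)
        (fun n => Eventually.of_forall fun ξ => ?_) (Eventually.of_forall fun ξ => ?_)
      · exact (((((hm n).comp hsm).sub (hψm.comp hsm)).aestronglyMeasurable).smul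
          (Lp.aestronglyMeasurable _)).norm.pow 2
      · have h1 := one_le_symbolA_rpow hα ξ
        have h2 : |ψ (symbolA ξ ^ α)| ≤ c :=
          le_of_tendsto (hlim _ h1).abs (Eventually.of_forall fun n => hc n _ h1)
        rw [Real.norm_of_nonneg (by positivity), norm_smul, mul_pow]
        refine mul_le_mul_of_nonneg_right (pow_le_pow_left₀ (norm_nonneg _) ?_ 2) (by positivity)
        exact (norm_sub_le _ _).trans (by
          rw [Real.norm_eq_abs, Real.norm_eq_abs]; linarith [hc n _ h1])
      · have h1 := (hlim _ (one_le_symbolA_rpow hα ξ)).sub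
          (tendsto_const_nhds (x := ψ (symbolA ξ ^ α)))
        rw [sub_self] at h1
        simpa using (h1.smul_const (fourier u ξ)).norm.pow 2
    have h1 := h0.sqrt
    simpa [Real.sqrt_sq] using h1

namespace HDiv

variable {s : ℝ}

theorem toField_mem (u : HDiv s) : toField u ∈ sobolev s := u.2

theorem toField_injective : Function.Injective (toField (s := s)) := Subtype.coe_injective

theorem toField_toHDiv {u : Field} (hu : u ∈ sobolev s) : toField (toHDiv s u) = u := by
  have h : toHDiv s u = (⟨u, hu⟩ : sobolev s) := dif_pos hu
  rw [h]; rfl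

theorem toHDiv_toField (u : HDiv s) : toHDiv s (toField u) = u :=
  toField_injective (toField_toHDiv u.2)

/-- The isometry `A^{s/2} : H^s → H^0`. -/
def coordₗᵢ (s : ℝ) : HDiv s →ₗᵢ[ℝ] divFree where
  toFun u := ⟨radial (fun x => x ^ (s / 2)) (toField u), radial_mem_divFree u.2.1 u.2.2⟩
  map_add' u v := by
    refine divFree_ext ?_
    filter_upwards [fourier_radial (ψ := fun x => x ^ (s / 2)) (u + v).2.2,
      fourier_radial (ψ := fun x => x ^ (s / 2)) u.2.2,
      fourier_radial (ψ := fun x => x ^ (s / 2)) v.2.2,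
      fourier_add_ae (toField u) (toField v),
      fourier_add_ae (radial (fun x => x ^ (s / 2)) (toField u))
        (radial (fun x => x ^ (s / 2)) (toField v))] with ξ h1 h2 h3 h4 h5
    refine h1.trans ?_
    simp only [Submodule.coe_add]
    rw [h5]
    refine Eq.trans ?_ (congrArg₂ (· + ·) h2.symm h3.symm)
    rw [← smul_add]
    exact congrArg _ h4
  map_smul' c u := by
    refine divFree_ext ?_
    filter_upwards [fourier_radial (ψ := fun x => x ^ (s / 2)) (c • u).2.2,
      fourier_radial (ψ := fun x => x ^ (s / 2)) u.2.2,
      fourier_smul_ae c (toField u),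
      fourier_smul_ae c (radial (fun x => x ^ (s / 2)) (toField u))] with ξ h1 h2 h3 h4
    refine h1.trans ?_
    simp only [Submodule.coe_smul, RingHom.id_apply]
    rw [h4]
    refine Eq.trans ?_ (congrArg (c • ·) h2.symm)
    rw [smul_comm]
    exact congrArg _ h3
  norm_map' u := by
    show ‖radial (fun x => x ^ (s / 2)) (toField u)‖ = ‖weightedHat u‖
    rw [← norm_fourier]
    congr 1
    refine Lp.ext ?_
    have hm : MemLp (weighted s (toField u)) 2 volume := u.2.2
    exact (fourier_radial (ψ := fun x => x ^ (s / 2)) u.2.2).trans hm.coeFn_toLp.symm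

theorem fourier_coordₗᵢ (u : HDiv s) :
    fourier (coordₗᵢ s u) =ᵐ[volume] weighted s (toField u) :=
  fourier_radial (ψ := fun x => x ^ (s / 2)) u.2.2

theorem isBddSymbol_rpow_neg {r : ℝ} (hr : 0 ≤ r) : IsBddSymbol fun x => x ^ (-r) := by
  refine ⟨measurable_id.pow_const _, 1, fun x hx => ?_⟩
  rw [abs_of_nonneg (Real.rpow_nonneg (by linarith) _)]
  exact Real.rpow_le_one_of_one_le_of_nonpos hx (by linarith)

/-- A^{-s/2} is a bounded multiplier for s ≥ 0, and supplies the preimage. -/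
theorem coordₗᵢ_surjective (hs : 0 ≤ s) : Function.Surjective (coordₗᵢ s) := by
  intro f
  have hb := isBddSymbol_rpow_neg (show 0 ≤ s / 2 by positivity)
  have h1 := fourier_radial (ψ := fun x => x ^ (-(s / 2))) (memLp_radial hb f)
  have h2 : weighted s (radial (fun x => x ^ (-(s / 2))) f) =ᵐ[volume] fourier f := by
    filter_upwards [h1] with ξ h
    rw [weighted, h, smul_smul, ← Real.rpow_add (symbolA_pos ξ), add_neg_cancel, Real.rpow_zero,
      one_smul]
  have h3 : radial (fun x => x ^ (-(s / 2))) f ∈ sobolev s :=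
    ⟨radial_mem_divFree f.2 (memLp_radial hb f), (memLp_congr_ae h2).2 (Lp.memLp _)⟩
  refine ⟨toHDiv s (radial (fun x => x ^ (-(s / 2))) f), divFree_ext ?_⟩
  refine (fourier_coordₗᵢ _).trans ?_
  rw [toField_toHDiv h3]
  exact h2

/-- The isometric isomorphism `A^{s/2} : H^s → H^0`. -/
def coord (hs : 0 ≤ s) : HDiv s ≃ₗᵢ[ℝ] divFree :=
  LinearIsometryEquiv.ofSurjective (coordₗᵢ s) (coordₗᵢ_surjective hs)

theorem fourier_coord (hs : 0 ≤ s) (u : HDiv s) :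
    fourier (coord hs u) =ᵐ[volume] fun ξ => symbolA ξ ^ (s / 2) • fourier (toField u) ξ :=
  fourier_coordₗᵢ u

theorem fourier_coord_symm (hs : 0 ≤ s) (f : divFree) :
    fourier (toField ((coord hs).symm f)) =ᵐ[volume]
      fun ξ => symbolA ξ ^ (-(s / 2)) • fourier f ξ := by
  have h := fourier_coord hs ((coord hs).symm f)
  rw [LinearIsometryEquiv.apply_symm_apply] at h
  filter_upwards [h] with ξ h
  rw [h, smul_smul, ← Real.rpow_add (symbolA_pos ξ), neg_add_cancel, Real.rpow_zero, one_smul]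

theorem coord_toHDiv (hs : 0 ≤ s) {u : Field} (hu : u ∈ sobolev s) :
    fourier (coord hs (toHDiv s u)) =ᵐ[volume] fun ξ => symbolA ξ ^ (s / 2) • fourier u ξ := by
  have := fourier_coord hs (toHDiv s u)
  rwa [toField_toHDiv hu] at this

end HDiv

end HyperNS

end

/-! ### Weighted Young inequality and integrable weights. -/

noncomputable section

namespace HyperNS

open Filter Topology Set

section Young

variable {V : Type*} [MeasurableSpace V] {μ : Measure V}

theorem sq_lintegral_mul_le {F G : V → ℝ≥0∞} (hF : Measurable F) (hG : Measurable G) :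
    (∫⁻ x, F x * G x ∂μ) ^ 2 ≤ (∫⁻ x, F x ^ 2 ∂μ) * ∫⁻ x, G x ^ 2 ∂μ := by
  have h := ENNReal.lintegral_mul_le_Lp_mul_Lq μ Real.HolderConjugate.two_two
    hF.aemeasurable hG.aemeasurable
  simp only [Pi.mul_apply, ENNReal.rpow_two] at h
  calc _ ≤ ((∫⁻ x, F x ^ 2 ∂μ) ^ (1 / 2 : ℝ) * (∫⁻ x, G x ^ 2 ∂μ) ^ (1 / 2 : ℝ)) ^ 2 :=
        pow_le_pow_left₀ zero_le h 2
    _ = _ := by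
        rw [mul_pow, ← ENNReal.rpow_natCast, ← ENNReal.rpow_natCast, ← ENNReal.rpow_mul,
          ← ENNReal.rpow_mul]
        norm_num

theorem sq_add_le (a b : ℝ≥0∞) : (a + b) ^ 2 ≤ 2 * (a ^ 2 + b ^ 2) := by
  have := ENNReal.rpow_add_le_mul_rpow_add_rpow a b (p := 2) (by norm_num)
  simp only [ENNReal.rpow_two] at this
  norm_num at this
  exact this

variable [AddCommGroup V] [MeasurableAdd₂ V] [MeasurableNeg V] [SFinite μ]
  [μ.IsAddLeftInvariant] [μ.IsNegInvariant]

/-- Young's inequality L¹ * L² → L²: Cauchy-Schwarz after splitting F = F^{1/2}F^{1/2}, then Tonelli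
and translation invariance. -/
theorem lintegral_sq_conv_le {F G : V → ℝ≥0∞} (hF : Measurable F) (hG : Measurable G) :
    ∫⁻ ξ, (∫⁻ η, F η * G (ξ - η) ∂μ) ^ 2 ∂μ ≤ (∫⁻ x, F x ∂μ) ^ 2 * ∫⁻ x, G x ^ 2 ∂μ := by
  have hGs : ∀ ξ, Measurable fun η => G (ξ - η) := fun ξ => hG.comp (measurable_const.sub measurable_id)
  have hF2 : Measurable fun η => F η ^ (1 / 2 : ℝ) := hF.pow_const _
  have hsq : ∀ a : ℝ≥0∞, (a ^ (1 / 2 : ℝ)) ^ 2 = a := fun a => by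
    rw [← ENNReal.rpow_natCast, ← ENNReal.rpow_mul]; norm_num
  have h1 : ∀ ξ, (∫⁻ η, F η * G (ξ - η) ∂μ) ^ 2
      ≤ (∫⁻ x, F x ∂μ) * ∫⁻ η, F η * G (ξ - η) ^ 2 ∂μ := by
    intro ξ
    have hm : Measurable fun η => F η ^ (1 / 2 : ℝ) * G (ξ - η) := hF2.mul (hGs ξ)
    have := sq_lintegral_mul_le (μ := μ) hF2 hm
    simp only [← mul_assoc, ← sq, mul_pow, hsq] at this
    exact this
  refine (lintegral_mono h1).trans ?_
  have hm : Measurable fun p : V × V => F p.2 * G (p.1 - p.2) ^ 2 :=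
    (hF.comp measurable_snd).mul ((hG.comp (measurable_fst.sub measurable_snd)).pow_const 2)
  rw [lintegral_const_mul _ hm.lintegral_prod_right', lintegral_lintegral_swap hm.aemeasurable, sq,
    mul_assoc]
  gcongr
  rw [← lintegral_mul_const _ hF]
  refine lintegral_mono fun η => ?_
  have hm2 : Measurable fun x => G (x - η) ^ 2 :=
    (hG.comp (measurable_id.sub measurable_const)).pow_const 2
  simp only
  rw [lintegral_const_mul _ hm2, lintegral_sub_right_eq_self (fun x => G x ^ 2) η]

theorem lintegral_conv_comm (F G : V → ℝ≥0∞) (ξ : V) :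
    ∫⁻ η, F η * G (ξ - η) ∂μ = ∫⁻ η, G η * F (ξ - η) ∂μ := by
  rw [← lintegral_sub_left_eq_self _ ξ]
  simp [mul_comm]

/-- Weighted Young inequality for a quasi-subadditive weight. -/
theorem lintegral_sq_weight_conv_le {F G W : V → ℝ≥0∞} {c : ℝ≥0∞} (hF : Measurable F)
    (hG : Measurable G) (hW : Measurable W) (hsub : ∀ ξ η, W ξ ≤ c * (W η + W (ξ - η))) :
    ∫⁻ ξ, (W ξ * ∫⁻ η, F η * G (ξ - η) ∂μ) ^ 2 ∂μ
      ≤ 2 * c ^ 2 * ((∫⁻ x, G x ∂μ) ^ 2 * (∫⁻ x, (W x * F x) ^ 2 ∂μ)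
        + (∫⁻ x, F x ∂μ) ^ 2 * ∫⁻ x, (W x * G x) ^ 2 ∂μ) := by
  have hGs : ∀ ξ, Measurable fun η => G (ξ - η) := fun ξ => hG.comp (measurable_const.sub measurable_id)
  have hWs : ∀ ξ, Measurable fun η => W (ξ - η) := fun ξ => hW.comp (measurable_const.sub measurable_id)
  -- Quasi-subadditivity puts the weight on one factor or the other; in each case the unweighted
  -- factor is the one to be measured in L¹, and commutativity of the convolution brings it to the
  -- first slot.
  have h1 : ∀ ξ, (W ξ * ∫⁻ η, F η * G (ξ - η) ∂μ) ^ 2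
      ≤ 2 * c ^ 2 * ((∫⁻ η, G η * (W (ξ - η) * F (ξ - η)) ∂μ) ^ 2
        + (∫⁻ η, F η * (W (ξ - η) * G (ξ - η)) ∂μ) ^ 2) := by
    intro ξ
    have h2 : W ξ * ∫⁻ η, F η * G (ξ - η) ∂μ ≤ c * (∫⁻ η, (W η * F η) * G (ξ - η) ∂μ
        + ∫⁻ η, F η * (W (ξ - η) * G (ξ - η)) ∂μ) := by
      have m1 : Measurable fun η => F η * G (ξ - η) := hF.mul (hGs ξ)
      have m2 : Measurable fun η => W η * F η * G (ξ - η) := (hW.mul hF).mul (hGs ξ)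
      have m3 : Measurable fun η => F η * (W (ξ - η) * G (ξ - η)) :=
        hF.mul ((hWs ξ).mul (hGs ξ))
      have m4 : Measurable fun η => W η * F η * G (ξ - η) + F η * (W (ξ - η) * G (ξ - η)) :=
        m2.add m3
      rw [← lintegral_const_mul _ m1, ← lintegral_add_left m2,
        ← lintegral_const_mul _ m4]
      refine lintegral_mono fun η => ?_
      calc W ξ * (F η * G (ξ - η)) ≤ c * (W η + W (ξ - η)) * (F η * G (ξ - η)) := by
            gcongr; exact hsub ξ η
        _ = _ := by ring
    refine (pow_le_pow_left₀ zero_le h2 2).trans ?_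
    rw [mul_pow, lintegral_conv_comm (fun η => W η * F η) G, mul_comm (2 : ℝ≥0∞), mul_assoc]
    gcongr
    exact sq_add_le _ _
  have hmeas : Measurable fun ξ => (∫⁻ η, G η * (W (ξ - η) * F (ξ - η)) ∂μ) ^ 2 := by
    refine Measurable.pow_const ?_ 2
    have : Measurable fun p : V × V => G p.2 * (W (p.1 - p.2) * F (p.1 - p.2)) :=
      (hG.comp measurable_snd).mul ((hW.mul hF).comp (measurable_fst.sub measurable_snd))
    exact this.lintegral_prod_right'
  have hmeas2 : Measurable fun ξ => (∫⁻ η, F η * (W (ξ - η) * G (ξ - η)) ∂μ) ^ 2 := by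
    refine Measurable.pow_const ?_ 2
    have : Measurable fun p : V × V => F p.2 * (W (p.1 - p.2) * G (p.1 - p.2)) :=
      (hF.comp measurable_snd).mul ((hW.mul hG).comp (measurable_fst.sub measurable_snd))
    exact this.lintegral_prod_right'
  refine (lintegral_mono h1).trans ?_
  have hsum : Measurable fun ξ => (∫⁻ η, G η * (W (ξ - η) * F (ξ - η)) ∂μ) ^ 2 +
      (∫⁻ η, F η * (W (ξ - η) * G (ξ - η)) ∂μ) ^ 2 := hmeas.add hmeas2
  rw [lintegral_const_mul _ hsum, lintegral_add_left hmeas]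
  gcongr
  · exact lintegral_sq_conv_le hG (hW.mul hF)
  · exact lintegral_sq_conv_le hF (hW.mul hG)

end Young

/-- The weight `(1 + |2πξ|²)^{r/2}` with values in `[0, ∞]`. -/
def weight (r : ℝ) (ξ : Plane) : ℝ≥0∞ := ENNReal.ofReal (symbolA ξ ^ (r / 2))

theorem measurable_weight (r : ℝ) : Measurable (weight r) :=
  (continuous_symbolA.measurable.pow_const _).ennreal_ofReal

theorem weight_mul (r s : ℝ) (ξ : Plane) : weight r ξ * weight s ξ = weight (r + s) ξ := by
  rw [weight, weight, weight, ← ENNReal.ofReal_mul (Real.rpow_nonneg (symbolA_pos ξ).le _),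
    ← Real.rpow_add (symbolA_pos ξ), ← add_div]

theorem weight_zero (ξ : Plane) : weight 0 ξ = 1 := by simp [weight]

theorem weight_le {r s : ℝ} (h : r ≤ s) (ξ : Plane) : weight r ξ ≤ weight s ξ :=
  ENNReal.ofReal_le_ofReal (Real.rpow_le_rpow_of_exponent_le (one_le_symbolA ξ) (by linarith))

theorem enorm_weighted (s : ℝ) (u : Field) (ξ : Plane) :
    ‖weighted s u ξ‖ₑ = weight s ξ * ‖fourier u ξ‖ₑ := by
  rw [weighted, enorm_smul, weight, Real.enorm_of_nonneg (Real.rpow_nonneg (symbolA_pos ξ).le _)]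

/-- From |ξ|² ≤ 2|η|² + 2|ξ-η|² the symbol at ξ is at most 4 times the larger of the other two;
raising to the power r/2 gives the constant, and a maximum is at most the sum. -/
theorem weight_subadd {r : ℝ} (hr : 0 ≤ r) (ξ η : Plane) :
    weight r ξ ≤ ENNReal.ofReal (4 ^ (r / 2)) * (weight r η + weight r (ξ - η)) := by
  have h0 : ∀ ζ, 0 ≤ symbolA ζ ^ (r / 2) := fun ζ => Real.rpow_nonneg (symbolA_pos ζ).le _
  rw [weight, weight, weight, ← ENNReal.ofReal_add (h0 _) (h0 _),
    ← ENNReal.ofReal_mul (by positivity)]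
  refine ENNReal.ofReal_le_ofReal ?_
  have h1 : ‖ξ‖ ≤ ‖η‖ + ‖ξ - η‖ := by
    simpa using norm_add_le η (ξ - η)
  have h2 : symbolA ξ ≤ 4 * max (symbolA η) (symbolA (ξ - η)) := by
    have h3 : symbolA ξ ≤ 2 * symbolA η + 2 * symbolA (ξ - η) := by
      unfold symbolA
      have h4 : (2 * Real.pi * ‖ξ‖) ^ 2 ≤ (2 * Real.pi * (‖η‖ + ‖ξ - η‖)) ^ 2 := by
        gcongr
      nlinarith [sq_nonneg (2 * Real.pi * (‖η‖ - ‖ξ - η‖))]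
    linarith [le_max_left (symbolA η) (symbolA (ξ - η)), le_max_right (symbolA η) (symbolA (ξ - η))]
  have h5 : symbolA ξ ^ (r / 2) ≤ (4 * max (symbolA η) (symbolA (ξ - η))) ^ (r / 2) :=
    Real.rpow_le_rpow (symbolA_pos ξ).le h2 (by positivity)
  rw [Real.mul_rpow (by norm_num) ((symbolA_pos η).le.trans (le_max_left _ _))] at h5
  refine h5.trans (mul_le_mul_of_nonneg_left ?_ (by positivity))
  rcases le_total (symbolA η) (symbolA (ξ - η)) with h | h
  · rw [max_eq_right h]; linarith [h0 η]
  · rw [max_eq_left h]; linarith [h0 (ξ - η)]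

/-- The integrand decays like |ξ|^{-2r}, integrable in the plane since 2r > 2. Here the condition α
> 1 enters. -/
theorem lintegral_weight_lt_top {r : ℝ} (hr : 1 < r) :
    ∫⁻ ξ, weight (-(2 * r)) ξ < ⊤ := by
  have h := (integrable_rpow_neg_one_add_norm_sq (E := Plane) (μ := volume) (r := 2 * r)
    (by simp; linarith)).lintegral_lt_top
  refine lt_of_le_of_lt (lintegral_mono fun ξ => ENNReal.ofReal_le_ofReal ?_) h
  refine Real.rpow_le_rpow_of_nonpos (by positivity) ?_ (by linarith)
  unfold symbolA
  have h1 : 1 ≤ 2 * Real.pi := by linarith [Real.pi_gt_three]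
  rw [mul_pow]
  nlinarith [mul_nonneg (sub_nonneg.2 (one_le_pow₀ h1 : 1 ≤ (2 * Real.pi) ^ 2)) (sq_nonneg ‖ξ‖)]

/-- A function with a weighted square integral is integrable. -/
theorem sq_lintegral_le_weight {r : ℝ} {F : Plane → ℝ≥0∞} (hF : Measurable F) :
    (∫⁻ ξ, F ξ) ^ 2 ≤ (∫⁻ ξ, weight (-(2 * r)) ξ) * ∫⁻ ξ, (weight r ξ * F ξ) ^ 2 := by
  have hm : Measurable fun ξ => weight r ξ * F ξ := (measurable_weight r).mul hF
  have h := sq_lintegral_mul_le (μ := (volume : Measure Plane)) (measurable_weight (-r)) hm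
  have e1 : ∀ ξ, weight (-r) ξ * (weight r ξ * F ξ) = F ξ := fun ξ => by
    rw [← mul_assoc, weight_mul, neg_add_cancel, weight_zero, one_mul]
  have e2 : ∀ ξ, weight (-r) ξ ^ 2 = weight (-(2 * r)) ξ := fun ξ => by
    rw [sq, weight_mul]; congr 1; ring
  simpa only [e1, e2] using h

end HyperNS

end

/-! ### Products of fields and derivatives as convolutions. -/

noncomputable section

namespace HyperNS

open Filter Topology Set
open scoped Convolution

/-! Squared Sobolev norms with values in `[0, ∞]`. -/

/-- The squared `H^s` norm, with values in `[0, ∞]`. -/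
def sobolevSq (s : ℝ) (u : Field) : ℝ≥0∞ := ∫⁻ ξ, (weight s ξ * ‖fourier u ξ‖ₑ) ^ 2

theorem eLpNorm_two_sq {f : Plane → CPlane} :
    eLpNorm f 2 (volume : Measure Plane) ^ 2 = ∫⁻ ξ, ‖f ξ‖ₑ ^ 2 := by
  have h := eLpNorm_nnreal_pow_eq_lintegral (μ := (volume : Measure Plane)) (f := f)
    (p := 2) (by norm_num)
  simpa using h

theorem memLp_two_of_lintegral_lt_top {f : Plane → CPlane}
    (hf : AEStronglyMeasurable f (volume : Measure Plane)) (h : ∫⁻ ξ, ‖f ξ‖ₑ ^ 2 < ⊤) :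
    MemLp f 2 (volume : Measure Plane) := by
  refine ⟨hf, ?_⟩
  rw [← eLpNorm_two_sq] at h
  exact (ENNReal.pow_lt_top_iff.1 h).resolve_right (by norm_num)

theorem sobolevSq_eq (s : ℝ) (u : Field) : sobolevSq s u = eLpNorm (weighted s u) 2 volume ^ 2 := by
  rw [eLpNorm_two_sq]
  simp only [enorm_weighted]
  rfl

theorem aestronglyMeasurable_weighted (s : ℝ) (u : Field) :
    AEStronglyMeasurable (weighted s u) (volume : Measure Plane) :=
  (continuous_symbolA.measurable.pow_const _).aestronglyMeasurable.smul
    (Lp.aestronglyMeasurable _)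

theorem mem_sobolev_iff {s : ℝ} {u : Field} :
    u ∈ sobolev s ↔ u ∈ divFree ∧ sobolevSq s u < ⊤ := by
  refine and_congr_right fun _ => ?_
  rw [sobolevSq_eq, ENNReal.pow_lt_top_iff]
  simp [MemLp, aestronglyMeasurable_weighted]

theorem sobolevSq_toField {s : ℝ} (u : HDiv s) :
    sobolevSq s (HDiv.toField u) = ENNReal.ofReal (‖u‖ ^ 2) := by
  have hm : MemLp (weighted s (HDiv.toField u)) 2 volume := u.2.2
  have h : ‖u‖ = ‖hm.toLp _‖ := rfl
  rw [sobolevSq_eq, h, Lp.norm_toLp, ENNReal.ofReal_pow ENNReal.toReal_nonneg,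
    ENNReal.ofReal_toReal hm.eLpNorm_ne_top]

theorem sobolevSq_mono {r s : ℝ} (h : r ≤ s) (u : Field) : sobolevSq r u ≤ sobolevSq s u :=
  lintegral_mono fun ξ => by gcongr; exact weight_le h ξ

theorem sobolev_mono {r s : ℝ} (h : r ≤ s) : sobolev s ≤ sobolev r := fun u hu =>
  mem_sobolev_iff.2 ⟨hu.1, (sobolevSq_mono h u).trans_lt (mem_sobolev_iff.1 hu).2⟩

theorem measurable_enorm_fourier (u : Field) : Measurable fun ξ => ‖fourier u ξ‖ₑ :=
  (Lp.stronglyMeasurable (fourier u)).measurable.enorm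

/-! Gradients. -/

/-- The Fourier transform of `∂ᵢ v`. -/
def gradHat (i : Fin 2) (v : Field) (ξ : Plane) : CPlane :=
  (2 * Real.pi * Complex.I * ((ξ i : ℝ) : ℂ)) • fourier v ξ

theorem measurable_gradHat (i : Fin 2) (v : Field) : Measurable (gradHat i v) := by
  have h : Measurable fun ξ : Plane => 2 * Real.pi * Complex.I * ((ξ i : ℝ) : ℂ) := by fun_prop
  exact h.smul (Lp.stronglyMeasurable (fourier v)).measurable

theorem enorm_gradHat_le (i : Fin 2) (v : Field) (ξ : Plane) :
    ‖gradHat i v ξ‖ₑ ≤ weight 1 ξ * ‖fourier v ξ‖ₑ := by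
  rw [gradHat, enorm_smul]
  gcongr
  rw [weight, ← ofReal_norm]
  refine ENNReal.ofReal_le_ofReal ?_
  rw [← Real.sqrt_eq_rpow]
  refine Real.le_sqrt_of_sq_le ?_
  have h1 : ‖ξ i‖ ≤ ‖ξ‖ := PiLp.norm_apply_le ξ i
  simp only [norm_mul, Complex.norm_I, Complex.norm_real, Complex.norm_ofNat, mul_one]
  rw [Real.norm_of_nonneg Real.pi_pos.le]
  unfold symbolA
  have h2 : (2 * Real.pi * ‖ξ i‖) ^ 2 ≤ (2 * Real.pi * ‖ξ‖) ^ 2 := by gcongr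
  linarith

theorem memLp_gradHat {v : Field} (hv : sobolevSq 1 v < ⊤) (i : Fin 2) :
    MemLp (gradHat i v) 2 (volume : Measure Plane) := by
  refine memLp_two_of_lintegral_lt_top (measurable_gradHat i v).aestronglyMeasurable
    (lt_of_le_of_lt (lintegral_mono fun ξ => ?_) hv)
  gcongr
  exact enorm_gradHat_le i v ξ

theorem fourier_partialDeriv {v : Field} (hv : sobolevSq 1 v < ⊤) (i : Fin 2) :
    fourier (partialDeriv i v) =ᵐ[volume] gradHat i v := by
  refine fourier_invFourier (memLp_gradHat hv i) ?_
  filter_upwards [coeFn_fourier_neg v] with ξ hξ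
  rw [hξ, conjVec_smul]
  congr 1
  simp [Complex.conj_ofNat]

/-! Integrability of Fourier transforms. -/

/-- Cauchy-Schwarz against the integrable weight: r > 1 additional derivatives in L² make the
weighted transform integrable. It takes the place of Sobolev embeddings. -/
theorem sq_lintegral_fourier_le {s r : ℝ} (u : Field) :
    (∫⁻ ξ, weight s ξ * ‖fourier u ξ‖ₑ) ^ 2
      ≤ (∫⁻ ξ, weight (-(2 * r)) ξ) * sobolevSq (r + s) u := by
  refine (sq_lintegral_le_weight (r := r)
    ((measurable_weight s).mul (measurable_enorm_fourier u))).trans_eq ?_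
  simp only [Pi.mul_apply, ← mul_assoc, weight_mul]
  rfl

theorem lintegral_fourier_lt_top {s r : ℝ} (hr : 1 < r) {u : Field}
    (hu : sobolevSq (r + s) u < ⊤) : ∫⁻ ξ, weight s ξ * ‖fourier u ξ‖ₑ < ⊤ := by
  have h := (sq_lintegral_fourier_le (s := s) (r := r) u).trans_lt
    (ENNReal.mul_lt_top (lintegral_weight_lt_top hr) hu)
  exact (ENNReal.pow_lt_top_iff.1 h).resolve_right (by norm_num)

theorem integrable_fourier {r : ℝ} (hr : 1 < r) {u : Field} (hu : sobolevSq r u < ⊤) :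
    Integrable (fourier u) := by
  refine ⟨Lp.aestronglyMeasurable _, ?_⟩
  have h := lintegral_fourier_lt_top (s := 0) hr (u := u) (by rwa [add_zero])
  simp only [weight_zero, one_mul] at h
  exact h

theorem integrable_gradHat {r : ℝ} (hr : 1 < r) {v : Field} (hv : sobolevSq (r + 1) v < ⊤)
    (i : Fin 2) : Integrable (gradHat i v) :=
  ⟨(measurable_gradHat i v).aestronglyMeasurable,
    (lintegral_mono fun ξ => enorm_gradHat_le i v ξ).trans_lt (lintegral_fourier_lt_top hr hv)⟩

/-! Products of fields and convolutions of their Fourier transforms. -/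

theorem ofRealVec_ae_eq_fourierInv {u : Field} {f : Plane → CPlane}
    (hf : fourier u =ᵐ[volume] f) (hi : Integrable f) :
    (fun x => ofRealVec (u x)) =ᵐ[volume] (𝓕⁻ f : Plane → CPlane) := by
  have h1 : (Lp.fourierTransformₗᵢ Plane CPlane).symm (fourier u) = ofRealVec.compLpL 2 volume u :=
    (Lp.fourierTransformₗᵢ Plane CPlane).symm_apply_apply _
  have h2 := coeFn_fourierInv (G := fourier u) (hi.congr hf.symm)
  have h3 : (𝓕⁻ (fourier u) : CField) = ofRealVec.compLpL 2 volume u := h1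
  rw [h3, funext (Real.fourierInv_congr_ae hf)] at h2
  exact (ofRealVec.coeFn_compLpL (p := 2) (μ := volume) u).symm.trans h2

theorem fourierInv_convolution (L : CPlane →L[ℂ] CPlane →L[ℂ] CPlane) {f g : Plane → CPlane}
    (hf : Integrable f) (hg : Integrable g) (x : Plane) :
    𝓕⁻ (f ⋆[L] g) x = L (𝓕⁻ f x) (𝓕⁻ g x) := by
  simp only [Real.fourierInv_eq_fourier_neg]
  exact Real.fourier_bilin_convolution_eq L hf hg _

/-- A real field whose complexification is the inverse Fourier transform of `H ∈ L¹ ∩ L²`. -/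
theorem memLp_of_ofRealVec_ae_eq {w : Plane → Plane} {H : Plane → CPlane}
    (hH : Integrable H) (hH2 : MemLp H 2 (volume : Measure Plane))
    (hw : (fun x => ofRealVec (w x)) =ᵐ[volume] (𝓕⁻ H : Plane → CPlane)) :
    ∃ h : MemLp w 2 (volume : Measure Plane), fourier (h.toLp w) =ᵐ[volume] H := by
  set G : CField := hH2.toLp H with hG
  have hGH : G =ᵐ[volume] H := hH2.coeFn_toLp
  have h1 := coeFn_fourierInv (G := G) (hH.congr hGH.symm)
  rw [funext (Real.fourierInv_congr_ae hGH)] at h1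
  have h2 : (𝓕⁻ G : CField) =ᵐ[volume] fun x => ofRealVec (w x) := h1.trans hw.symm
  have h3 : w =ᵐ[volume] fun x => reVec ((𝓕⁻ G : CField) x) := by
    filter_upwards [h2] with x hx
    rw [hx, reVec_ofRealVec]
  have h4 : MemLp w 2 (volume : Measure Plane) :=
    (memLp_congr_ae h3).2 (reVec.comp_memLp (𝓕⁻ G : CField))
  refine ⟨h4, ?_⟩
  have h5 : ofRealVec.compLpL 2 volume (h4.toLp w) = (𝓕⁻ G : CField) := by
    refine Lp.ext ?_
    filter_upwards [ofRealVec.coeFn_compLpL (p := 2) (μ := volume) (h4.toLp w), h4.coeFn_toLp, h2]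
      with x h6 h7 h8
    rw [h6, h7, h8]
  have h6 : fourier (h4.toLp w) = G := by
    show Lp.fourierTransformₗᵢ Plane CPlane (ofRealVec.compLpL 2 volume (h4.toLp w)) = G
    rw [h5]
    exact (Lp.fourierTransformₗᵢ Plane CPlane).apply_symm_apply G
  rw [h6]
  exact hGH

/-- The Fourier transform of `∑ᵢ Lᵢ(u, ∂ᵢ v)`. -/
def bilinGradHat (L : Fin 2 → CPlane →L[ℂ] CPlane →L[ℂ] CPlane) (u v : Field) (ξ : Plane) :
    CPlane := ∑ i, (fourier u ⋆[L i] gradHat i v) ξ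

section BilinGrad

variable (L : Fin 2 → CPlane →L[ℂ] CPlane →L[ℂ] CPlane) {α : ℝ} {u v : Field}

theorem integrable_bilinGradHat (hα : 1 < α) (hu : sobolevSq α u < ⊤)
    (hv : sobolevSq (2 * α) v < ⊤) : Integrable (bilinGradHat L u v) := by
  have hv' : sobolevSq ((2 * α - 1) + 1) v < ⊤ := by rwa [sub_add_cancel]
  exact integrable_finsetSum _ fun i _ =>
    (integrable_fourier hα hu).integrable_convolution (L i)
      (integrable_gradHat (by linarith) hv' i)

/-- Both transforms are integrable, so u and ∂ᵢv are given by inversion integrals and the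
convolution theorem holds pointwise. -/
theorem fourierInv_bilinGradHat (hα : 1 < α) (hu : sobolevSq α u < ⊤)
    (hv : sobolevSq (2 * α) v < ⊤) :
    (fun x => ∑ i, L i (ofRealVec (u x)) (ofRealVec (partialDeriv i v x)))
      =ᵐ[volume] (𝓕⁻ (bilinGradHat L u v) : Plane → CPlane) := by
  have hv' : sobolevSq ((2 * α - 1) + 1) v < ⊤ := by rwa [sub_add_cancel]
  have hg : ∀ i, Integrable (gradHat i v) := integrable_gradHat (by linarith) hv'
  have hf := integrable_fourier hα hu
  have hv1 : sobolevSq 1 v < ⊤ := (sobolevSq_mono (by linarith) v).trans_lt hv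
  filter_upwards [ofRealVec_ae_eq_fourierInv (EventuallyEq.refl _ _) hf,
    ae_all_iff.2 fun i => ofRealVec_ae_eq_fourierInv (fourier_partialDeriv hv1 i) (hg i)]
    with x h1 h2
  have h3 : 𝓕⁻ (bilinGradHat L u v) x = ∑ i, 𝓕⁻ (fourier u ⋆[L i] gradHat i v) x := by
    simp only [Real.fourierInv_eq', bilinGradHat, Finset.smul_sum]
    refine integral_finsetSum _ fun i _ => ?_
    have h4 := (Real.fourierIntegral_convergent_iff (-x)).2
      (hf.integrable_convolution (L i) (hg i))
    refine h4.congr (Eventually.of_forall fun ξ => ?_)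
    simp [Circle.smul_def, Real.fourierChar_apply]
  rw [h3]
  refine Finset.sum_congr rfl fun i _ => ?_
  rw [fourierInv_convolution (L i) hf (hg i), ← h2 i, ← h1]

theorem enorm_bilinGradHat_le (ξ : Plane) :
    ‖bilinGradHat L u v ξ‖ₑ ≤ (∑ i, ‖L i‖ₑ) *
      ∫⁻ η, ‖fourier u η‖ₑ * (weight 1 (ξ - η) * ‖fourier v (ξ - η)‖ₑ) := by
  have hm : Measurable fun η => ‖fourier u η‖ₑ * (weight 1 (ξ - η) * ‖fourier v (ξ - η)‖ₑ) :=
    (measurable_enorm_fourier u).mul (((measurable_weight 1).mul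
      (measurable_enorm_fourier v)).comp (measurable_const.sub measurable_id))
  refine (enorm_sum_le _ _).trans ?_
  rw [Finset.sum_mul]
  refine Finset.sum_le_sum fun i _ => (enorm_integral_le_lintegral_enorm _).trans ?_
  rw [← lintegral_const_mul _ hm]
  refine lintegral_mono fun η => ?_
  calc ‖L i (fourier u η) (gradHat i v (ξ - η))‖ₑ
      ≤ ‖L i‖ₑ * ‖fourier u η‖ₑ * ‖gradHat i v (ξ - η)‖ₑ :=
        ((L i (fourier u η)).le_opENorm _).trans (by gcongr; exact (L i).le_opENorm _)
    _ ≤ ‖L i‖ₑ * ‖fourier u η‖ₑ * (weight 1 (ξ - η) * ‖fourier v (ξ - η)‖ₑ) := by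
        gcongr; exact enorm_gradHat_le i v _
    _ = _ := by rw [mul_assoc]

/-- Weighted Young with weight of order α. If u carries it, ∇v must have an integrable transform,
which costs 1 + r derivatives with r = 2α - 1 > 1. If ∇v carries it, û must be integrable, which α >
1 gives, and α + 1 ≤ 2α. The form L is left general to cover both the advection term and the
gradient of |v|²/2. -/
theorem lintegral_sq_bilinGradHat_le (hα : 1 < α) : ∃ K : ℝ≥0, ∀ u v : Field,
    ∫⁻ ξ, (weight α ξ * ‖bilinGradHat L u v ξ‖ₑ) ^ 2
      ≤ K * (sobolevSq α u * sobolevSq (2 * α) v) := by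
  set c : ℝ≥0∞ := ENNReal.ofReal (4 ^ (α / 2))
  set D : ℝ≥0∞ := ∑ i, ‖L i‖ₑ
  set A : ℝ≥0∞ := ∫⁻ ξ, weight (-(2 * (2 * α - 1))) ξ
  set A' : ℝ≥0∞ := ∫⁻ ξ, weight (-(2 * α)) ξ
  have hA : A < ⊤ := lintegral_weight_lt_top (by linarith)
  have hA' : A' < ⊤ := lintegral_weight_lt_top hα
  have hD : D < ⊤ := ENNReal.sum_lt_top.2 fun i _ => enorm_lt_top
  have hK : D ^ 2 * (2 * c ^ 2 * (A + A')) < ⊤ := by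
    refine ENNReal.mul_lt_top (ENNReal.pow_lt_top hD) (ENNReal.mul_lt_top (ENNReal.mul_lt_top
      (by norm_num) (ENNReal.pow_lt_top ENNReal.ofReal_lt_top)) (ENNReal.add_lt_top.2 ⟨hA, hA'⟩))
  refine ⟨(D ^ 2 * (2 * c ^ 2 * (A + A'))).toNNReal, fun u v => ?_⟩
  rw [ENNReal.coe_toNNReal hK.ne]
  set G : Plane → ℝ≥0∞ := fun ξ => weight 1 ξ * ‖fourier v ξ‖ₑ
  have hG : Measurable G := (measurable_weight 1).mul (measurable_enorm_fourier v)
  have hF := measurable_enorm_fourier u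
  have hconv : Measurable fun ξ => (weight α ξ * ∫⁻ η, ‖fourier u η‖ₑ * G (ξ - η)) ^ 2 := by
    have hm : Measurable fun p : Plane × Plane => ‖fourier u p.2‖ₑ * G (p.1 - p.2) :=
      (hF.comp measurable_snd).mul (hG.comp (measurable_fst.sub measurable_snd))
    exact ((measurable_weight α).mul hm.lintegral_prod_right').pow_const 2
  have h1 : ∫⁻ ξ, (weight α ξ * ‖bilinGradHat L u v ξ‖ₑ) ^ 2
      ≤ D ^ 2 * ∫⁻ ξ, (weight α ξ * ∫⁻ η, ‖fourier u η‖ₑ * G (ξ - η)) ^ 2 := by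
    rw [← lintegral_const_mul _ hconv]
    refine lintegral_mono fun ξ => ?_
    rw [← mul_pow, ← mul_assoc, mul_comm D, mul_assoc]
    gcongr
    exact enorm_bilinGradHat_le L ξ
  have h2 := lintegral_sq_weight_conv_le (μ := (volume : Measure Plane)) hF hG
    (measurable_weight α) (weight_subadd (by linarith))
  have h3 : (∫⁻ ξ, G ξ) ^ 2 ≤ A * sobolevSq (2 * α) v := by
    have := sq_lintegral_fourier_le (s := 1) (r := 2 * α - 1) v
    rwa [sub_add_cancel] at this
  have h4 : (∫⁻ ξ, ‖fourier u ξ‖ₑ) ^ 2 ≤ A' * sobolevSq α u := by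
    have := sq_lintegral_fourier_le (s := 0) (r := α) u
    simpa only [weight_zero, one_mul, add_zero] using this
  have h5 : ∫⁻ ξ, (weight α ξ * G ξ) ^ 2 ≤ sobolevSq (2 * α) v := by
    refine le_trans (lintegral_mono fun ξ => ?_) (sobolevSq_mono (r := α + 1) (by linarith) v)
    simp only [G, ← mul_assoc, weight_mul]
    exact le_rfl
  calc _ ≤ D ^ 2 * (2 * c ^ 2 * (A * sobolevSq (2 * α) v * sobolevSq α u
        + A' * sobolevSq α u * sobolevSq (2 * α) v)) := by
        refine h1.trans (mul_le_mul_right (h2.trans (mul_le_mul_right ?_ _)) _)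
        exact add_le_add (mul_le_mul' h3 le_rfl) (mul_le_mul' h4 h5)
    _ = _ := by ring

theorem memLp_bilinGradHat (hα : 1 < α) (hu : sobolevSq α u < ⊤)
    (hv : sobolevSq (2 * α) v < ⊤) : MemLp (bilinGradHat L u v) 2 (volume : Measure Plane) := by
  obtain ⟨K, hK⟩ := lintegral_sq_bilinGradHat_le L hα
  refine memLp_two_of_lintegral_lt_top (integrable_bilinGradHat L hα hu hv).aestronglyMeasurable
    (lt_of_le_of_lt (lintegral_mono fun ξ => ?_) ((hK u v).trans_lt
      (ENNReal.mul_lt_top ENNReal.coe_lt_top (ENNReal.mul_lt_top hu hv))))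
  gcongr
  refine le_mul_of_one_le_left zero_le ?_
  rw [← weight_zero ξ]
  exact weight_le (by linarith) ξ

/-- If `ofRealVec ∘ w = ∑ᵢ Lᵢ(u, ∂ᵢ v)`, then `w` is square integrable and its Fourier transform is
the corresponding convolution. -/
theorem memLp_of_eq_bilinGrad (hα : 1 < α) (hu : sobolevSq α u < ⊤)
    (hv : sobolevSq (2 * α) v < ⊤) {w : Plane → Plane} (hw : ∀ x, ofRealVec (w x)
      = ∑ i, L i (ofRealVec (u x)) (ofRealVec (partialDeriv i v x))) :
    ∃ h : MemLp w 2 (volume : Measure Plane), fourier (h.toLp w) =ᵐ[volume] bilinGradHat L u v :=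
  memLp_of_ofRealVec_ae_eq (integrable_bilinGradHat L hα hu hv) (memLp_bilinGradHat L hα hu hv)
    (EventuallyEq.trans (Eventually.of_forall hw) (fourierInv_bilinGradHat L hα hu hv))

end BilinGrad

end HyperNS

end

/-! ### Leray projector, the bilinear operator and its cancellation. -/

noncomputable section

namespace HyperNS

open Filter Topology Set
open scoped Convolution

/-! The Leray projector as a Fourier multiplier. -/

theorem ofRealVec_neg_arg (ξ : Plane) : ofRealVec (-ξ) = -ofRealVec ξ := map_neg _ _

theorem inner_ofRealVec (ξ : Plane) (a : CPlane) :
    inner ℂ (ofRealVec ξ) a = ∑ i, ((ξ i : ℝ) : ℂ) * a i := by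
  simp only [PiLp.inner_apply, RCLike.inner_apply, ofRealVec_apply, Complex.conj_ofReal, mul_comm]

theorem inner_ofRealVec_conjVec (ξ : Plane) (a : CPlane) :
    inner ℂ (ofRealVec ξ) (conjVec a) = (starRingEnd ℂ) (inner ℂ (ofRealVec ξ) a) := by
  simp only [inner_ofRealVec, conjVec_apply, map_sum, map_mul, Complex.conj_ofReal]

/-- The component of `a` along `ξ`. -/
def longitudinal (ξ : Plane) (a : CPlane) : CPlane :=
  (inner ℂ (ofRealVec ξ) a / ((‖ξ‖ ^ 2 : ℝ) : ℂ)) • ofRealVec ξ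

theorem norm_longitudinal_le (ξ : Plane) (a : CPlane) : ‖longitudinal ξ a‖ ≤ ‖a‖ := by
  rw [longitudinal, norm_smul, norm_div, Complex.norm_real, Real.norm_of_nonneg (by positivity),
    norm_ofRealVec]
  rcases eq_or_ne ξ 0 with rfl | h
  · simp
  have h0 : 0 < ‖ξ‖ := norm_pos_iff.2 h
  have h1 : ‖inner ℂ (ofRealVec ξ) a‖ ≤ ‖ξ‖ * ‖a‖ := by
    simpa only [norm_ofRealVec] using norm_inner_le_norm (𝕜 := ℂ) (ofRealVec ξ) a
  rw [div_mul_eq_mul_div, div_le_iff₀ (by positivity)]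
  nlinarith

theorem inner_longitudinal (ξ : Plane) (a : CPlane) :
    inner ℂ (ofRealVec ξ) (longitudinal ξ a) = inner ℂ (ofRealVec ξ) a := by
  rcases eq_or_ne ξ 0 with rfl | h
  · simp
  have h0 : ((‖ξ‖ : ℝ) : ℂ) ≠ 0 := by exact_mod_cast norm_ne_zero_iff.2 h
  rw [longitudinal, inner_smul_right, inner_self_eq_norm_sq_to_K, norm_ofRealVec]
  push_cast
  exact div_mul_cancel₀ _ (pow_ne_zero 2 h0)

theorem longitudinal_neg_conjVec (ξ : Plane) (a : CPlane) :
    longitudinal (-ξ) (conjVec a) = conjVec (longitudinal ξ a) := by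
  rw [longitudinal, longitudinal, ofRealVec_neg_arg, norm_neg, conjVec_smul, conjVec_ofRealVec,
    inner_neg_left, inner_ofRealVec_conjVec, map_div₀, Complex.conj_ofReal, neg_div, neg_smul_neg]

theorem mem_divFree_iff {u : Field} :
    u ∈ divFree ↔ ∀ᵐ ξ : Plane, inner ℂ (ofRealVec ξ) (fourier u ξ) = 0 := by
  simp only [inner_ofRealVec]
  rfl

/-- Removing the component along ξ yields a square integrable Hermitian function, hence a field; it
is divergence-free, and the removed part is orthogonal to divergence-free fields. These properties
characterise the orthogonal projection. -/
theorem fourier_leray (q : Field) :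
    fourier (leray q) =ᵐ[volume] fun ξ => fourier q ξ - longitudinal ξ (fourier q ξ) := by
  set k : Plane → CPlane := fun ξ => fourier q ξ - longitudinal ξ (fourier q ξ) with hk
  have hmeas : AEStronglyMeasurable k (volume : Measure Plane) := by
    have h0 : Measurable fun ξ => fourier q ξ := (Lp.stronglyMeasurable (fourier q)).measurable
    have h1 : Measurable fun ξ : Plane => ofRealVec ξ := ofRealVec.continuous.measurable
    have h2 : Measurable fun ξ : Plane => ((‖ξ‖ ^ 2 : ℝ) : ℂ) := by fun_prop
    have h3 : Measurable fun ξ => longitudinal ξ (fourier q ξ) :=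
      ((h1.inner (𝕜 := ℂ) h0).div h2).smul h1
    exact (h0.sub h3).aestronglyMeasurable
  have hmem : MemLp k 2 (volume : Measure Plane) := by
    refine MemLp.of_le_mul (c := 2) (Lp.memLp (fourier q)) hmeas (Eventually.of_forall fun ξ => ?_)
    linarith [norm_sub_le (fourier q ξ) (longitudinal ξ (fourier q ξ)),
      norm_longitudinal_le ξ (fourier q ξ)]
  have hsymm : IsConjSymm k := by
    filter_upwards [coeFn_fourier_neg q] with ξ hξ
    simp only [hk]
    rw [hξ, longitudinal_neg_conjVec, map_sub]
  have hp := fourier_invFourier hmem hsymm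
  suffices h : leray q = invFourier k by rw [h]; exact hp
  refine Submodule.eq_starProjection_of_mem_of_inner_eq_zero ?_ fun w hw => ?_
  · rw [mem_divFree_iff]
    filter_upwards [hp] with ξ h
    rw [h, hk, inner_sub_right, inner_longitudinal, sub_self]
  · rw [inner_fourier]
    refine integral_eq_zero_of_ae ?_
    filter_upwards [hp, fourier_sub_ae q (invFourier k), mem_divFree_iff.1 hw] with ξ h1 h2 h3
    rw [h2, h1, hk, sub_sub_cancel, longitudinal, inner_smul_left, h3, mul_zero]
    rfl

theorem leray_mem (q : Field) : leray q ∈ divFree := Submodule.starProjection_apply_mem _ _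

theorem inner_leray {w : Field} (hw : w ∈ divFree) (q : Field) :
    inner ℝ w (leray q) = inner ℝ w q := by
  rw [leray, ← Submodule.inner_starProjection_left_eq_right,
    Submodule.starProjection_eq_self_iff.2 hw]

theorem sobolevSq_leray_le (s : ℝ) (q : Field) : sobolevSq s (leray q) ≤ 4 * sobolevSq s q := by
  have hm : Measurable fun ξ => (weight s ξ * ‖fourier q ξ‖ₑ) ^ 2 :=
    ((measurable_weight s).mul (measurable_enorm_fourier q)).pow_const 2
  rw [sobolevSq, sobolevSq, ← lintegral_const_mul _ hm]
  refine lintegral_mono_ae ?_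
  filter_upwards [fourier_leray q] with ξ h
  have h1 : ‖fourier (leray q) ξ‖ₑ ≤ 2 * ‖fourier q ξ‖ₑ := by
    have h2 : ‖fourier (leray q) ξ‖ ≤ 2 * ‖fourier q ξ‖ := by
      rw [h]
      linarith [norm_sub_le (fourier q ξ) (longitudinal ξ (fourier q ξ)),
        norm_longitudinal_le ξ (fourier q ξ)]
    rw [← ofReal_norm, ← ofReal_norm (fourier q ξ)]
    refine (ENNReal.ofReal_le_ofReal h2).trans_eq ?_
    rw [ENNReal.ofReal_mul (by norm_num), ENNReal.ofReal_ofNat]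
  calc _ ≤ (weight s ξ * (2 * ‖fourier q ξ‖ₑ)) ^ 2 := by gcongr
    _ = _ := by ring

/-! The advection term. -/

/-- `(a, b) ↦ aᵢ b`. -/
def advForm (i : Fin 2) : CPlane →L[ℂ] CPlane →L[ℂ] CPlane :=
  LinearMap.toContinuousBilinearMap (LinearMap.mk₂ ℂ (fun a b => a i • b)
    (fun a b c => by simp [add_smul]) (fun c a b => by simp [mul_smul])
    (fun a b c => smul_add _ _ _) (fun c a b => smul_comm _ _ _))

theorem advForm_apply (i : Fin 2) (a b : CPlane) : advForm i a b = a i • b := rfl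

/-- `(a, b) ↦ (a · b) eᵢ`. -/
def dotForm (i : Fin 2) : CPlane →L[ℂ] CPlane →L[ℂ] CPlane :=
  LinearMap.toContinuousBilinearMap (LinearMap.mk₂ ℂ
    (fun a b => (∑ j, a j * b j) • EuclideanSpace.single i (1 : ℂ))
    (fun a b c => by simp [add_mul, add_smul, add_add_add_comm])
    (fun c a b => by simp [mul_assoc, ← mul_add, mul_smul])
    (fun a b c => by simp [mul_add, add_smul, add_add_add_comm])
    (fun c a b => by simp [mul_left_comm, ← mul_add, mul_smul]))

theorem dotForm_apply (i : Fin 2) (a b : CPlane) :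
    dotForm i a b = (∑ j, a j * b j) • EuclideanSpace.single i (1 : ℂ) := rfl

theorem ofRealVec_advection (u v : Field) (x : Plane) : ofRealVec (advection u v x)
    = ∑ i, advForm i (ofRealVec (u x)) (ofRealVec (partialDeriv i v x)) := by
  ext j
  simp [advection, advForm_apply, Fin.sum_univ_two]

/-- The field with components `v · ∂ᵢ v`. -/
def dotGrad (v : Field) (x : Plane) : Plane :=
  WithLp.toLp 2 fun i => ∑ j, v x j * partialDeriv i v x j

theorem ofRealVec_dotGrad (v : Field) (x : Plane) : ofRealVec (dotGrad v x)
    = ∑ i, dotForm i (ofRealVec (v x)) (ofRealVec (partialDeriv i v x)) := by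
  ext j
  fin_cases j <;> simp [dotGrad, dotForm_apply, Fin.sum_univ_two]

/-- The algebra behind the cancellation: v · (u·∇)v = u · ∇(|v|²/2), `dotGrad` being that gradient.
-/
theorem inner_advection_self (u v : Field) (x : Plane) :
    inner ℝ (v x) (advection u v x) = inner ℝ (u x) (dotGrad v x) := by
  simp only [advection, dotGrad, PiLp.inner_apply, RCLike.inner_apply, Fin.sum_univ_two]
  simp
  ring

section Bounds

variable {α : ℝ}

theorem memLp_advection (hα : 1 < α) {u v : Field} (hu : sobolevSq α u < ⊤)
    (hv : sobolevSq (2 * α) v < ⊤) : ∃ h : MemLp (advection u v) 2 (volume : Measure Plane),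
      fourier (h.toLp _) =ᵐ[volume] bilinGradHat advForm u v :=
  memLp_of_eq_bilinGrad advForm hα hu hv (ofRealVec_advection u v)

theorem bilinB_eq {u v : Field} (h : MemLp (advection u v) 2 (volume : Measure Plane)) :
    bilinB u v = leray (h.toLp _) := dif_pos h

/-- The Leray projector costs a constant factor on the convolution estimate. Only the H^α norm of u
occurs, and this asymmetry makes the a priori estimate close. -/
theorem sobolevSq_bilinB_le (hα : 1 < α) : ∃ K : ℝ≥0, ∀ u v : Field, sobolevSq α u < ⊤ →
    sobolevSq (2 * α) v < ⊤ →
      sobolevSq α (bilinB u v) ≤ K * (sobolevSq α u * sobolevSq (2 * α) v) := by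
  obtain ⟨K, hK⟩ := lintegral_sq_bilinGradHat_le advForm hα
  refine ⟨4 * K, fun u v hu hv => ?_⟩
  obtain ⟨h, hq⟩ := memLp_advection hα hu hv
  rw [bilinB_eq h]
  have h1 : sobolevSq α (h.toLp _) = ∫⁻ ξ, (weight α ξ * ‖bilinGradHat advForm u v ξ‖ₑ) ^ 2 := by
    refine lintegral_congr_ae ?_
    filter_upwards [hq] with ξ hξ
    rw [hξ]
  refine (sobolevSq_leray_le α _).trans ?_
  rw [h1, ENNReal.coe_mul, mul_assoc]
  exact mul_le_mul_right (hK u v) _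

theorem bilinB_mem (hα : 1 < α) {u v : Field} (hu : sobolevSq α u < ⊤)
    (hv : sobolevSq (2 * α) v < ⊤) : bilinB u v ∈ sobolev α := by
  obtain ⟨K, hK⟩ := sobolevSq_bilinB_le hα
  obtain ⟨h, -⟩ := memLp_advection hα hu hv
  refine mem_sobolev_iff.2 ⟨?_, (hK u v hu hv).trans_lt
    (ENNReal.mul_lt_top ENNReal.coe_lt_top (ENNReal.mul_lt_top hu hv))⟩
  rw [bilinB_eq h]
  exact leray_mem _

end Bounds

/-! Bilinearity. -/

theorem sobolevSq_add_lt_top {s : ℝ} {u v : Field} (hu : sobolevSq s u < ⊤)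
    (hv : sobolevSq s v < ⊤) : sobolevSq s (u + v) < ⊤ := by
  have hm : Measurable fun ξ => (weight s ξ * ‖fourier u ξ‖ₑ) ^ 2 :=
    ((measurable_weight s).mul (measurable_enorm_fourier u)).pow_const 2
  have h : sobolevSq s (u + v) ≤ ∫⁻ ξ, 2 * ((weight s ξ * ‖fourier u ξ‖ₑ) ^ 2
      + (weight s ξ * ‖fourier v ξ‖ₑ) ^ 2) := by
    refine lintegral_mono_ae ?_
    filter_upwards [fourier_add_ae u v] with ξ h
    refine le_trans ?_ (sq_add_le _ _)
    rw [h, ← mul_add]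
    gcongr
    exact enorm_add_le _ _
  refine h.trans_lt ?_
  rw [lintegral_const_mul' _ _ (by norm_num), lintegral_add_left hm]
  exact ENNReal.mul_lt_top (by norm_num) (ENNReal.add_lt_top.2 ⟨hu, hv⟩)

theorem sobolevSq_smul_lt_top {s : ℝ} {u : Field} (c : ℝ) (hu : sobolevSq s u < ⊤) :
    sobolevSq s (c • u) < ⊤ := by
  have h : sobolevSq s (c • u) = ∫⁻ ξ, ‖c‖ₑ ^ 2 * (weight s ξ * ‖fourier u ξ‖ₑ) ^ 2 := by
    refine lintegral_congr_ae ?_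
    filter_upwards [fourier_smul_ae c u] with ξ h
    rw [h, enorm_smul]
    ring
  rw [h, lintegral_const_mul' _ _ (ENNReal.pow_ne_top enorm_ne_top)]
  exact ENNReal.mul_lt_top (ENNReal.pow_lt_top enorm_lt_top) hu

/-- The H¹ bounds are essential to the argument: `invFourier` is 0 outside L², so additivity is
checked on Fourier transforms only where both are square integrable. -/
theorem partialDeriv_add {u v : Field} (hu : sobolevSq 1 u < ⊤) (hv : sobolevSq 1 v < ⊤)
    (i : Fin 2) : partialDeriv i (u + v) = partialDeriv i u + partialDeriv i v := by
  refine eq_of_fourier_ae ?_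
  filter_upwards [fourier_partialDeriv (sobolevSq_add_lt_top hu hv) i, fourier_partialDeriv hu i,
    fourier_partialDeriv hv i, fourier_add_ae u v,
    fourier_add_ae (partialDeriv i u) (partialDeriv i v)] with ξ h1 h2 h3 h4 h5
  rw [h1, h5, h2, h3, gradHat, h4, smul_add]
  rfl

theorem partialDeriv_smul {u : Field} (hu : sobolevSq 1 u < ⊤) (c : ℝ) (i : Fin 2) :
    partialDeriv i (c • u) = c • partialDeriv i u := by
  refine eq_of_fourier_ae ?_
  filter_upwards [fourier_partialDeriv (sobolevSq_smul_lt_top c hu) i, fourier_partialDeriv hu i,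
    fourier_smul_ae c u, fourier_smul_ae c (partialDeriv i u)] with ξ h1 h2 h3 h4
  rw [h1, h4, h2, gradHat, h3, gradHat, smul_comm]

theorem bilinB_add_of_ae {u v u₁ v₁ u₂ v₂ : Field}
    (h : MemLp (advection u v) 2 (volume : Measure Plane))
    (h₁ : MemLp (advection u₁ v₁) 2 (volume : Measure Plane))
    (h₂ : MemLp (advection u₂ v₂) 2 (volume : Measure Plane))
    (hae : advection u v =ᵐ[volume] fun x => advection u₁ v₁ x + advection u₂ v₂ x) :
    bilinB u v = bilinB u₁ v₁ + bilinB u₂ v₂ := by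
  rw [bilinB_eq h, bilinB_eq h₁, bilinB_eq h₂, ← map_add, ← MemLp.toLp_add]
  exact congrArg _ (MemLp.toLp_congr _ _ hae)

theorem bilinB_smul_of_ae {u v u₁ v₁ : Field} {c : ℝ}
    (h : MemLp (advection u v) 2 (volume : Measure Plane))
    (h₁ : MemLp (advection u₁ v₁) 2 (volume : Measure Plane))
    (hae : advection u v =ᵐ[volume] fun x => c • advection u₁ v₁ x) :
    bilinB u v = c • bilinB u₁ v₁ := by
  rw [bilinB_eq h, bilinB_eq h₁, ← map_smul, ← MemLp.toLp_const_smul]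
  exact congrArg _ (MemLp.toLp_congr _ _ hae)

section Bilinear

variable {α : ℝ} {u u' v v' : Field}

theorem bilinB_add_left (hα : 1 < α) (hu : sobolevSq α u < ⊤) (hu' : sobolevSq α u' < ⊤)
    (hv : sobolevSq (2 * α) v < ⊤) : bilinB (u + u') v = bilinB u v + bilinB u' v := by
  refine bilinB_add_of_ae (memLp_advection hα (sobolevSq_add_lt_top hu hu') hv).1
    (memLp_advection hα hu hv).1 (memLp_advection hα hu' hv).1 ?_
  filter_upwards [Lp.coeFn_add u u'] with x h
  simp only [advection, h, Pi.add_apply, PiLp.add_apply, add_smul, Finset.sum_add_distrib]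

theorem bilinB_smul_left (hα : 1 < α) (hu : sobolevSq α u < ⊤) (hv : sobolevSq (2 * α) v < ⊤)
    (c : ℝ) : bilinB (c • u) v = c • bilinB u v := by
  refine bilinB_smul_of_ae (memLp_advection hα (sobolevSq_smul_lt_top c hu) hv).1
    (memLp_advection hα hu hv).1 ?_
  filter_upwards [Lp.coeFn_smul c u] with x h
  simp only [advection, h, Pi.smul_apply, PiLp.smul_apply, smul_assoc, Finset.smul_sum]

theorem bilinB_add_right (hα : 1 < α) (hu : sobolevSq α u < ⊤) (hv : sobolevSq (2 * α) v < ⊤)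
    (hv' : sobolevSq (2 * α) v' < ⊤) : bilinB u (v + v') = bilinB u v + bilinB u v' := by
  have h1 : ∀ {w}, sobolevSq (2 * α) w < ⊤ → sobolevSq 1 w < ⊤ := fun {w} h =>
    (sobolevSq_mono (by linarith) w).trans_lt h
  refine bilinB_add_of_ae (memLp_advection hα hu (sobolevSq_add_lt_top hv hv')).1
    (memLp_advection hα hu hv).1 (memLp_advection hα hu hv').1 ?_
  filter_upwards [ae_all_iff.2 fun i => Lp.coeFn_add (partialDeriv i v) (partialDeriv i v')]
    with x h
  simp only [advection, partialDeriv_add (h1 hv) (h1 hv'), h, Pi.add_apply, smul_add,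
    Finset.sum_add_distrib]

theorem bilinB_smul_right (hα : 1 < α) (hu : sobolevSq α u < ⊤) (hv : sobolevSq (2 * α) v < ⊤)
    (c : ℝ) : bilinB u (c • v) = c • bilinB u v := by
  refine bilinB_smul_of_ae (memLp_advection hα hu (sobolevSq_smul_lt_top c hv)).1
    (memLp_advection hα hu hv).1 ?_
  filter_upwards [ae_all_iff.2 fun i => Lp.coeFn_smul c (partialDeriv i v)] with x h
  simp only [advection, partialDeriv_smul ((sobolevSq_mono (by linarith) v).trans_lt hv), h,
    Pi.smul_apply, smul_comm _ c, Finset.smul_sum]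

end Bilinear

/-! The cancellation `(B(u, v), v) = 0`. -/

/-- The transform of ∇(|v|²/2) is parallel to ξ, hence orthogonal to û(ξ). In the convolution the
gradient contributes the factor ξ - η; exchanging η and ξ - η turns it into η while v̂(η) · v̂(ξ-η)
stays, and the two contributions add up to ξ · conj û(ξ) = 0. The integral equals its own negative.
-/
theorem inner_bilinGradHat_dotForm {α : ℝ} (hα : 1 < α) {u v : Field} (hu : u ∈ divFree)
    (hv : sobolevSq (2 * α) v < ⊤) :
    ∀ᵐ ξ, inner ℂ (fourier u ξ) (bilinGradHat dotForm v v ξ) = 0 := by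
  have hv' : sobolevSq ((2 * α - 1) + 1) v < ⊤ := by rwa [sub_add_cancel]
  have hg : ∀ i, Integrable (gradHat i v) := integrable_gradHat (by linarith) hv'
  have hf : Integrable (fourier v) := integrable_fourier (r := 2 * α) (by linarith) hv
  have hu' : ∀ᵐ ξ : Plane, ∑ i : Fin 2, ((ξ i : ℝ) : ℂ) * fourier u ξ i = 0 := hu
  filter_upwards [hu', ae_all_iff.2 fun i => hf.ae_convolution_exists (dotForm i) (hg i)]
    with ξ h1 h2
  have h3 : inner ℂ (fourier u ξ) (bilinGradHat dotForm v v ξ) = ∫ η, ∑ i,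
      inner ℂ (fourier u ξ) (dotForm i (fourier v η) (gradHat i v (ξ - η))) := by
    rw [integral_finsetSum _ fun i _ => (h2 i).const_inner (𝕜 := ℂ) (fourier u ξ), bilinGradHat,
      inner_sum]
    exact Finset.sum_congr rfl fun i _ => (integral_inner (h2 i) _).symm
  set φ : Plane → ℂ := fun η => ∑ i,
      inner ℂ (fourier u ξ) (dotForm i (fourier v η) (gradHat i v (ξ - η))) with hφ
  have h4 : ∀ η, φ (ξ - η) = -φ η := by
    intro η
    have h5 : ∑ i : Fin 2, ((ξ i : ℝ) : ℂ) * (starRingEnd ℂ) (fourier u ξ i) = 0 := by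
      have := congrArg (starRingEnd ℂ) h1
      simpa only [map_sum, map_mul, Complex.conj_ofReal, map_zero] using this
    have h6 : ∀ ζ, φ ζ = (∑ j, fourier v ζ j * fourier v (ξ - ζ) j) * (2 * Real.pi * Complex.I)
        * ∑ i, (((ξ i - ζ i : ℝ)) : ℂ) * (starRingEnd ℂ) (fourier u ξ i) := by
      intro ζ
      simp only [hφ, dotForm_apply, gradHat, inner_smul_right, EuclideanSpace.inner_single_right,
        PiLp.smul_apply, PiLp.sub_apply, smul_eq_mul, Fin.sum_univ_two]
      ring
    rw [h6, h6, sub_sub_cancel]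
    simp only [Fin.sum_univ_two, PiLp.sub_apply] at h5 ⊢
    push_cast
    linear_combination (fourier v η 0 * fourier v (ξ - η) 0 + fourier v η 1 * fourier v (ξ - η) 1)
      * (2 * Real.pi * Complex.I) * h5
  have h5 : ∫ η, φ η = -∫ η, φ η := by
    rw [← integral_neg, ← integral_sub_left_eq_self φ volume ξ]
    exact integral_congr_ae (Eventually.of_forall h4)
  rw [h3]
  exact self_eq_neg.1 h5

/-- Since v is divergence-free the projector can be dropped; then the pairing is moved to u ·
∇(|v|²/2) and evaluated by Plancherel, with no integration by parts. -/
theorem inner_bilinB_self {α : ℝ} (hα : 1 < α) {u v : Field} (hu : u ∈ sobolev (2 * α))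
    (hv : v ∈ sobolev (2 * α)) : inner ℝ v (bilinB u v) = 0 := by
  have hus := (mem_sobolev_iff.1 hu).2
  have hvs := (mem_sobolev_iff.1 hv).2
  have hm : ∀ {w}, sobolevSq (2 * α) w < ⊤ → sobolevSq α w < ⊤ := fun {w} h =>
    (sobolevSq_mono (by linarith) w).trans_lt h
  obtain ⟨h, -⟩ := memLp_advection hα (hm hus) hvs
  obtain ⟨hd, hdf⟩ := memLp_of_eq_bilinGrad dotForm hα (hm hvs) hvs (ofRealVec_dotGrad v)
  have h1 : inner ℝ v (h.toLp _) = inner ℝ u (hd.toLp _) := by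
    rw [L2.inner_def, L2.inner_def]
    refine integral_congr_ae ?_
    filter_upwards [h.coeFn_toLp, hd.coeFn_toLp] with x h2 h3
    rw [h2, h3, inner_advection_self]
  rw [bilinB_eq h, inner_leray hv.1, h1, inner_fourier]
  refine integral_eq_zero_of_ae ?_
  filter_upwards [hdf, inner_bilinGradHat_dotForm hα hu.1 hvs] with ξ h2 h3
  rw [h2, h3]
  rfl

end HyperNS

end

/-! ### Translation between Sobolev spaces and the abstract equation. -/

noncomputable section

namespace HyperNS

open Filter Topology Set

theorem smul_rpow_smul_rpow (ξ : Plane) (a b c : ℝ) (h : a + b = c) (f : CPlane) :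
    symbolA ξ ^ a • symbolA ξ ^ b • f = symbolA ξ ^ c • f := by
  rw [smul_smul, ← Real.rpow_add (symbolA_pos ξ), h]

theorem toHDiv_add {s : ℝ} {u v : Field} (hu : u ∈ sobolev s) (hv : v ∈ sobolev s) :
    toHDiv s (u + v) = toHDiv s u + toHDiv s v := by
  refine HDiv.toField_injective ?_
  rw [map_add, HDiv.toField_toHDiv hu, HDiv.toField_toHDiv hv,
    HDiv.toField_toHDiv (Submodule.add_mem _ hu hv)]

theorem toHDiv_smul {s : ℝ} {u : Field} (c : ℝ) (hu : u ∈ sobolev s) :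
    toHDiv s (c • u) = c • toHDiv s u := by
  refine HDiv.toField_injective ?_
  rw [map_smul, HDiv.toField_toHDiv hu, HDiv.toField_toHDiv (Submodule.smul_mem _ c hu)]

theorem intervalIntegrable_isometry {s : ℝ} (e : divFree ≃ₗᵢ[ℝ] HDiv s) {f : ℝ → divFree} {a b : ℝ}
    (hf : IntervalIntegrable f volume a b) :
    IntervalIntegrable (fun r => e (f r)) volume a b :=
  ⟨(e : divFree ≃L[ℝ] HDiv s).toContinuousLinearMap.integrable_comp hf.1,
    (e : divFree ≃L[ℝ] HDiv s).toContinuousLinearMap.integrable_comp hf.2⟩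

theorem integral_isometry {s : ℝ} (hs : 0 ≤ s) (e : divFree ≃ₗᵢ[ℝ] HDiv s) {f : ℝ → divFree}
    {a b : ℝ} (hf : IntervalIntegrable f volume a b) :
    ∫ r in a..b, e (f r) = e (∫ r in a..b, f r) :=
  haveI := HDiv.completeSpace hs
  (e : divFree ≃L[ℝ] HDiv s).toContinuousLinearMap.intervalIntegral_comp_comm hf

theorem ae_uIoc_of_ae_nonneg {p : ℝ → Prop} (h : ∀ᵐ s : ℝ, 0 ≤ s → p s) (t : ℝ≥0) :
    ∀ᵐ s : ℝ, s ∈ uIoc (0 : ℝ) t → p s := by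
  filter_upwards [h] with s hs hst
  rw [uIoc_of_le t.coe_nonneg] at hst
  exact hs hst.1.le

theorem bddAbove_sq_norm {s : ℝ} (T : ℝ≥0) (f : C(ℝ≥0, HDiv s)) :
    BddAbove (range fun t : Icc (0 : ℝ≥0) T => ‖f t‖ ^ 2) := by
  have h : Continuous fun t : Icc (0 : ℝ≥0) T => ‖f t‖ ^ 2 := by fun_prop
  exact (isCompact_range h).bddAbove

theorem sq_norm_le_supSq {s : ℝ} {T t : ℝ≥0} (ht : t ∈ Icc 0 T) (f : C(ℝ≥0, HDiv s)) :
    ‖f t‖ ^ 2 ≤ supSq T f :=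
  le_ciSup (bddAbove_sq_norm T f) ⟨t, ht⟩

theorem sobolevSq_mid_lt_top {α : ℝ} (u : HDiv (2 * α)) : sobolevSq (2 * α) (HDiv.toField u) < ⊤ :=
  (mem_sobolev_iff.1 u.toField_mem).2

section Translation

variable {α : ℝ} (hα : 1 < α)

/-- The functional calculus of `A^α` for `α > 1`. -/
abbrev stokes : SymbolCalculus divFree := stokesCalculus (α := α) (by linarith)

/-- `A^{α/2} : H^α → H^0`. -/
abbrev lowIso : HDiv α ≃ₗᵢ[ℝ] divFree := HDiv.coord (by linarith)

/-- `A^α : H^{2α} → H^0`. -/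
abbrev midIso : HDiv (2 * α) ≃ₗᵢ[ℝ] divFree := HDiv.coord (by linarith)

/-- `A^{3α/2} : H^{3α} → H^0`. -/
abbrev highIso : HDiv (3 * α) ≃ₗᵢ[ℝ] divFree := HDiv.coord (by linarith)

include hα

theorem fourier_invRoot (u : divFree) :
    fourier ((stokes hα).invRoot u) =ᵐ[volume]
      fun ξ => symbolA ξ ^ (-(α / 2)) • fourier u ξ := by
  filter_upwards [fourier_calcOp (α := α) (by linarith) SymbolCalculus.isBddSymbol_inv_sqrt u] with ξ h
  refine h.trans ?_
  rw [Real.sqrt_eq_rpow, ← Real.rpow_mul (symbolA_pos ξ).le, Real.rpow_neg (symbolA_pos ξ).le]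
  congr 4
  ring

theorem mem_sobolev_low (u : HDiv (2 * α)) : HDiv.toField u ∈ sobolev α :=
  sobolev_mono (by linarith) u.toField_mem

theorem sobolevSq_low_lt_top (u : HDiv (2 * α)) : sobolevSq α (HDiv.toField u) < ⊤ :=
  (mem_sobolev_iff.1 (mem_sobolev_low hα u)).2

/-- A^{α/2} = A^{-α/2}A^α: each `invRoot` descends one step of length α on the Sobolev scale. -/
theorem lowIso_toHDiv (u : HDiv (2 * α)) :
    lowIso hα (toHDiv α (HDiv.toField u)) = (stokes hα).invRoot (midIso hα u) := by
  refine divFree_ext ?_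
  filter_upwards [HDiv.coord_toHDiv (s := α) (by linarith) (mem_sobolev_low hα u),
    fourier_invRoot hα (midIso hα u), HDiv.fourier_coord (s := 2 * α) (by linarith) u]
    with ξ h1 h2 h3
  rw [h1, h2, h3, smul_rpow_smul_rpow ξ _ _ (α / 2) (by ring)]

theorem invRoot_highIso {u : Field} (hu : u ∈ sobolev (2 * α)) (hu' : u ∈ sobolev (3 * α)) :
    (stokes hα).invRoot (highIso hα (toHDiv (3 * α) u)) = midIso hα (toHDiv (2 * α) u) := by
  refine divFree_ext ?_
  filter_upwards [HDiv.coord_toHDiv (s := 2 * α) (by linarith) hu,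
    fourier_invRoot hα (highIso hα (toHDiv (3 * α) u)),
    HDiv.coord_toHDiv (s := 3 * α) (by linarith) hu'] with ξ h1 h2 h3
  rw [h1, h2, h3, smul_rpow_smul_rpow ξ _ _ (2 * α / 2) (by ring)]

/-- An element of `H^{2α}` whose coordinate is in the range of `A^{-α/2}` belongs to `H^{3α}`. -/
theorem toField_eq_of_invRoot {u : HDiv (2 * α)} {y : divFree}
    (h : (stokes hα).invRoot y = midIso hα u) :
    HDiv.toField u = HDiv.toField ((highIso hα).symm y) := by
  have e : u = (midIso hα).symm ((stokes hα).invRoot y) := by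
    rw [h, LinearIsometryEquiv.symm_apply_apply]
  rw [e]
  refine eq_of_fourier_ae ?_
  filter_upwards [HDiv.fourier_coord_symm (s := 2 * α) (by linarith) ((stokes hα).invRoot y),
    fourier_invRoot hα y, HDiv.fourier_coord_symm (s := 3 * α) (by linarith) y] with ξ h1 h2 h3
  rw [h1, h2, h3, smul_rpow_smul_rpow ξ _ _ (-(3 * α / 2)) (by ring)]

theorem stokesPow_eq {u : Field} (hu : u ∈ sobolev (3 * α)) :
    MemLp (fun ξ => (symbolA ξ ^ α) • fourier u ξ) 2 (volume : Measure Plane) ∧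
    stokesPow α u = HDiv.toField ((lowIso hα).symm (highIso hα (toHDiv (3 * α) u))) := by
  have h : fourier (HDiv.toField ((lowIso hα).symm (highIso hα (toHDiv (3 * α) u)))) =ᵐ[volume]
      fun ξ => (symbolA ξ ^ α) • fourier u ξ := by
    filter_upwards [HDiv.fourier_coord_symm (s := α) (by linarith)
      (highIso hα (toHDiv (3 * α) u)), HDiv.coord_toHDiv (s := 3 * α) (by linarith) hu]
      with ξ h1 h2
    rw [h1, h2, smul_rpow_smul_rpow ξ _ _ α (by ring)]
  have hm := (memLp_congr_ae h).1 (Lp.memLp _)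
  exact ⟨hm, eq_of_fourier_ae ((fourier_radial (ψ := fun x => x ^ α) hm).trans h.symm)⟩

variable {ν : ℝ}

theorem fourier_semigroup (hν : 0 < ν) {t : ℝ} (ht : 0 ≤ t) (u : Field) :
    fourier (semigroup ν α t u) =ᵐ[volume]
      fun ξ => Real.exp (-(ν * t * symbolA ξ ^ α)) • fourier u ξ :=
  fourier_radial (ψ := fun x => Real.exp (-(ν * t * x ^ α))) (memLp_radial
    ((SymbolCalculus.isBddSymbol_exp hν ht).comp_rpow (α := α) (by linarith)) u)

theorem semigroup_mid (hν : 0 < ν) {t : ℝ} (ht : 0 ≤ t) (x : HDiv (2 * α)) :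
    semigroup ν α t (HDiv.toField x)
      = HDiv.toField ((midIso hα).symm ((stokes hα).semi ν t (midIso hα x))) := by
  refine eq_of_fourier_ae ?_
  filter_upwards [fourier_semigroup hα hν ht (HDiv.toField x),
    HDiv.fourier_coord_symm (s := 2 * α) (by linarith) ((stokes hα).semi ν t (midIso hα x)),
    fourier_calcOp (α := α) (by linarith) (SymbolCalculus.isBddSymbol_exp hν ht) (midIso hα x),
    HDiv.fourier_coord (s := 2 * α) (by linarith) x] with ξ h1 h2 h3 h4
  rw [h1, h2]
  refine Eq.trans ?_ (congrArg (symbolA ξ ^ (-(2 * α / 2)) • ·) h3.symm)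
  simp only [h4]
  rw [smul_comm (Real.exp _), smul_rpow_smul_rpow ξ _ _ 0 (by ring), Real.rpow_zero, one_smul]

/-- Smoothing from H^α to H^{2α}: A^α e^{-νtA^α} b is A^{α/2} e^{-νtA^α} applied to A^{α/2} b.
Positivity of t keeps the symbol of `kern` bounded. -/
theorem semigroup_low (hν : 0 < ν) {t : ℝ} (ht : 0 < t) {b : Field} (hb : b ∈ sobolev α) :
    semigroup ν α t b
      = HDiv.toField ((midIso hα).symm ((stokes hα).kern ν t (lowIso hα (toHDiv α b)))) := by
  refine eq_of_fourier_ae ?_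
  filter_upwards [fourier_semigroup hα hν ht.le b,
    HDiv.fourier_coord_symm (s := 2 * α) (by linarith)
      ((stokes hα).kern ν t (lowIso hα (toHDiv α b))),
    fourier_calcOp (α := α) (by linarith) (SymbolCalculus.isBddSymbol_kern hν ht)
      (lowIso hα (toHDiv α b)),
    HDiv.coord_toHDiv (s := α) (by linarith) hb] with ξ h1 h2 h3 h4
  rw [h1, h2]
  refine Eq.trans ?_ (congrArg (symbolA ξ ^ (-(2 * α / 2)) • ·) h3.symm)
  simp only [h4]
  rw [Real.sqrt_eq_rpow, ← Real.rpow_mul (symbolA_pos ξ).le, mul_comm (_ ^ _) (Real.exp _),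
    mul_smul, smul_rpow_smul_rpow ξ _ _ α (by ring), smul_comm (_ ^ _) (Real.exp _),
    smul_rpow_smul_rpow ξ _ _ 0 (by ring), Real.rpow_zero, one_smul]

theorem norm_toHDiv_bilinB_le : ∃ K : ℝ, 0 ≤ K ∧ ∀ u v : HDiv (2 * α),
    ‖toHDiv α (bilinB (HDiv.toField u) (HDiv.toField v))‖
      ≤ K * ‖(stokes hα).invRoot (midIso hα u)‖ * ‖v‖ := by
  obtain ⟨K, hK⟩ := sobolevSq_bilinB_le hα
  refine ⟨√K, Real.sqrt_nonneg _, fun u v => ?_⟩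
  have hu := sobolevSq_low_lt_top hα u
  have hv := sobolevSq_mid_lt_top v
  have hm := bilinB_mem hα hu hv
  have h := hK _ _ hu hv
  have e1 := sobolevSq_toField (toHDiv α (bilinB (HDiv.toField u) (HDiv.toField v)))
  have e2 := sobolevSq_toField (toHDiv α (HDiv.toField u))
  rw [HDiv.toField_toHDiv hm] at e1
  rw [HDiv.toField_toHDiv (mem_sobolev_low hα u), ← (lowIso hα).norm_map, lowIso_toHDiv] at e2
  rw [e1, e2, sobolevSq_toField, ← ENNReal.ofReal_mul (by positivity),
    ← ENNReal.ofReal_coe_nnreal, ← ENNReal.ofReal_mul (by positivity),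
    ENNReal.ofReal_le_ofReal_iff (by positivity)] at h
  refine (pow_le_pow_iff_left₀ (norm_nonneg _) (by positivity) two_ne_zero).1 ?_
  rw [mul_pow, mul_pow, Real.sq_sqrt (by positivity)]
  linarith

/-- The bilinear operator `B` in the coordinates `A^α : H^{2α} → H^0` and `A^{α/2} : H^α → H^0`. -/
def bilinFun (f g : divFree) : divFree := lowIso hα (toHDiv α (bilinB
    (HDiv.toField ((midIso hα).symm f)) (HDiv.toField ((midIso hα).symm g))))

theorem bilinFun_add_left (f f' g : divFree) :
    bilinFun hα (f + f') g = bilinFun hα f g + bilinFun hα f' g := by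
  have h := sobolevSq_low_lt_top hα ((midIso hα).symm f)
  have h' := sobolevSq_low_lt_top hα ((midIso hα).symm f')
  have hg := sobolevSq_mid_lt_top ((midIso hα).symm g)
  rw [bilinFun, map_add, map_add, bilinB_add_left hα h h' hg,
    toHDiv_add (bilinB_mem hα h hg) (bilinB_mem hα h' hg), map_add]
  rfl

theorem bilinFun_smul_left (c : ℝ) (f g : divFree) :
    bilinFun hα (c • f) g = c • bilinFun hα f g := by
  have h := sobolevSq_low_lt_top hα ((midIso hα).symm f)
  have hg := sobolevSq_mid_lt_top ((midIso hα).symm g)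
  rw [bilinFun, map_smul, map_smul, bilinB_smul_left hα h hg, toHDiv_smul _ (bilinB_mem hα h hg),
    map_smul]
  rfl

theorem bilinFun_add_right (f g g' : divFree) :
    bilinFun hα f (g + g') = bilinFun hα f g + bilinFun hα f g' := by
  have h := sobolevSq_low_lt_top hα ((midIso hα).symm f)
  have hg := sobolevSq_mid_lt_top ((midIso hα).symm g)
  have hg' := sobolevSq_mid_lt_top ((midIso hα).symm g')
  rw [bilinFun, map_add, map_add, bilinB_add_right hα h hg hg',
    toHDiv_add (bilinB_mem hα h hg) (bilinB_mem hα h hg'), map_add]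
  rfl

theorem bilinFun_smul_right (c : ℝ) (f g : divFree) :
    bilinFun hα f (c • g) = c • bilinFun hα f g := by
  have h := sobolevSq_low_lt_top hα ((midIso hα).symm f)
  have hg := sobolevSq_mid_lt_top ((midIso hα).symm g)
  rw [bilinFun, map_smul, map_smul, bilinB_smul_right hα h hg, toHDiv_smul _ (bilinB_mem hα h hg),
    map_smul]
  rfl

theorem norm_bilinFun_le : ∃ K : ℝ, 0 ≤ K ∧ ∀ f g : divFree,
    ‖bilinFun hα f g‖ ≤ K * ‖(stokes hα).invRoot f‖ * ‖g‖ := by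
  obtain ⟨K, hK0, hK⟩ := norm_toHDiv_bilinB_le hα
  refine ⟨K, hK0, fun f g => ?_⟩
  rw [bilinFun, LinearIsometryEquiv.norm_map]
  refine (hK _ _).trans_eq ?_
  rw [LinearIsometryEquiv.norm_map, LinearIsometryEquiv.apply_symm_apply]

/-- `bilinFun` as a bounded bilinear map. -/
def bilinOp : divFree →L[ℝ] divFree →L[ℝ] divFree :=
  LinearMap.mkContinuousOfExistsBound₂
    (LinearMap.mk₂ ℝ (bilinFun hα) (bilinFun_add_left hα) (bilinFun_smul_left hα)
      (bilinFun_add_right hα) (bilinFun_smul_right hα))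
    (by
      obtain ⟨K, hK0, hK⟩ := norm_bilinFun_le hα
      refine ⟨K, fun f g => (hK f g).trans ?_⟩
      gcongr
      exact (stokes hα).norm_invRoot_le f)

theorem bilinOp_apply (f g : divFree) : bilinOp hα f g = lowIso hα (toHDiv α (bilinB
    (HDiv.toField ((midIso hα).symm f)) (HDiv.toField ((midIso hα).symm g)))) := rfl

theorem norm_bilinOp_le : ∃ K : ℝ, 0 ≤ K ∧ ∀ f g : divFree,
    ‖bilinOp hα f g‖ ≤ K * ‖(stokes hα).invRoot f‖ * ‖g‖ := norm_bilinFun_le hα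

/-- With g = A^α v the left vector is A^{-α/2} v, and the right one is A^{α/2} B(u, v); the powers
cancel and leave the L² pairing of v with B(u, v). -/
theorem inner_bilinOp (f g : divFree) : inner ℝ
    ((stokes hα).invRoot ((stokes hα).invRoot ((stokes hα).invRoot g))) (bilinOp hα f g) = 0 := by
  set u := (midIso hα).symm f
  set v := (midIso hα).symm g with hv
  have hm := bilinB_mem hα (sobolevSq_low_lt_top hα u) (sobolevSq_mid_lt_top v)
  rw [← inner_bilinB_self hα u.toField_mem v.toField_mem]
  show inner ℝ ((stokes hα).invRoot ((stokes hα).invRoot ((stokes hα).invRoot g)) : Field)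
    (bilinOp hα f g : Field) = _
  rw [inner_fourier, inner_fourier]
  refine integral_congr_ae ?_
  filter_upwards [fourier_invRoot hα g, fourier_invRoot hα ((stokes hα).invRoot g),
    fourier_invRoot hα ((stokes hα).invRoot ((stokes hα).invRoot g)),
    HDiv.coord_toHDiv (s := α) (by linarith) hm,
    HDiv.fourier_coord_symm (s := 2 * α) (by linarith) g] with ξ h1 h2 h3 h4 h5
  rw [h3, h2, h1, bilinOp_apply, h4, h5, smul_rpow_smul_rpow ξ _ _ _ rfl,
    smul_rpow_smul_rpow ξ _ _ _ rfl]
  simp only [← Complex.coe_smul, inner_smul_left, inner_smul_right, Complex.conj_ofReal]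
  rw [← mul_assoc, ← Complex.ofReal_mul, ← Real.rpow_add (symbolA_pos ξ)]
  congr 4
  ring

/-! Curves. -/

/-- A curve in `H^{2α}`, in the coordinate `A^α`. -/
def midCurve (v : C(ℝ≥0, HDiv (2 * α))) : C(ℝ≥0, divFree) :=
  ⟨fun t => midIso hα (v t), (midIso hα).continuous.comp v.continuous⟩

theorem midCurve_apply (v : C(ℝ≥0, HDiv (2 * α))) (t : ℝ≥0) :
    midCurve hα v t = midIso hα (v t) := rfl

theorem midCurve_injective : Function.Injective (midCurve hα) := fun v w h => by
  ext1 t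
  exact (midIso hα).injective (congrArg (fun f : C(ℝ≥0, divFree) => f t) h)

theorem midCurve_surjective : Function.Surjective (midCurve hα) := fun w =>
  ⟨⟨fun t => (midIso hα).symm (w t), (midIso hα).symm.continuous.comp w.continuous⟩, by
    ext1 t
    simp [midCurve_apply]⟩

/-- The nonlinearity in the coordinate `A^{α/2}`. -/
def nonlinCurve (z v : C(ℝ≥0, HDiv (2 * α))) (s : ℝ) : divFree :=
  bilinOp hα (midCurve hα v s.toNNReal + midCurve hα z s.toNNReal)
    (midCurve hα v s.toNNReal + midCurve hα z s.toNNReal)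

theorem continuous_nonlinCurve (z v : C(ℝ≥0, HDiv (2 * α))) : Continuous (nonlinCurve hα z v) :=
  SymbolCalculus.continuous_nonlinearity (bilinOp hα) (midCurve hα z) (midCurve hα v)

variable (z v : C(ℝ≥0, HDiv (2 * α)))

theorem memLp_nonlinTerm (s : ℝ) : MemLp (advection (v s.toNNReal + z s.toNNReal : HDiv (2 * α))
    (v s.toNNReal + z s.toNNReal : HDiv (2 * α))) 2 (volume : Measure Plane) :=
  (memLp_advection hα (sobolevSq_low_lt_top hα _) (sobolevSq_mid_lt_top _)).1

theorem nonlinTerm_mem (s : ℝ) : nonlinTerm z v s ∈ sobolev α :=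
  bilinB_mem hα (sobolevSq_low_lt_top hα _) (sobolevSq_mid_lt_top _)

theorem toHDiv_nonlinTerm (s : ℝ) :
    toHDiv α (nonlinTerm z v s) = (lowIso hα).symm (nonlinCurve hα z v s) := by
  rw [nonlinCurve, midCurve_apply, midCurve_apply, ← map_add, bilinOp_apply,
    LinearIsometryEquiv.symm_apply_apply, LinearIsometryEquiv.symm_apply_apply]
  rfl

theorem semigroup_nonlinTerm (hν : 0 < ν) {s t : ℝ} (hst : s < t) :
    semigroup ν α (t - s) (nonlinTerm z v s) = HDiv.toField ((midIso hα).symm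
      ((stokes hα).kern ν (t - s) (nonlinCurve hα z v s))) := by
  rw [semigroup_low hα hν (sub_pos.2 hst) (nonlinTerm_mem hα z v s), toHDiv_nonlinTerm hα,
    LinearIsometryEquiv.apply_symm_apply]

/-- Only s = t has to be excluded: there the semigroup does not smooth, and the nonlinear term is
only known to lie in H^α. -/
theorem toHDiv_semigroup_ae (hν : 0 < ν) (t : ℝ≥0) :
    ∀ᵐ s : ℝ, s ∈ uIoc (0 : ℝ) t →
      toHDiv (2 * α) (semigroup ν α (t - s) (nonlinTerm z v s))
        = (midIso hα).symm ((stokes hα).kern ν (t - s) (nonlinCurve hα z v s)) := by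
  filter_upwards [Measure.ae_ne volume (t : ℝ)] with s hs h
  rw [uIoc_of_le t.coe_nonneg] at h
  rw [semigroup_nonlinTerm hα z v hν (lt_of_le_of_ne h.2 hs), HDiv.toHDiv_toField]

theorem intervalIntegrable_mild (hν : 0 < ν) (t : ℝ≥0) : IntervalIntegrable
    (fun s => (stokes hα).kern ν (t - s) (nonlinCurve hα z v s)) volume 0 t :=
  (stokes hα).intervalIntegrable_kern hν (continuous_nonlinCurve hα z v) t.2

theorem mildTermsWellDefined (hν : 0 < ν) (x : HDiv (2 * α)) :
    MildTermsWellDefined ν α x z v := by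
  refine fun t => ⟨?_, fun s _ hst => ?_, ?_⟩
  · rw [semigroup_mid hα hν t.coe_nonneg]
    exact HDiv.toField_mem _
  · rw [semigroup_nonlinTerm hα z v hν hst]
    exact HDiv.toField_mem _
  · refine (intervalIntegrable_isometry (midIso hα).symm
      (intervalIntegrable_mild hα z v hν t)).congr_ae ?_
    rw [EventuallyEq, ae_restrict_iff' measurableSet_uIoc]
    filter_upwards [toHDiv_semigroup_ae hα z v hν t] with s hs h
    exact (hs h).symm

theorem solvesMild_iff (hν : 0 < ν) (x : HDiv (2 * α)) : SolvesMild ν α x z v ↔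
    (stokes hα).IsMild ν (bilinOp hα) (midIso hα x) (midCurve hα z) (midCurve hα v) := by
  refine forall_congr' fun t => ?_
  rw [intervalIntegral.integral_congr_ae (toHDiv_semigroup_ae hα z v hν t),
    integral_isometry (by linarith) _ (intervalIntegrable_mild hα z v hν t),
    semigroup_mid hα hν t.coe_nonneg, HDiv.toHDiv_toField, ← eq_sub_iff_add_eq, ← map_sub,
    LinearIsometryEquiv.eq_symm_apply]
  rfl

variable {v}

/-- The curve `A^{3α/2} v`. -/
def highCurve (v : C(ℝ≥0, HDiv (2 * α))) (s : ℝ) : divFree :=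
  highIso hα (toHDiv (3 * α) (HDiv.toField (v s.toNNReal)))

theorem InClass.memLp_highCurve (hv : InClass α v) {T : ℝ} (hT : 0 ≤ T) :
    MemLp (highCurve hα v) 2 (volume.restrict (Ioc 0 T)) := by
  -- The class is defined through positive times; T + 1 includes the case T = 0.
  have h := hv.2 (T + 1) (by linarith)
  refine (highIso hα : HDiv (3 * α) ≃L[ℝ] divFree).toContinuousLinearMap.comp_memLp'
    (h.mono_measure (Measure.restrict_mono (Ioc_subset_Ioc_right ?_) le_rfl))
  linarith

theorem InClass.intervalIntegrable_highCurve (hv : InClass α v) {t : ℝ} (ht : 0 ≤ t) :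
    IntervalIntegrable (highCurve hα v) volume 0 t := by
  rw [intervalIntegrable_iff_integrableOn_Ioc_of_le ht]
  exact (hv.memLp_highCurve hα ht).integrable (by norm_num)

theorem InClass.invRoot_highCurve (hv : InClass α v) :
    ∀ᵐ s : ℝ, 0 ≤ s → (stokes hα).invRoot (highCurve hα v s) = midCurve hα v s.toNNReal := by
  filter_upwards [hv.1] with s hs h
  rw [highCurve, invRoot_highIso hα (HDiv.toField_mem _) (hs h), HDiv.toHDiv_toField]
  rfl

theorem InClass.toHDiv_stokesPow (hv : InClass α v) : ∀ᵐ s : ℝ, 0 ≤ s →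
    toHDiv α (stokesPow α (v s.toNNReal)) = (lowIso hα).symm (highCurve hα v s) := by
  filter_upwards [hv.1] with s hs h
  rw [(stokesPow_eq hα (hs h)).2, HDiv.toHDiv_toField]
  rfl

theorem strongTermsWellDefined (hv : InClass α v) : StrongTermsWellDefined α z v := by
  refine ⟨fun t => mem_sobolev_low hα _, ?_, fun s _ => ⟨memLp_nonlinTerm hα z v s,
    nonlinTerm_mem hα z v s⟩, fun t => ⟨?_, ?_⟩⟩
  · filter_upwards [hv.1] with s hs h
    obtain ⟨h1, h2⟩ := stokesPow_eq hα (hs h)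
    refine ⟨h1, ?_⟩
    rw [h2]
    exact HDiv.toField_mem _
  · refine (intervalIntegrable_isometry (lowIso hα).symm
      (hv.intervalIntegrable_highCurve hα t.2)).congr_ae ?_
    rw [EventuallyEq, ae_restrict_iff' measurableSet_uIoc]
    filter_upwards [ae_uIoc_of_ae_nonneg (hv.toHDiv_stokesPow hα) t] with s hs h
    exact (hs h).symm
  · simp only [toHDiv_nonlinTerm hα]
    exact intervalIntegrable_isometry (lowIso hα).symm
      ((continuous_nonlinCurve hα z v).intervalIntegrable _ _)

theorem solvesStrong_iff (hv : InClass α v) (x : HDiv (2 * α)) : SolvesStrong ν α x z v ↔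
    ∀ t : ℝ, 0 ≤ t → (stokes hα).invRoot (midCurve hα v t.toNNReal)
      + ν • (∫ s in (0 : ℝ)..t, highCurve hα v s) + ∫ s in (0 : ℝ)..t, nonlinCurve hα z v s
        = (stokes hα).invRoot (midIso hα x) := by
  have h1 : ∀ u : HDiv (2 * α), toHDiv α (HDiv.toField u)
      = (lowIso hα).symm ((stokes hα).invRoot (midIso hα u)) := fun u => by
    rw [← lowIso_toHDiv, LinearIsometryEquiv.symm_apply_apply]
  have hα0 : 0 ≤ α := by linarith
  have h2 : ∀ t : ℝ≥0, (toHDiv α (v t) + ν • (∫ s in (0 : ℝ)..t, toHDiv α (stokesPow α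
      (v s.toNNReal))) + ∫ s in (0 : ℝ)..t, toHDiv α (nonlinTerm z v s) = toHDiv α x) ↔
      (stokes hα).invRoot (midCurve hα v t) + ν • (∫ s in (0 : ℝ)..t, highCurve hα v s)
        + ∫ s in (0 : ℝ)..t, nonlinCurve hα z v s = (stokes hα).invRoot (midIso hα x) := by
    intro t
    rw [intervalIntegral.integral_congr_ae
      (ae_uIoc_of_ae_nonneg (hv.toHDiv_stokesPow hα) t)]
    simp only [toHDiv_nonlinTerm hα]
    rw [integral_isometry hα0 (lowIso hα).symm (hv.intervalIntegrable_highCurve hα t.coe_nonneg),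
      integral_isometry hα0 (lowIso hα).symm ((continuous_nonlinCurve hα z v).intervalIntegrable _ _), h1, h1,
      ← map_smul, ← map_add, ← map_add, (lowIso hα).symm.injective.eq_iff]
    rfl
  refine (forall_congr' h2).trans ⟨fun h t ht => ?_, fun h t => ?_⟩
  · have := h t.toNNReal
    rwa [Real.coe_toNNReal t ht] at this
  · have := h t t.2
    rwa [Real.toNNReal_coe] at this

theorem solvesMild_iff_solvesStrong (hν : 0 < ν) (hv : InClass α v) (x : HDiv (2 * α)) :
    SolvesMild ν α x z v ↔ SolvesStrong ν α x z v := by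
  rw [solvesMild_iff hα z v hν, solvesStrong_iff hα z hv,
    (stokes hα).strong_iff_mild hν (continuous_nonlinCurve hα z v) (midIso hα x)
      (SymbolCalculus.continuous_curve (midCurve hα v)) (hv.invRoot_highCurve hα)
      (fun t ht => hv.intervalIntegrable_highCurve hα ht)]
  refine ⟨fun h t ht => h.apply ht, fun h t => ?_⟩
  have := h t t.2
  rwa [Real.toNNReal_coe] at this

/-- Parabolic regularity: the nonlinear term is continuous in H^α, so the mild formula itself yields
L²_loc(H^{3α}). The class condition is therefore automatic for mild solutions. -/
theorem SolvesMild.inClass (hν : 0 < ν) {x : HDiv (2 * α)} (h : SolvesMild ν α x z v) :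
    InClass α v := by
  rw [solvesMild_iff hα z v hν] at h
  obtain ⟨Y, hY, hYT⟩ := (stokes hα).exists_root_mild hν (continuous_nonlinCurve hα z v)
    (midIso hα x)
  have h1 : ∀ᵐ s : ℝ, 0 ≤ s → HDiv.toField (v s.toNNReal)
      = HDiv.toField ((highIso hα).symm (Y s)) := by
    filter_upwards [hY] with s hs h0
    exact toField_eq_of_invRoot hα ((hs h0).trans (h.apply h0).symm)
  refine ⟨?_, fun T hT => ?_⟩
  · filter_upwards [h1] with s hs h0
    rw [hs h0]
    exact HDiv.toField_mem _
  · have h2 := ((highIso hα).symm : divFree ≃L[ℝ] HDiv (3 * α)).toContinuousLinearMap.comp_memLp'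
      (hYT T hT.le).1
    refine (memLp_congr_ae ?_).1 h2
    rw [EventuallyEq, ae_restrict_iff' measurableSet_Ioc]
    filter_upwards [h1] with s hs h0
    rw [hs h0.1.le, HDiv.toHDiv_toField]
    rfl

theorem InClass.sub {v₁ v₂ : C(ℝ≥0, HDiv (2 * α))} (h₁ : InClass α v₁) (h₂ : InClass α v₂) :
    ∀ᵐ s : ℝ, 0 ≤ s → (stokes hα).invRoot (highCurve hα (v₁ - v₂) s)
      = midCurve hα v₁ s.toNNReal - midCurve hα v₂ s.toNNReal := by
  filter_upwards [h₁.1, h₂.1] with s hs₁ hs₂ h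
  have h3 : HDiv.toField ((v₁ - v₂) s.toNNReal) ∈ sobolev (3 * α) := by
    rw [ContinuousMap.sub_apply, map_sub]
    exact Submodule.sub_mem _ (hs₁ h) (hs₂ h)
  rw [highCurve, invRoot_highIso hα (HDiv.toField_mem _) h3, HDiv.toHDiv_toField,
    ContinuousMap.sub_apply, map_sub]
  rfl

theorem existsUnique_solvesMild (hν : 0 < ν) (x : HDiv (2 * α)) : ∃! v, SolvesMild ν α x z v := by
  obtain ⟨K, hK0, hK⟩ := norm_bilinOp_le hα
  obtain ⟨w, hw⟩ := (stokes hα).exists_isMild hν hK0 hK (inner_bilinOp hα) (midIso hα x)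
    (midCurve hα z)
  obtain ⟨v, rfl⟩ := midCurve_surjective hα w
  refine ⟨v, (solvesMild_iff hα z v hν x).2 hw, fun v' hv' => midCurve_injective hα ?_⟩
  exact (stokes hα).isMild_unique hν hK0 hK ((solvesMild_iff hα z v' hν x).1 hv') hw

theorem solvesMild_zero (hν : 0 < ν) : SolvesMild ν α 0 0 (0 : C(ℝ≥0, HDiv (2 * α))) := by
  rw [solvesMild_iff hα 0 0 hν]
  intro t
  simp [midCurve_apply, SymbolCalculus.mild]

theorem solvesMild_lipschitz (hν : 0 < ν) (T : ℝ≥0) (R : ℝ) : ∃ C : ℝ, 0 < C ∧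
    ∀ (x₁ x₂ : HDiv (2 * α)) (z₁ z₂ v₁ v₂ : C(ℝ≥0, HDiv (2 * α))),
      SolvesMild ν α x₁ z₁ v₁ → SolvesMild ν α x₂ z₂ v₂ → ‖x₁‖ ≤ R → ‖x₂‖ ≤ R →
      (∀ t ∈ Set.Icc 0 T, ‖z₁ t‖ ≤ R) → (∀ t ∈ Set.Icc 0 T, ‖z₂ t‖ ≤ R) →
      supSq T (v₁ - v₂) + intSq (3 * α) T (v₁ - v₂)
        ≤ C * (‖x₁ - x₂‖ ^ 2 + supSq T (z₁ - z₂)) := by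
  obtain ⟨K, hK0, hK⟩ := norm_bilinOp_le hα
  obtain ⟨c, hc, H⟩ := (stokes hα).isMild_lipschitz hν hK0 hK (inner_bilinOp hα) T R T.2
  -- One c for the supremum and one for the integral; δ below is the square root of `supSq T (z₁ -
  -- z₂)`.
  refine ⟨2 * c, by positivity, fun x₁ x₂ z₁ z₂ v₁ v₂ h₁ h₂ hx₁ hx₂ hz₁ hz₂ => ?_⟩
  have hmem : ∀ t ∈ Icc (0 : ℝ) T, t.toNNReal ∈ Icc 0 T := fun t ht =>
    ⟨zero_le, Real.toNNReal_le_iff_le_coe.2 ht.2⟩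
  have hsup : 0 ≤ supSq T (z₁ - z₂) := Real.iSup_nonneg fun t => by positivity
  have hnorm : ∀ (p q : C(ℝ≥0, HDiv (2 * α))) (t : ℝ≥0),
      ‖midCurve hα p t - midCurve hα q t‖ = ‖(p - q) t‖ := fun p q t => by
    rw [midCurve_apply, midCurve_apply, ← map_sub, LinearIsometryEquiv.norm_map]
    rfl
  obtain ⟨H1, H2⟩ := H (midIso hα x₁) (midIso hα x₂) (midCurve hα z₁) (midCurve hα z₂)
    (midCurve hα v₁) (midCurve hα v₂) (highCurve hα (v₁ - v₂)) (√(supSq T (z₁ - z₂)))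
    (Real.sqrt_nonneg _) ((solvesMild_iff hα _ _ hν _).1 h₁) ((solvesMild_iff hα _ _ hν _).1 h₂)
    (by rwa [LinearIsometryEquiv.norm_map]) (by rwa [LinearIsometryEquiv.norm_map])
    (fun t ht => by
      rw [midCurve_apply, LinearIsometryEquiv.norm_map]; exact hz₁ _ (hmem t ht))
    (fun t ht => by
      rw [midCurve_apply, LinearIsometryEquiv.norm_map]; exact hz₂ _ (hmem t ht))
    (fun t ht => by
      rw [hnorm]
      exact Real.le_sqrt_of_sq_le (sq_norm_le_supSq (hmem t ht) _))
    (InClass.sub hα (h₁.inClass hα _ hν) (h₂.inClass hα _ hν))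
  rw [Real.sq_sqrt hsup, ← map_sub, LinearIsometryEquiv.norm_map] at H1 H2
  have h3 : supSq T (v₁ - v₂) ≤ c * (‖x₁ - x₂‖ ^ 2 + supSq T (z₁ - z₂)) := by
    have : Nonempty (Icc (0 : ℝ≥0) T) := ⟨⟨0, le_rfl, zero_le⟩⟩
    refine ciSup_le fun t => ?_
    have := H1 (t : ℝ≥0) ⟨NNReal.coe_nonneg _, NNReal.coe_le_coe.2 t.2.2⟩
    rwa [hnorm, Real.toNNReal_coe] at this
  have h4 : intSq (3 * α) T (v₁ - v₂) = ∫ s in (0 : ℝ)..T, ‖highCurve hα (v₁ - v₂) s‖ ^ 2 := by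
    simp only [intSq, highCurve, LinearIsometryEquiv.norm_map]
  rw [h4]
  linarith

end Translation

end HyperNS

end

/-! ### Assembly of the theorem. -/

open HyperNS in
theorem mainTheorem8 (ν α : ℝ) (hν : 0 < ν) (hα : 1 < α) :
    (∀ (x : HDiv (2 * α)) (z v : C(ℝ≥0, HDiv (2 * α))), InClass α v →
      StrongTermsWellDefined α z v ∧ MildTermsWellDefined ν α x z v ∧
      (SolvesMild ν α x z v ↔ SolvesStrong ν α x z v)) ∧
    (∀ (x : HDiv (2 * α)) (z : C(ℝ≥0, HDiv (2 * α))),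
      (∃! v : C(ℝ≥0, HDiv (2 * α)), InClass α v ∧ SolvesMild ν α x z v) ∧
      (∃! v : C(ℝ≥0, HDiv (2 * α)), InClass α v ∧ SolvesStrong ν α x z v)) ∧
    ∃ V : HDiv (2 * α) × C(ℝ≥0, HDiv (2 * α)) → C(ℝ≥0, HDiv (2 * α)),
      (∀ x z, InClass α (V (x, z)) ∧ SolvesMild ν α x z (V (x, z)) ∧
        SolvesStrong ν α x z (V (x, z))) ∧
      V (0, 0) = 0 ∧
      ∀ (T : ℝ≥0) (R : ℝ), 0 < T → 0 < R → ∃ C : ℝ, 0 < C ∧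
        ∀ (x₁ x₂ : HDiv (2 * α)) (z₁ z₂ : C(ℝ≥0, HDiv (2 * α))),
          ‖x₁‖ ≤ R → ‖x₂‖ ≤ R →
          (∀ t ∈ Set.Icc 0 T, ‖z₁ t‖ ≤ R) → (∀ t ∈ Set.Icc 0 T, ‖z₂ t‖ ≤ R) →
          supSq T (V (x₁, z₁) - V (x₂, z₂)) + intSq (3 * α) T (V (x₁, z₁) - V (x₂, z₂))
            ≤ C * (‖x₁ - x₂‖ ^ 2 + supSq T (z₁ - z₂)) := by
  refine ⟨fun x z v hv => ⟨strongTermsWellDefined hα z hv, mildTermsWellDefined hα z v hν x,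
    solvesMild_iff_solvesStrong hα z hν hv x⟩, fun x z => ?_, ?_⟩
  · obtain ⟨v, hv, huniq⟩ := existsUnique_solvesMild hα z hν x
    have hc := hv.inClass hα z hν
    refine ⟨⟨v, ⟨hc, hv⟩, fun v' h => huniq v' h.2⟩,
      ⟨v, ⟨hc, (solvesMild_iff_solvesStrong hα z hν hc x).1 hv⟩, fun v' h => huniq v' ?_⟩⟩
    exact (solvesMild_iff_solvesStrong hα z hν h.1 x).2 h.2
  · choose V hV huniq using fun p : HDiv (2 * α) × C(ℝ≥0, HDiv (2 * α)) =>
      existsUnique_solvesMild hα p.2 hν p.1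
    refine ⟨V, fun x z => ?_, ?_, fun T R _ _ => ?_⟩
    · have h := hV (x, z)
      have hc := h.inClass hα z hν
      exact ⟨hc, h, (solvesMild_iff_solvesStrong hα z hν hc x).1 h⟩
    -- The zero curve is a mild solution for zero data, and the solution is unique.
    · exact (huniq (0, 0) 0 (solvesMild_zero hα hν)).symm
    · obtain ⟨C, hC, H⟩ := solvesMild_lipschitz hα hν T R
      exact ⟨C, hC, fun x₁ x₂ z₁ z₂ => H x₁ x₂ z₁ z₂ _ _ (hV _) (hV _)⟩
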